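/- A chore allocation instance consists of agents $N=[n]$, chores $M=[m]$ and disutilities $d_i(j)\in\mathbb R_{\ge 0}$ for $i\in N$, $j\in M$, extended additively to sets by $d_i(S)=\sum_{j\in S}d_i(j)$. It is bivalued if there are real numbers $a,b\ge 0$ with $d_i(j)\in\{a,b\}$ for all $i\in N$ and $j\in M$. An allocation is a partition $\mathbf x=(\mathbf x_1,\dots,\mathbf x_n)$ of $M$ into (possibly empty) bundles. It is EFX (envy-free up to any chore) if $d_i(\mathbf x_i\setminus\{j\})\le d_i(\mathbf x_h)$ for all $i,h\in N$ and all $j\in\mathbf x_i$. It is fPO (fractionally Pareto-optimal) if there is no fractional allocation $\mathbf y\in[0,1]^{n\times m}$ with $\sum_{i}y_{ij}=1$ for all $j\in M$ such that $\sum_j d_i(j)\,y_{ij}\le d_i(\mathbf x_i)$ for all $i\in N$, with strict inequality for at least one $i$. **Theorem.** For every bivalued chore allocation instance with three agents, an allocation that is both EFX and fPO exists. Moreover, such an allocation can be computed in strongly polynomial time: there is a single program for a random access machine with exact real arithmetic (each operation $+,-,\times,\div$ or comparison on numbers, and each load, store or index operation, costs one step) that, on every bivalued instance with three agents and $m$ chores,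 given by the table of its disutilities, halts with an EFX and fPO allocation after a number of steps bounded by a polynomial in $m$ alone; and if the disutilities are rational, the encoding lengths of all numbers that occur during the computation are bounded by a polynomial in the encoding length of the instance. -/

import Mathlib

/-! ### Chore allocation -/

/-- A chore allocation instance with agents `Fin n`, chores `Fin m` and additive disutilities:
`d i j` is the disutility that chore `j` causes to agent `i`. -/
structure ChoreInstance (n m : ℕ) where
  d : Fin n → Fin m → ℝ
  d_nonneg : ∀ i j, 0 ≤ d i j

/-- An (integral) allocation: every chore `j` goes to exactly one agent `x j`. -/
abbrev Allocation (n m : ℕ) : Type := Fin m → Fin n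

/-- The bundle of agent `i`. -/
def Allocation.bundle {n m : ℕ} (x : Allocation n m) (i : Fin n) : Finset (Fin m) :=
  Finset.univ.filter (fun j => x j = i)

/-- A fractional allocation: `y i j` is the fraction of chore `j` that agent `i` performs, and
every chore is allocated completely. -/
structure IsFractionalAllocation {n m : ℕ} (y : Fin n → Fin m → ℝ) : Prop where
  mem_Icc : ∀ i j, y i j ∈ Set.Icc (0 : ℝ) 1
  sum_eq_one : ∀ j, ∑ i, y i j = 1

namespace ChoreInstance

variable {n m : ℕ}

/-- The disutility of agent `i` for the set `S` of chores. -/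
noncomputable def cost (I : ChoreInstance n m) (i : Fin n) (S : Finset (Fin m)) : ℝ :=
  ∑ j ∈ S, I.d i j

/-- The disutility of agent `i` under the fractional allocation `y`. -/
noncomputable def fracCost (I : ChoreInstance n m) (i : Fin n) (y : Fin n → Fin m → ℝ) : ℝ :=
  ∑ j, I.d i j * y i j

/-- All disutilities of single chores lie in `{a, b}`, with the same `a, b` for all agents. -/
def Bivalued (I : ChoreInstance n m) : Prop :=
  ∃ a b : ℝ, 0 ≤ a ∧ 0 ≤ b ∧ ∀ i j, I.d i j = a ∨ I.d i j = b

/-- Envy-freeness up to any chore. -/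
def EFX (I : ChoreInstance n m) (x : Allocation n m) : Prop :=
  ∀ i h : Fin n, ∀ j ∈ x.bundle i, I.cost i ((x.bundle i).erase j) ≤ I.cost i (x.bundle h)

/-- The fractional allocation `y` dominates the allocation `x`. -/
def FracDominates (I : ChoreInstance n m) (y : Fin n → Fin m → ℝ) (x : Allocation n m) : Prop :=
  (∀ i, I.fracCost i y ≤ I.cost i (x.bundle i)) ∧
    ∃ h, I.fracCost h y < I.cost h (x.bundle h)

/-- Fractional Pareto-optimality of an allocation. -/
def FPO (I : ChoreInstance n m) (x : Allocation n m) : Prop :=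
  ¬ ∃ y : Fin n → Fin m → ℝ, IsFractionalAllocation y ∧ I.FracDominates y x

end ChoreInstance

/-! ### A random access machine with real arithmetic

Two kinds of data are kept apart: natural numbers, used for counters, indices and the output, and
real numbers, on which the machine can only do field arithmetic and comparisons (no rounding). For
each kind there are registers, which a program names directly, and a memory, which is accessed
only by loading and storing at an address held in a register. A program is a fixed finite text,
the same for all inputs, and every elementary operation or test costs one step. -/

namespace RAM

/-- The contents of the machine's registers and memories. -/
structure State where
  natReg : ℕ → ℕ
  natMem : ℕ → ℕ
  realReg : ℕ → ℝ
  realMem : ℕ → ℝ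

/-- Elementary operations. Arguments are names of registers, except for the constants `c`. -/
inductive Op where
  | natConst (r c : ℕ)
  | natAdd (r s t : ℕ)
  | natSub (r s t : ℕ)
  | natLoad (r addr : ℕ)
  | natStore (addr s : ℕ)
  | realConst (r : ℕ) (c : ℚ)
  | realAdd (r s t : ℕ)
  | realSub (r s t : ℕ)
  | realMul (r s t : ℕ)
  | realDiv (r s t : ℕ)
  | realLoad (r addr : ℕ)
  | realStore (addr s : ℕ)

/-- The effect of an elementary operation. Subtraction of naturals is truncated, and division of
reals by zero returns zero. -/
noncomputable def Op.exec : Op → State → State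
  | .natConst r c, σ => { σ with natReg := Function.update σ.natReg r c }
  | .natAdd r s t, σ =>
      { σ with natReg := Function.update σ.natReg r (σ.natReg s + σ.natReg t) }
  | .natSub r s t, σ =>
      { σ with natReg := Function.update σ.natReg r (σ.natReg s - σ.natReg t) }
  | .natLoad r addr, σ =>
      { σ with natReg := Function.update σ.natReg r (σ.natMem (σ.natReg addr)) }
  | .natStore addr s, σ =>
      { σ with natMem := Function.update σ.natMem (σ.natReg addr) (σ.natReg s) }
  | .realConst r c, σ => { σ with realReg := Function.update σ.realReg r (c : ℝ) }
  | .realAdd r s t, σ =>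
      { σ with realReg := Function.update σ.realReg r (σ.realReg s + σ.realReg t) }
  | .realSub r s t, σ =>
      { σ with realReg := Function.update σ.realReg r (σ.realReg s - σ.realReg t) }
  | .realMul r s t, σ =>
      { σ with realReg := Function.update σ.realReg r (σ.realReg s * σ.realReg t) }
  | .realDiv r s t, σ =>
      { σ with realReg := Function.update σ.realReg r (σ.realReg s / σ.realReg t) }
  | .realLoad r addr, σ =>
      { σ with realReg := Function.update σ.realReg r (σ.realMem (σ.natReg addr)) }
  | .realStore addr s, σ =>
      { σ with realMem := Function.update σ.realMem (σ.natReg addr) (σ.realReg s) }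

/-- Tests: comparison of two registers. -/
inductive Test where
  | natLE (r s : ℕ)
  | realLE (r s : ℕ)

/-- The outcome of a test. -/
def Test.Holds : Test → State → Prop
  | .natLE r s, σ => σ.natReg r ≤ σ.natReg s
  | .realLE r s, σ => σ.realReg r ≤ σ.realReg s

/-- Programs. -/
inductive Program where
  | skip
  | op (o : Op)
  | seq (P Q : Program)
  | ite (b : Test) (P Q : Program)
  | while (b : Test) (P : Program)

/-- A configuration: the list of program parts that remain to be executed, and the state. The
machine has halted when the list is empty. -/
abbrev Config : Type := List Program × State

open Classical in
/-- One step of the machine. -/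
noncomputable def step : Config → Config
  | ([], σ) => ([], σ)
  | (.skip :: k, σ) => (k, σ)
  | (.op o :: k, σ) => (k, o.exec σ)
  | (.seq P Q :: k, σ) => (P :: Q :: k, σ)
  | (.ite b P Q :: k, σ) => if b.Holds σ then (P :: k, σ) else (Q :: k, σ)
  | (.while b P :: k, σ) => if b.Holds σ then (P :: .while b P :: k, σ) else (k, σ)

/-- The configuration after `t` steps of program `P` started in state `σ`. -/
noncomputable def runFor (P : Program) (σ : State) (t : ℕ) : Config :=
  step^[t] ([P], σ)

/-- The number of binary digits in numerator and denominator of a rational number. -/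
def ratSize (q : ℚ) : ℕ := Nat.size q.num.natAbs + Nat.size q.den

/-- Every number in the state is a natural or rational number of encoding length at most `B`. -/
structure State.FitsIn (σ : State) (B : ℕ) : Prop where
  natReg : ∀ r, Nat.size (σ.natReg r) ≤ B
  natMem : ∀ r, Nat.size (σ.natMem r) ≤ B
  realReg : ∀ r, ∃ q : ℚ, σ.realReg r = (q : ℝ) ∧ ratSize q ≤ B
  realMem : ∀ r, ∃ q : ℚ, σ.realMem r = (q : ℝ) ∧ ratSize q ≤ B

/-- The initial state for a chore allocation instance: the registers `0` and `1` for naturals hold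
`n` and `m`, address `n * j + i` of the memory for reals holds `d i j`, all else is zero. -/
noncomputable def initState {n m : ℕ} (I : ChoreInstance n m) : State where
  natReg r := if r = 0 then n else if r = 1 then m else 0
  natMem _ := 0
  realReg _ := 0
  realMem k := if h : 0 < n ∧ k / n < m then
    I.d ⟨k % n, Nat.mod_lt k h.1⟩ ⟨k / n, h.2⟩ else 0

/-- The memory for naturals encodes the allocation `x`: address `j` holds the agent who receives
chore `j`. -/
def State.Encodes {n m : ℕ} (σ : State) (x : Allocation n m) : Prop :=
  ∀ j : Fin m, σ.natMem j = (x j : ℕ)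

/-- The encoding length of an instance with rational disutilities `D`. -/
def inputSize {n m : ℕ} (D : Fin n → Fin m → ℚ) : ℕ :=
  n + m + ∑ i, ∑ j, ratSize (D i j)

/-- The program `P` computes, in strongly polynomial time, for every instance of the class `C` an
allocation that satisfies `S`:
* on every instance of `C` with `n` agents and `m` chores (with arbitrary real disutilities) `P`
  halts after a number of steps polynomial in `n` and `m`, with such an allocation as its output;
* if the disutilities are rational, all numbers that occur during the computation have encoding
  length polynomial in the encoding length of the instance. -/
def ComputesInStronglyPolyTime (P : Program) (C : ∀ n m : ℕ, ChoreInstance n m → Prop)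
    (S : ∀ n m : ℕ, ChoreInstance n m → Allocation n m → Prop) : Prop :=
  (∃ p : Polynomial ℕ, ∀ (n m : ℕ) (I : ChoreInstance n m), C n m I →
    ∃ t ≤ p.eval (n + m), ∃ x : Allocation n m,
      (runFor P (initState I) t).1 = [] ∧ (runFor P (initState I) t).2.Encodes x ∧ S n m I x) ∧
  (∃ q : Polynomial ℕ, ∀ (n m : ℕ) (I : ChoreInstance n m), C n m I →
    ∀ D : Fin n → Fin m → ℚ, (∀ i j, I.d i j = (D i j : ℝ)) →
      ∀ t, (runFor P (initState I) t).2.FitsIn (q.eval (inputSize D)))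

end RAM

namespace Chores

/-! ### Counting solutions by types of chores -/


open Finset

/-! Let `a < b` be the two costs and call a chore low for an agent if it costs her `a`. Then only
the type of a chore matters: the set of agents for whom it is low. An allocation is fPO as soon as
positive weights exist under which every chore goes to an agent of minimal weighted cost
(`fpo_of_weights`). The weights `1` and `b / a` suffice here; weighted costs are then `a` times
powers of `b / a`, and minimality becomes a comparison of the exponents `lev`. So a solution is a
matrix of numbers of chores per type and agent (`CountSol`), and any choice of chores inside a type
realises it.

For `0 < a`, scale to costs `1` and `k = b / a > 1` and suppose that there is no solution (`solv`).
Among the divisions with equal weights take a minimizer of `Phi`, a sum of squared costs in which an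
agent who has private chores (low for her only) is charged `k - 1` extra. This charge turns the
slack `k` of an exchange of a costly chore into the slack `1` that EFX demands of an owner of cheap
chores; on the envied side it is harmless, since others see a private chore at cost `k`. Exchange
arguments show that if agent `1` still violates EFX towards `3`, then none of her chores is low for
both, and she does not hold both private and costly chores (`IsMin.of_envy`). Each remaining
configuration yields a solution: - If `1` holds nothing low for `2`, she keeps her private chores at
a raised weight and the other two redivide the rest (`IsMin.single`). - If she holds chores low for
`1` and `2` only, the remedy depends on who has costly chores (`IsMin.pair_low`,
`IsMin.pair_high_two`, `IsMin.pair_high_one`): rebalance the pair, raise one or both of their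
weights, or let `3` take one more costly chore.

Hence the minimizer itself is a solution with equal weights.

Raised weights rest on two-agent divisions (`exists_out`), which are either balanced or let one
agent pass on surplus chores that are low for her alone of the two. If agent `1` with her private
chores is envious, she releases them one by one to the others, who redivide each time. Once her envy
ends, `Out.next` shows that they do not envy her either (`solv_of_envy`).

For `a = 0` all weights are equal and only the chores that are high for all need care
(`countSol_zero_one`).

For the algorithm, a solution is described by two index thresholds for each of the eight types and
three weight bits. Exhaustive search over 19 registers with values up to `m + 1` takes polynomially
many rounds, each a scan of the chores. The program only adds, subtracts, compares and moves
numbers, so each step adds at most one binary digit over a fixed common denominator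
(`fitsIn_of_tame`). -/

/-- The type of a chore: for each of the three agents, whether the chore has the low cost. -/
abbrev Typ : Type := Bool × Bool × Bool

/-- Whether chores of type `L` are low for agent `i`. -/
def low (L : Typ) (i : Fin 3) : Bool := ![L.1, L.2.1, L.2.2] i

/-- The cost of a chore of type `L` for agent `i`. -/
noncomputable def val (a b : ℝ) (L : Typ) (i : Fin 3) : ℝ := if low L i then a else b

/-- The logarithmic weighted cost of a chore of type `L` for agent `i`, when the agents
`i` with `lam i` have a raised weight. -/
def lev (lam : Fin 3 → Bool) (L : Typ) (i : Fin 3) : ℕ :=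
  (if lam i then 1 else 0) + (if low L i then 0 else 1)

/-- The cost for agent `i` of the bundle of agent `h`, when `X L h` chores of type `L` are
assigned to `h`. -/
noncomputable def ccost (a b : ℝ) (X : Typ → Fin 3 → ℕ) (i h : Fin 3) : ℝ :=
  ∑ L, (X L h : ℝ) * val a b L i

/-- A solution of the instance with `N L` chores of type `L`, in terms of numbers of chores. -/
def CountSol (a b : ℝ) (N : Typ → ℕ) : Prop :=
  ∃ (lam : Fin 3 → Bool) (X : Typ → Fin 3 → ℕ), (a = 0 → ∀ i, lam i = false) ∧
    (∀ L, X L 0 + X L 1 + X L 2 = N L) ∧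
    (∀ L i, 0 < X L i → ∀ h, lev lam L i ≤ lev lam L h) ∧
    ∀ i h L, 0 < X L i → ccost a b X i i - val a b L i ≤ ccost a b X i h

theorem CountSol.scale {a b c : ℝ} {N : Typ → ℕ} (hc0 : 0 < c) (h : CountSol a b N) :
    CountSol (c * a) (c * b) N := by
  obtain ⟨lam, X, h1, h2, h3, h4⟩ := h
  have hv : ∀ L i, val (c * a) (c * b) L i = c * val a b L i := by
    intro L i; unfold val; split_ifs <;> rfl
  have hc : ∀ i h, ccost (c * a) (c * b) X i h = c * ccost a b X i h := by
    intro i h; simp only [ccost, hv, mul_sum]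
    exact sum_congr rfl fun _ _ => by ring
  refine ⟨lam, X, fun h => h1 ((mul_eq_zero.1 h).resolve_left hc0.ne'), h2, h3, fun i h L hL => ?_⟩
  rw [hv, hc, hc, ← mul_sub]
  exact mul_le_mul_of_nonneg_left (h4 i h L hL) hc0.le

theorem sum_typ {M : Type*} [AddCommMonoid M] (f : Typ → M) : ∑ L, f L =
    f (true, true, true) + f (true, true, false) + (f (true, false, true) + f (true, false, false))
    + (f (false, true, true) + f (false, true, false)
    + (f (false, false, true) + f (false, false, false))) := by
  simp [Fintype.sum_prod_type]

/-- Everything in `CountSol` is invariant under renaming the agents. The two transpositions derived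
from this generate all permutations, so later arguments may fix who envies whom. -/
theorem countSol_equiv {a b : ℝ} {N : Typ → ℕ} (e : Typ ≃ Typ) (s : Fin 3 ≃ Fin 3)
    (he : ∀ L i, low (e L) (s i) = low L i) (h : CountSol a b N) :
    CountSol a b (fun L => N (e.symm L)) := by
  obtain ⟨lam, X, h1, h2, h3, h4⟩ := h
  have hlow : ∀ L i, low (e.symm L) (s.symm i) = low L i := fun L i => by
    rw [← he, e.apply_symm_apply, s.apply_symm_apply]
  have hlev : ∀ L i, lev (fun i => lam (s.symm i)) L i = lev lam (e.symm L) (s.symm i) := by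
    intro L i; simp only [lev, hlow]
  have hval : ∀ L i, val a b L i = val a b (e.symm L) (s.symm i) := by
    intro L i; simp only [val, hlow]
  have hc : ∀ i h, ccost a b (fun L i => X (e.symm L) (s.symm i)) i h
      = ccost a b X (s.symm i) (s.symm h) := by
    intro i h
    simp only [ccost, hval _ i]
    exact Equiv.sum_comp e.symm (fun L => (X L (s.symm h) : ℝ) * val a b L (s.symm i))
  refine ⟨fun i => lam (s.symm i), fun L i => X (e.symm L) (s.symm i), fun h i => h1 h _, ?_, ?_, ?_⟩
  · intro L
    have := Equiv.sum_comp s.symm (fun i => X (e.symm L) i)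
    simp only [Fin.sum_univ_three] at this
    rw [this, h2]
  · intro L i hL h
    rw [hlev, hlev]
    exact h3 _ _ hL _
  · intro i h L hL
    rw [hval, hc, hc]
    exact h4 _ _ _ hL

/-- The numbers of chores of each type, with `H` chores that are high for all. -/
def cnt (a1 a2 a3 b12 b13 b23 g H : ℕ) : Typ → ℕ
  | (true, true, true) => g
  | (true, true, false) => b12
  | (true, false, true) => b13
  | (false, true, true) => b23
  | (true, false, false) => a1
  | (false, true, false) => a2
  | (false, false, true) => a3
  | (false, false, false) => H

theorem CountSol.swap12 {a b : ℝ} {a1 a2 a3 b12 b13 b23 g H : ℕ}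
    (h : CountSol a b (cnt a1 a2 a3 b12 b13 b23 g H)) :
    CountSol a b (cnt a2 a1 a3 b12 b23 b13 g H) := by
  have := countSol_equiv ⟨fun L => (L.2.1, L.1, L.2.2), fun L => (L.2.1, L.1, L.2.2),
    fun _ => rfl, fun _ => rfl⟩ (Equiv.swap 0 1) (by decide) h
  convert this using 1
  funext ⟨x, y, z⟩
  cases x <;> cases y <;> cases z <;> rfl

theorem CountSol.swap23 {a b : ℝ} {a1 a2 a3 b12 b13 b23 g H : ℕ}
    (h : CountSol a b (cnt a1 a2 a3 b12 b13 b23 g H)) :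
    CountSol a b (cnt a1 a3 a2 b13 b12 b23 g H) := by
  have := countSol_equiv ⟨fun L => (L.1, L.2.2, L.2.1), fun L => (L.1, L.2.2, L.2.1),
    fun _ => rfl, fun _ => rfl⟩ (Equiv.swap 1 2) (by decide) h
  convert this using 1
  funext ⟨x, y, z⟩
  cases x <;> cases y <;> cases z <;> rfl

/-- Solvability of an instance with costs `1` and `k`, given by the numbers of its chores:
`ai` chores are low for `i` only, `bij` for `i` and `j` only, `g` for all, and `H` for none. -/
def Solv (k : ℝ) (a1 a2 a3 b12 b13 b23 g H : ℕ) : Prop :=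
  CountSol 1 k (cnt a1 a2 a3 b12 b13 b23 g H)

theorem Solv.swap12 {k : ℝ} {a1 a2 a3 b12 b13 b23 g H : ℕ}
    (h : Solv k a1 a2 a3 b12 b13 b23 g H) : Solv k a2 a1 a3 b12 b23 b13 g H :=
  CountSol.swap12 h

theorem Solv.swap23 {k : ℝ} {a1 a2 a3 b12 b13 b23 g H : ℕ}
    (h : Solv k a1 a2 a3 b12 b13 b23 g H) : Solv k a1 a3 a2 b13 b12 b23 g H :=
  CountSol.swap23 h

/-! ### Realising numbers of chores by thresholds -/

/-- The allocation that, among the chores of type `L`, gives those with index below `u L` to agent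
`0`, the further ones below `v L` to agent `1`, and the rest to agent `2`. -/
def thresh {m : ℕ} (ty : Fin m → Typ) (u v : Typ → ℕ) : Allocation 3 m := fun j =>
  if (j : ℕ) < u (ty j) then 0 else if (j : ℕ) < v (ty j) then 1 else 2

/-- A discrete intermediate value argument: raising the threshold by one adds at most one element.
-/
theorem exists_card_lt {m : ℕ} (S : Finset (Fin m)) (c : ℕ) (hc : c ≤ #S) :
    ∃ u ≤ m, #{j ∈ S | j.val < u} = c := by
  have key : ∀ t : ℕ, c ≤ #{j ∈ S | j.val < t} → ∃ u ≤ t, #{j ∈ S | j.val < u} = c := by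
    intro t
    induction t with
    | zero => intro h; exact ⟨0, le_rfl, by simp at h ⊢; omega⟩
    | succ t ih =>
      intro h
      by_cases h' : c ≤ #{j ∈ S | j.val < t}
      · obtain ⟨u, hu, e⟩ := ih h'
        exact ⟨u, by omega, e⟩
      · refine ⟨t + 1, le_rfl, le_antisymm ?_ h⟩
        have : #{j ∈ S | j.val < t + 1} ≤ #{j ∈ S | j.val < t} + 1 := by
          calc #{j ∈ S | j.val < t + 1}
              ≤ #({j ∈ S | j.val < t} ∪ {j ∈ S | j.val = t}) := by
                apply card_le_card; intro j hj
                rw [mem_filter] at hj; rw [mem_union, mem_filter, mem_filter]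
                rcases Nat.lt_succ_iff_lt_or_eq.1 hj.2 with h | h
                exacts [Or.inl ⟨hj.1, h⟩, Or.inr ⟨hj.1, h⟩]
            _ ≤ _ := (card_union_le _ _).trans (Nat.add_le_add_left (by
                rw [card_le_one]; intro x hx y hy
                simp only [mem_filter] at hx hy; exact Fin.ext (by omega)) _)
        omega
  obtain ⟨u, hu, e⟩ := key m (by simpa using hc)
  exact ⟨u, hu, e⟩

/-- Chores of one type are interchangeable, so each type may be cut into three consecutive pieces.
This makes the search space polynomial. -/
theorem exists_thresh {m : ℕ} (ty : Fin m → Typ) (X : Typ → Fin 3 → ℕ)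
    (hX : ∀ L, X L 0 + X L 1 + X L 2 = #{j | ty j = L}) :
    ∃ u v : Typ → ℕ, (∀ L, u L ≤ m ∧ v L ≤ m) ∧
      ∀ L i, #{j | ty j = L ∧ thresh ty u v j = i} = X L i := by
  have h1 : ∀ L, ∃ u ≤ m, #{j ∈ ({j | ty j = L} : Finset (Fin m)) | j.val < u} = X L 0 :=
    fun L => exists_card_lt _ _ (by rw [← hX L]; omega)
  have h2 : ∀ L, ∃ v ≤ m, #{j ∈ ({j | ty j = L} : Finset (Fin m)) | j.val < v}
      = X L 0 + X L 1 :=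
    fun L => exists_card_lt _ _ (by rw [← hX L]; omega)
  choose u hu hu' using h1
  choose v hv hv' using h2
  have e0 : ∀ L, #{j | ty j = L ∧ thresh ty u v j = 0} = X L 0 := by
    intro L
    rw [← hu' L, filter_filter]
    refine congrArg card (filter_congr fun j _ => ?_)
    unfold thresh
    constructor
    · rintro ⟨rfl, h⟩; refine ⟨rfl, ?_⟩; by_contra h'; rw [if_neg h'] at h; split_ifs at h <;> simp at h
    · rintro ⟨rfl, h⟩; exact ⟨rfl, if_pos h⟩
  have e1 : ∀ L, #{j | ty j = L ∧ thresh ty u v j = 1} = X L 1 := by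
    intro L
    have hm : ∀ j, (ty j = L ∧ thresh ty u v j = 1) ↔
        (ty j = L ∧ ¬ (j : ℕ) < u L ∧ (j : ℕ) < v L) := by
      intro j
      constructor
      · rintro ⟨rfl, h⟩; refine ⟨rfl, ?_⟩; unfold thresh at h
        split_ifs at h with h1 h2 <;> simp_all
      · rintro ⟨rfl, h, h'⟩; refine ⟨rfl, ?_⟩; simp [thresh, h, h']
    simp only [hm]
    have hu'' := hu' L
    have hv'' := hv' L
    rw [filter_filter] at hu'' hv''
    rcases le_total (u L) (v L) with h | h
    · have : #({j | ty j = L ∧ (j : ℕ) < v L} : Finset (Fin m)) =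
          #({j | ty j = L ∧ (j : ℕ) < u L} : Finset (Fin m)) +
          #({j | ty j = L ∧ ¬ (j : ℕ) < u L ∧ (j : ℕ) < v L} : Finset (Fin m)) := by
        rw [← card_union_of_disjoint]
        · congr 1; ext j; simp only [mem_filter, mem_union, mem_univ, true_and]
          by_cases h1 : ty j = L <;> simp [h1]; omega
        · rw [disjoint_left]; intro j; simp only [mem_filter, mem_univ, true_and]; tauto
      omega
    -- With `v L ≤ u L` the second threshold is ineffective, and the counts force `X L 1 = 0`.
    · have : #({j | ty j = L ∧ (j : ℕ) < v L} : Finset (Fin m)) ≤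
          #({j | ty j = L ∧ (j : ℕ) < u L} : Finset (Fin m)) := by
        apply card_le_card; intro j hj
        simp only [mem_filter, mem_univ, true_and] at hj ⊢; exact ⟨hj.1, by omega⟩
      have h0 : X L 1 = 0 := by omega
      rw [h0, card_eq_zero, filter_eq_empty_iff]
      intro j _; omega
  refine ⟨u, v, fun L => ⟨hu L, hv L⟩, fun L i => ?_⟩
  have htot : #{j | ty j = L} = #{j | ty j = L ∧ thresh ty u v j = 0} +
      #{j | ty j = L ∧ thresh ty u v j = 1} + #{j | ty j = L ∧ thresh ty u v j = 2} := by
    simp only [← filter_filter]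
    rw [card_eq_sum_card_fiberwise (f := thresh ty u v) (t := univ) (by simp), Fin.sum_univ_three]
  have h0 := e0 L
  have h1 := e1 L
  have hX' := hX L
  match i with
  | 0 => exact h0
  | 1 => exact h1
  | 2 => omega

/-! ### From numbers of chores back to allocations -/

section Instance

variable {m : ℕ} (I : ChoreInstance 3 m)

open Classical in
/-- Whether the chore `j` has the globally minimal cost for agent `i`. -/
noncomputable def isLow (i : Fin 3) (j : Fin m) : Bool := decide (∀ i' j', I.d i j ≤ I.d i' j')

/-- The type of the chore `j`. -/
noncomputable def ty (j : Fin m) : Typ := (isLow I 0 j, isLow I 1 j, isLow I 2 j)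

theorem low_ty (i : Fin 3) (j : Fin m) : low (ty I j) i = isLow I i j := by
  fin_cases i <;> rfl

/-- The pattern condition: all chores are assigned to agents with minimal weighted cost. -/
def Compl (lam : Fin 3 → Bool) (x : Allocation 3 m) : Prop :=
  ∀ j h, lev lam (ty I j) (x j) ≤ lev lam (ty I j) h

/-- All weights are equal if the lowest cost is zero. -/
def Adm (lam : Fin 3 → Bool) : Prop :=
  (∃ i j, I.d i j ≤ 0) → ∀ i, lam i = false

variable {I}

/-- Types are defined by comparison with the globally smallest cost, which a program can compute
without knowing `a` and `b`. This still separates the two values, and a strict inequality `a < b`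
can always be arranged. -/
theorem exists_val (hI : I.Bivalued) :
    ∃ a b : ℝ, 0 ≤ a ∧ a < b ∧ ∀ i j, I.d i j = val a b (ty I j) i := by
  obtain ⟨a, b, ha, hb, h⟩ := hI
  simp only [val, low_ty, isLow, decide_eq_true_eq]
  by_cases hall : ∀ i j i' j', I.d i j ≤ I.d i' j'
  · by_cases hm : Nonempty (Fin m)
    · obtain ⟨j0⟩ := hm
      -- All costs are equal, so every chore is low for all and any larger number may play the role
      -- of `b`.
      refine ⟨I.d 0 j0, I.d 0 j0 + 1, I.d_nonneg _ _, by linarith, fun i j => ?_⟩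
      rw [if_pos (hall i j)]
      exact le_antisymm (hall _ _ _ _) (hall _ _ _ _)
    · exact ⟨0, 1, le_rfl, one_pos, fun i j => absurd ⟨j⟩ hm⟩
  · push Not at hall
    obtain ⟨i1, j1, i2, j2, hlt⟩ := hall
    have hne : min a b < max a b := by
      rcases h i1 j1 with e1 | e1 <;> rcases h i2 j2 with e2 | e2 <;> rw [e1, e2] at hlt
      · exact absurd hlt (lt_irrefl _)
      · simp [hlt]
      · simp [hlt]
      · exact absurd hlt (lt_irrefl _)
    have hv : ∀ i j, I.d i j = min a b ∨ I.d i j = max a b := by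
      intro i j
      rcases le_total a b with hab | hab
      · rw [min_eq_left hab, max_eq_right hab]; exact h i j
      · rw [min_eq_right hab, max_eq_left hab]; exact (h i j).symm
    refine ⟨min a b, max a b, le_min ha hb, hne, fun i j => ?_⟩
    have h2 : I.d i2 j2 = min a b := by
      rcases hv i2 j2 with e | e
      · exact e
      · rcases hv i1 j1 with e' | e' <;> rw [e, e'] at hlt
        · exact absurd hlt (not_lt.2 hne.le)
        · exact absurd hlt (lt_irrefl _)
    split_ifs with hl
    · rcases hv i j with e | e
      · exact e
      · have := hl i2 j2; rw [e, h2] at this; linarith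
    · rcases hv i j with e | e
      · exfalso; apply hl; intro i' j'; rw [e]
        rcases hv i' j' with e' | e' <;> rw [e']
        exact hne.le
      · exact e

/-- Choosing a cheapest agent for every chore minimizes the total weighted cost even over fractional
allocations, whereas a dominating allocation would make that total smaller. -/
theorem fpo_of_weights {n : ℕ} {I : ChoreInstance n m} {x : Allocation n m} (w : Fin n → ℝ)
    (hw : ∀ i, 0 < w i) (h : ∀ j i, w (x j) * I.d (x j) j ≤ w i * I.d i j) : I.FPO x := by
  rintro ⟨y, hy, hle, i0, hlt⟩
  have h1 : ∑ i, w i * I.fracCost i y < ∑ i, w i * I.cost i (x.bundle i) :=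
    sum_lt_sum (fun i _ => mul_le_mul_of_nonneg_left (hle i) (hw i).le)
      ⟨i0, mem_univ _, mul_lt_mul_of_pos_left hlt (hw i0)⟩
  have h2 : ∑ i, w i * I.cost i (x.bundle i) = ∑ j, w (x j) * I.d (x j) j := by
    rw [← sum_fiberwise univ x (fun j => w (x j) * I.d (x j) j)]
    refine sum_congr rfl fun i _ => ?_
    rw [ChoreInstance.cost, mul_sum]
    refine sum_congr rfl fun j hj => ?_
    simp only [mem_filter] at hj
    rw [hj.2]
  have h3 : ∑ i, w i * I.fracCost i y = ∑ j, ∑ i, w i * I.d i j * y i j := by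
    rw [sum_comm]
    refine sum_congr rfl fun i _ => ?_
    rw [ChoreInstance.fracCost, mul_sum]
    exact sum_congr rfl fun j _ => by ring
  have h4 : ∑ j, w (x j) * I.d (x j) j ≤ ∑ j, ∑ i, w i * I.d i j * y i j := by
    refine sum_le_sum fun j _ => ?_
    calc w (x j) * I.d (x j) j = ∑ i, w (x j) * I.d (x j) j * y i j := by
          rw [← mul_sum, hy.sum_eq_one, mul_one]
      _ ≤ _ := sum_le_sum fun i _ => mul_le_mul_of_nonneg_right (h j i) (hy.mem_Icc i j).1
  linarith

theorem Compl.fpo (hI : I.Bivalued) {lam : Fin 3 → Bool} {x : Allocation 3 m}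
    (hc : Compl I lam x) (ha : Adm I lam) : I.FPO x := by
  obtain ⟨a, b, ha0, hab, hd⟩ := exists_val hI
  rcases isEmpty_or_nonempty (Fin m) with hm | ⟨⟨j0⟩⟩
  · exact fpo_of_weights (fun _ => 1) (fun _ => one_pos) fun j => hm.elim j
  rcases ha0.eq_or_lt with rfl | hpos
  · by_cases hz : ∃ i j, I.d i j ≤ 0
    · have hl := ha hz
      refine fpo_of_weights (fun _ => 1) (fun _ => one_pos) fun j i => ?_
      have := hc j i
      simp only [lev, hl] at this
      simp only [hd, val, one_mul]
      split_ifs at this ⊢ <;> linarith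
    -- Here `a = 0` is never attained: all costs equal `b`, and equal weights work whatever `lam`
    -- says.
    · push Not at hz
      refine fpo_of_weights (fun _ => 1) (fun _ => one_pos) fun j i => ?_
      have h1 := hz i j
      have h2 := hz (x j) j
      simp only [hd, val, one_mul] at h1 h2 ⊢
      split_ifs at h1 h2 ⊢ <;> linarith
  · have hk : 1 ≤ b / a := by rw [le_div_iff₀ hpos]; linarith
    refine fpo_of_weights (fun i => if lam i then b / a else 1)
      (fun i => by split_ifs <;> linarith) fun j i => ?_
    -- `lev` is the logarithm to base `b / a` of the weighted cost divided by `a`.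
    have key : ∀ i, (if lam i then b / a else 1) * I.d i j = a * (b / a) ^ lev lam (ty I j) i := by
      intro i
      have e : a * (b / a) = b := by field_simp
      have e2 : b / a * b = a * (b / a) ^ 2 := by field_simp
      rw [hd, val, lev]
      split_ifs <;> norm_num
      · rw [mul_comm]
      · exact e2
      · exact e.symm
    rw [key, key]
    exact mul_le_mul_of_nonneg_left (pow_le_pow_right₀ hk (hc j i)) hpos.le

theorem CountSol.exists_thresh {a b : ℝ} (hab : a < b)
    (hd : ∀ i j, I.d i j = val a b (ty I j) i) (hs : CountSol a b fun L => #{j | ty I j = L})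
    (ha0 : 0 ≤ a) :
    ∃ (lam : Fin 3 → Bool) (u v : Typ → ℕ), Adm I lam ∧ (∀ L, u L ≤ m ∧ v L ≤ m) ∧
      Compl I lam (thresh (ty I) u v) ∧ I.EFX (thresh (ty I) u v) := by
  obtain ⟨lam, X, hadm, hrow, hc, hefx⟩ := hs
  obtain ⟨u, v, huv, hX⟩ := Chores.exists_thresh (ty I) X hrow
  have hpos : ∀ j, 0 < X (ty I j) (thresh (ty I) u v j) := by
    intro j
    rw [← hX, card_pos]
    exact ⟨j, by simp⟩
  have hcost : ∀ i h, I.cost i ((thresh (ty I) u v).bundle h) = ccost a b X i h := by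
    intro i h
    rw [ChoreInstance.cost, ccost, ← sum_fiberwise _ (ty I)]
    refine sum_congr rfl fun L _ => ?_
    rw [← hX L h, ← nsmul_eq_mul, Allocation.bundle, filter_filter]
    rw [sum_congr rfl (g := fun _ => val a b L i), sum_const]
    · congr 2; ext j; simp [and_comm]
    · intro j hj; simp only [mem_filter] at hj; rw [hd, hj.2.2]
  refine ⟨lam, u, v, ?_, huv, fun j h => hc _ _ (hpos j) h, fun i h j hj => ?_⟩
  · rintro ⟨i, j, hij⟩
    apply hadm
    rw [hd, val] at hij
    split_ifs at hij <;> linarith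
  · have hxj : thresh (ty I) u v j = i := by simpa [Allocation.bundle] using hj
    have h1 : I.cost i (((thresh (ty I) u v).bundle i).erase j) =
        I.cost i ((thresh (ty I) u v).bundle i) - I.d i j := by
      simp only [ChoreInstance.cost]; rw [← sum_erase_add _ _ hj]; ring
    rw [h1, hcost, hcost, hd]
    exact hefx i h _ (by rw [← hxj]; exact hpos j)

end Instance

end Chores

namespace Chores

/-! ### Solutions with given weights -/


open Finset

/-- An agent with `c` chores of cost `1` and `h` chores of cost `k` does not envy, up to any
chore, a bundle of cost `D`. -/
def NE (k : ℝ) (c h : ℕ) (D : ℝ) : Prop :=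
  (0 < c → c + k * h - 1 ≤ D) ∧ (0 < h → c + k * h - k ≤ D)

theorem NE.of_le {k : ℝ} {c h : ℕ} {D : ℝ} (hk : 1 ≤ k) (h' : c + k * h - 1 ≤ D) : NE k c h D :=
  ⟨fun _ => h', fun _ => by linarith⟩

theorem NE.mono {k : ℝ} {c h : ℕ} {D D' : ℝ} (h' : NE k c h D) (hD : D ≤ D') : NE k c h D' :=
  ⟨fun hc => (h'.1 hc).trans hD, fun hc => (h'.2 hc).trans hD⟩

/-- The matrix of an allocation, given by its rows. -/
def mat (rg r12 r13 r23 r1 r2 r3 r0 : Fin 3 → ℕ) : Typ → Fin 3 → ℕ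
  | (true, true, true) => rg
  | (true, true, false) => r12
  | (true, false, true) => r13
  | (false, true, true) => r23
  | (true, false, false) => r1
  | (false, true, false) => r2
  | (false, false, true) => r3
  | (false, false, false) => r0

theorem forall_typ {p : Typ → Prop} : (∀ L, p L) ↔
    (p (true, true, true) ∧ p (true, true, false) ∧ p (true, false, true) ∧
    p (true, false, false) ∧ p (false, true, true) ∧ p (false, true, false) ∧
    p (false, false, true) ∧ p (false, false, false)) := by
  simp [Prod.forall, Bool.forall_bool]; tauto

/-- Freedom from envy up to any chore only involves the numbers of low and high chores in the own
bundle, as counted by `NE`, and the cost of the other bundle in the eyes of the envier. -/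
theorem solv_of_mat {k : ℝ} {rg r12 r13 r23 r1 r2 r3 r0 : Fin 3 → ℕ} (hk : 0 ≤ k)
    (lam : Fin 3 → Bool)
    (hc : ∀ L i, 0 < mat rg r12 r13 r23 r1 r2 r3 r0 L i → ∀ h, lev lam L i ≤ lev lam L h)
    (e12 : NE k (r1 0 + r12 0 + r13 0 + rg 0) (r2 0 + r3 0 + r23 0 + r0 0)
      (r1 1 + r12 1 + r13 1 + rg 1 + k * (r2 1 + r3 1 + r23 1 + r0 1)))
    (e13 : NE k (r1 0 + r12 0 + r13 0 + rg 0) (r2 0 + r3 0 + r23 0 + r0 0)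
      (r1 2 + r12 2 + r13 2 + rg 2 + k * (r2 2 + r3 2 + r23 2 + r0 2)))
    (e21 : NE k (r2 1 + r12 1 + r23 1 + rg 1) (r1 1 + r3 1 + r13 1 + r0 1)
      (r2 0 + r12 0 + r23 0 + rg 0 + k * (r1 0 + r3 0 + r13 0 + r0 0)))
    (e23 : NE k (r2 1 + r12 1 + r23 1 + rg 1) (r1 1 + r3 1 + r13 1 + r0 1)
      (r2 2 + r12 2 + r23 2 + rg 2 + k * (r1 2 + r3 2 + r13 2 + r0 2)))
    (e31 : NE k (r3 2 + r13 2 + r23 2 + rg 2) (r1 2 + r2 2 + r12 2 + r0 2)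
      (r3 0 + r13 0 + r23 0 + rg 0 + k * (r1 0 + r2 0 + r12 0 + r0 0)))
    (e32 : NE k (r3 2 + r13 2 + r23 2 + rg 2) (r1 2 + r2 2 + r12 2 + r0 2)
      (r3 1 + r13 1 + r23 1 + rg 1 + k * (r1 1 + r2 1 + r12 1 + r0 1))) :
    Solv k (r1 0 + r1 1 + r1 2) (r2 0 + r2 1 + r2 2) (r3 0 + r3 1 + r3 2)
      (r12 0 + r12 1 + r12 2) (r13 0 + r13 1 + r13 2) (r23 0 + r23 1 + r23 2)
      (rg 0 + rg 1 + rg 2) (r0 0 + r0 1 + r0 2) := by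
  refine ⟨lam, mat rg r12 r13 r23 r1 r2 r3 r0, fun h => absurd h one_ne_zero, ?_, hc, ?_⟩
  · rw [forall_typ]; simp [mat, cnt]
  have hcc : ∀ i h, ccost 1 k (mat rg r12 r13 r23 r1 r2 r3 r0) i h =
      if i = 0 then (r1 h + r12 h + r13 h + rg h + k * (r2 h + r3 h + r23 h + r0 h) : ℝ) else
      if i = 1 then (r2 h + r12 h + r23 h + rg h + k * (r1 h + r3 h + r13 h + r0 h) : ℝ) else
      r3 h + r13 h + r23 h + rg h + k * (r1 h + r2 h + r12 h + r0 h) := by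
    intro i h
    rw [ccost, sum_typ]
    fin_cases i <;> simp [mat, val, low] <;> ring
  have h0 : ∀ L, 0 < mat rg r12 r13 r23 r1 r2 r3 r0 L 0 →
      (val 1 k L 0 = 1 ∧ 0 < r1 0 + r12 0 + r13 0 + rg 0) ∨
      (val 1 k L 0 = k ∧ 0 < r2 0 + r3 0 + r23 0 + r0 0) := by
    rw [forall_typ]; simp [mat, val, low]; omega
  have h1 : ∀ L, 0 < mat rg r12 r13 r23 r1 r2 r3 r0 L 1 →
      (val 1 k L 1 = 1 ∧ 0 < r2 1 + r12 1 + r23 1 + rg 1) ∨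
      (val 1 k L 1 = k ∧ 0 < r1 1 + r3 1 + r13 1 + r0 1) := by
    rw [forall_typ]; simp [mat, val, low]; omega
  have h2 : ∀ L, 0 < mat rg r12 r13 r23 r1 r2 r3 r0 L 2 →
      (val 1 k L 2 = 1 ∧ 0 < r3 2 + r13 2 + r23 2 + rg 2) ∨
      (val 1 k L 2 = k ∧ 0 < r1 2 + r2 2 + r12 2 + r0 2) := by
    rw [forall_typ]; simp [mat, val, low]; omega
  have key : ∀ {c h : ℕ} {D v : ℝ}, NE k c h D → (v = 1 ∧ 0 < c) ∨ (v = k ∧ 0 < h) →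
      (c + k * h : ℝ) - v ≤ D := by
    rintro c h D v hN (⟨rfl, hc⟩ | ⟨rfl, hh⟩)
    exacts [hN.1 hc, hN.2 hh]
  have hv : ∀ L i, 0 ≤ val 1 k L i := by intro L i; unfold val; split_ifs <;> linarith
  intro i h L hL
  fin_cases i <;> fin_cases h
  · exact sub_le_self _ (hv _ _)
  · have := key e12 (h0 L hL); simp only [hcc]; push_cast at this; simpa using this
  · have := key e13 (h0 L hL); simp only [hcc]; push_cast at this; simpa using this
  · have := key e21 (h1 L hL); simp only [hcc]; push_cast at this; simpa using this
  · exact sub_le_self _ (hv _ _)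
  · have := key e23 (h1 L hL); simp only [hcc]; push_cast at this; simpa using this
  · have := key e31 (h2 L hL); simp only [hcc]; push_cast at this; simpa using this
  · have := key e32 (h2 L hL); simp only [hcc]; push_cast at this; simpa using this
  · exact sub_le_self _ (hv _ _)

/-- Solutions in which all agents have the same weight. -/
theorem solv_flat {k : ℝ} (hk : 0 ≤ k) {a1 a2 a3 z12 z21 z13 z31 z23 z32 g1 g2 g3 h1 h2 h3 : ℕ}
    (e12 : NE k (a1 + z12 + z13 + g1) h1 (a2 + z21 + z23 + g2 + k * h2 + (k - 1) * (a2 + z23)))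
    (e13 : NE k (a1 + z12 + z13 + g1) h1 (a3 + z31 + z32 + g3 + k * h3 + (k - 1) * (a3 + z32)))
    (e21 : NE k (a2 + z21 + z23 + g2) h2 (a1 + z12 + z13 + g1 + k * h1 + (k - 1) * (a1 + z13)))
    (e23 : NE k (a2 + z21 + z23 + g2) h2 (a3 + z31 + z32 + g3 + k * h3 + (k - 1) * (a3 + z31)))
    (e31 : NE k (a3 + z31 + z32 + g3) h3 (a1 + z12 + z13 + g1 + k * h1 + (k - 1) * (a1 + z12)))
    (e32 : NE k (a3 + z31 + z32 + g3) h3 (a2 + z21 + z23 + g2 + k * h2 + (k - 1) * (a2 + z21))) :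
    Solv k a1 a2 a3 (z12 + z21) (z13 + z31) (z23 + z32) (g1 + g2 + g3) (h1 + h2 + h3) := by
  -- `zij` chores low for `i` and `j` only are held by `i`. The term with `k - 1` in each hypothesis
  -- corrects for the chores that are low for the envied owner but high for the envier.
  have := solv_of_mat (k := k) hk (rg := ![g1, g2, g3]) (r12 := ![z12, z21, 0])
    (r13 := ![z13, 0, z31]) (r23 := ![0, z23, z32]) (r1 := ![a1, 0, 0]) (r2 := ![0, a2, 0])
    (r3 := ![0, 0, a3]) (r0 := ![h1, h2, h3]) ![false, false, false] ?_ ?_ ?_ ?_ ?_ ?_ ?_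
  · simpa using this
  · rw [forall_typ]; simp [mat, lev, low, Fin.forall_fin_succ]
  · simp; convert e12 using 1; ring
  · simp; convert e13 using 1; ring
  · simp; convert e21 using 1; ring
  · simp; convert e23 using 1; ring
  · simp; convert e31 using 1; ring
  · simp; convert e32 using 1; ring

/-- Solutions in which agent `1` has a raised weight. -/
theorem solv_raise_one {k : ℝ} (hk : 0 ≤ k)
    {u u2 u3 a2 a3 b12 b13 z2 z3 g2 g3 h2 h3 : ℕ}
    (e12 : NE k u 0 (b12 + g2 + u2 + k * (a2 + z2 + h2)))
    (e13 : NE k u 0 (b13 + g3 + u3 + k * (a3 + z3 + h3)))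
    (e21 : NE k (a2 + b12 + z2 + g2) (u2 + h2) (k * u))
    (e23 : NE k (a2 + b12 + z2 + g2) (u2 + h2) (z3 + g3 + k * (a3 + b13 + u3 + h3)))
    (e31 : NE k (a3 + b13 + z3 + g3) (u3 + h3) (k * u))
    (e32 : NE k (a3 + b13 + z3 + g3) (u3 + h3) (z2 + g2 + k * (a2 + b12 + u2 + h2))) :
    Solv k (u + u2 + u3) a2 a3 b12 b13 (z2 + z3) (g2 + g3) (h2 + h3) := by
  -- Only the private chores of agent `1` have level `1` for everybody and can go anywhere; all
  -- other types must avoid her.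
  have := solv_of_mat (k := k) hk (rg := ![0, g2, g3]) (r12 := ![0, b12, 0])
    (r13 := ![0, 0, b13]) (r23 := ![0, z2, z3]) (r1 := ![u, u2, u3]) (r2 := ![0, a2, 0])
    (r3 := ![0, 0, a3]) (r0 := ![0, h2, h3]) ![true, false, false] ?_ ?_ ?_ ?_ ?_ ?_ ?_
  · simpa using this
  · rw [forall_typ]; simp [mat, lev, low, Fin.forall_fin_succ]
  · simp; convert e12 using 1; ring
  · simp; convert e13 using 1; ring
  · simp; convert e21 using 1
  · simp; convert e23 using 1; ring
  · simp; convert e31 using 1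
  · simp; convert e32 using 1; ring

/-- Solutions in which agents `1` and `2` have a raised weight. -/
theorem solv_raise_two {k : ℝ} (hk : 0 ≤ k)
    {u u3 v v3 a3 z1 z2 z3 b13 b23 g H : ℕ}
    (e12 : NE k (u + z1) 0 (z2 + k * v))
    (e13 : NE k (u + z1) 0 (u3 + z3 + b13 + g + k * (v3 + a3 + b23 + H)))
    (e21 : NE k (v + z2) 0 (z1 + k * u))
    (e23 : NE k (v + z2) 0 (v3 + z3 + b23 + g + k * (u3 + a3 + b13 + H)))
    (e31 : NE k (a3 + b13 + b23 + g) (u3 + v3 + z3 + H) (k * (u + z1)))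
    (e32 : NE k (a3 + b13 + b23 + g) (u3 + v3 + z3 + H) (k * (v + z2))) :
    Solv k (u + u3) (v + v3) a3 (z1 + z2 + z3) b13 b23 g H := by
  -- Chores low for `1` and `2` only can now go to all three agents, private chores of `1` or `2` to
  -- their owner or to `3`, and the rest must go to `3`.
  have := solv_of_mat (k := k) hk (rg := ![0, 0, g]) (r12 := ![z1, z2, z3])
    (r13 := ![0, 0, b13]) (r23 := ![0, 0, b23]) (r1 := ![u, 0, u3]) (r2 := ![0, v, v3])
    (r3 := ![0, 0, a3]) (r0 := ![0, 0, H]) ![true, true, false] ?_ ?_ ?_ ?_ ?_ ?_ ?_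
  · simpa using this
  · rw [forall_typ]; simp [mat, lev, low, Fin.forall_fin_succ]
  · simp; convert e12 using 1
  · simp; convert e13 using 1
  · simp; convert e21 using 1
  · simp; convert e23 using 1
  · simp; convert e31 using 1
  · simp; convert e32 using 1

end Chores

namespace Chores

/-! ### Divisions of chores among two agents -/


open Finset

/-- The indicator of `0 < a`. -/
noncomputable def th (a : ℕ) : ℝ := if a = 0 then 0 else 1

theorem th_nonneg (a : ℕ) : 0 ≤ th a := by unfold th; split_ifs <;> norm_num
theorem th_le_one (a : ℕ) : th a ≤ 1 := by unfold th; split_ifs <;> norm_num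
theorem th_le (a : ℕ) : th a ≤ a := by
  unfold th; split_ifs with h
  · simp
  · exact_mod_cast Nat.pos_of_ne_zero h
theorem th_pos {a : ℕ} (h : 0 < a) : th a = 1 := by simp [th, h.ne']
theorem th_zero : th 0 = 0 := by simp [th]

/-- A balanced division among two agents, with `A` and `B` chores that are low for the first and
the second agent only, `f + f'` chores low for both and `e + e'` chores high for both. -/
structure MOut (k : ℝ) (A B C n f f' e e' : ℕ) : Prop where
  hf : f + f' = C
  he : e + e' = n
  hA : (A : ℝ) - 1 ≤ k * B + C + k * n
  hB : (B : ℝ) - 1 ≤ k * A + C + k * n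
  f1 : 0 < f → (A + f + k * e + (k - 1) * th A : ℝ) ≤ B + f' + k * e' + (k - 1) * th B + 1
  e1 : 0 < e → (A + f + k * e + (k - 1) * th A : ℝ) ≤ B + f' + k * e' + (k - 1) * th B + k
  f2 : 0 < f' → (B + f' + k * e' + (k - 1) * th B : ℝ) ≤ A + f + k * e + (k - 1) * th A + 1
  e2 : 0 < e' → (B + f' + k * e' + (k - 1) * th B : ℝ) ≤ A + f + k * e + (k - 1) * th A + k

/-- A division among two agents in which the second one receives `r` chores that are low for the
first one only, and the first one just the `v` others. -/
structure ROut (k : ℝ) (A B C n v r : ℕ) : Prop where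
  hA : v + r = A
  hr : k * B + C + k * n < (A : ℝ) - 1
  h1 : (v : ℝ) - 1 ≤ k * B + C + k * n + r
  h2 : k * B + C + k * n + r - 1 < (v : ℝ)

/-- A division of chores among two agents, in terms of the numbers `c`, `c'` of low chores and
`h`, `h'` of high chores. -/
inductive Out (k : ℝ) (A B C n : ℕ) : ℕ → ℕ → ℕ → ℕ → Prop
  | bal {f f' e e' : ℕ} (h : MOut k A B C n f f' e e') : Out k A B C n (A + f) e (B + f') e'
  | left {v r : ℕ} (h : ROut k A B C n v r) : Out k A B C n v 0 (B + C) (n + r)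
  | right {v r : ℕ} (h : ROut k B A C n v r) : Out k A B C n (A + C) (n + r) v 0

theorem MOut.symm {k : ℝ} {A B C n f f' e e' : ℕ} (h : MOut k A B C n f f' e e') :
    MOut k B A C n f' f e' e :=
  ⟨by have := h.hf; omega, by have := h.he; omega, h.hB, h.hA, h.f2, h.e2, h.f1, h.e1⟩

theorem Out.symm {k : ℝ} {A B C n c h c' h' : ℕ} (H : Out k A B C n c h c' h') :
    Out k B A C n c' h' c h := by
  cases H with
  | bal h => exact .bal h.symm
  | left h => exact .right h
  | right h => exact .left h

theorem exists_rOut {k : ℝ} (hk : 1 < k) {A B C n : ℕ} (h : k * B + C + k * n < (A : ℝ) - 1) :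
    ∃ v r, ROut k A B C n v r := by
  have hk0 : 0 ≤ k := by linarith
  have hD : 0 ≤ k * B + C + k * n := by positivity
  set D := k * B + C + k * n with hDdef
  -- The choice of `v` makes `v` and `D + (A - v)` differ by at most one, where `D` is the cost of
  -- the remaining chores.
  have hfl := Nat.floor_le (a := (D + A + 1) / 2) (by positivity)
  have hfl' := Nat.lt_floor_add_one ((D + A + 1) / 2)
  set v := ⌊(D + A + 1) / 2⌋₊
  have hvA : v ≤ A := by
    have : (v : ℝ) < A := by linarith
    exact_mod_cast this.le
  refine ⟨v, A - v, by omega, h, ?_, ?_⟩ <;> rw [← hDdef] <;> push_cast [hvA] <;> linarith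

/-- Minimize the sum of the two squared modified costs; the four inequalities express that moving a
single shared chore brings no gain. The `A` and `B` chores never move, so `th` is constant
throughout. -/
theorem exists_mOut {k : ℝ} (hk : 1 < k) {A B C n : ℕ} (hA : (A : ℝ) - 1 ≤ k * B + C + k * n)
    (hB : (B : ℝ) - 1 ≤ k * A + C + k * n) : ∃ f f' e e', MOut k A B C n f f' e e' := by
  obtain ⟨⟨f, e⟩, hm, hmin⟩ := exists_min_image (range (C + 1) ×ˢ range (n + 1))
    (fun s => (A + s.1 + k * s.2 + (k - 1) * th A : ℝ) ^ 2 +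
      (B + ((C : ℝ) - s.1) + k * ((n : ℝ) - s.2) + (k - 1) * th B : ℝ) ^ 2) ⟨(0, 0), by simp⟩
  simp only [mem_product, mem_range] at hm
  have key : ∀ f' e' : ℕ, f' ≤ C → e' ≤ n → _ := fun f' e' hf he => hmin (f', e') (by
    simp only [mem_product, mem_range]; omega)
  simp only at key
  obtain ⟨f', hf'⟩ : ∃ f', f + f' = C := ⟨C - f, by omega⟩
  obtain ⟨e', he'⟩ : ∃ e', e + e' = n := ⟨n - e, by omega⟩
  have hC : (C : ℝ) = f + f' := by exact_mod_cast hf'.symm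
  have hn : (n : ℝ) = e + e' := by exact_mod_cast he'.symm
  refine ⟨f, f', e, e', hf', he', hA, hB, fun h => ?_, fun h => ?_, fun h => ?_, fun h => ?_⟩
  · have := key (f - 1) e (by omega) (by omega)
    rw [Nat.cast_sub (by omega), hC, hn] at this
    push_cast at this; nlinarith
  · have := key f (e - 1) (by omega) (by omega)
    rw [Nat.cast_sub (by omega), hC, hn] at this
    push_cast at this
    have h2 : 0 ≤ k * (k - ((A + f + k * e + (k - 1) * th A) -
      (B + f' + k * e' + (k - 1) * th B))) := by nlinarith
    have := nonneg_of_mul_nonneg_right h2 (by linarith); linarith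
  · have := key (f + 1) e (by omega) (by omega)
    rw [hC, hn] at this
    push_cast at this; nlinarith
  · have := key f (e + 1) (by omega) (by omega)
    rw [hC, hn] at this
    push_cast at this
    have h2 : 0 ≤ k * (k - ((B + f' + k * e' + (k - 1) * th B) -
      (A + f + k * e + (k - 1) * th A))) := by nlinarith
    have := nonneg_of_mul_nonneg_right h2 (by linarith); linarith

theorem exists_out {k : ℝ} (hk : 1 < k) (A B C n : ℕ) : ∃ c h c' h', Out k A B C n c h c' h' := by
  by_cases hA : (A : ℝ) - 1 ≤ k * B + C + k * n
  · by_cases hB : (B : ℝ) - 1 ≤ k * A + C + k * n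
    · obtain ⟨f, f', e, e', h⟩ := exists_mOut hk hA hB
      exact ⟨_, _, _, _, .bal h⟩
    · obtain ⟨v, r, h⟩ := exists_rOut hk (not_le.1 hB)
      exact ⟨_, _, _, _, .right h⟩
  · obtain ⟨v, r, h⟩ := exists_rOut hk (not_le.1 hA)
    exact ⟨_, _, _, _, .left h⟩

/-- An agent with exclusive low chores and some costly ones must tolerate the removal of a cheap
chore. The charge `(k - 1) * th A` improves the slack in `e1` from `k` to `1`, and `(k - 1) * th B`
is covered because each of the partner's `B` chores costs her `k`. -/
theorem MOut.ne {k : ℝ} (hk : 1 < k) {A B C n f f' e e' : ℕ} (h : MOut k A B C n f f' e e') :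
    NE k (A + f) e (f' + k * (B + e')) := by
  obtain ⟨hf, he, hA, hB, f1, e1, f2, e2⟩ := h
  have t1 := th_nonneg A
  have t2 := th_le B
  have t3 : (k - 1) * th B ≤ (k - 1) * B := mul_le_mul_of_nonneg_left t2 (by linarith)
  have t4 : 0 ≤ (k - 1) * th A := mul_nonneg (by linarith) t1
  constructor
  · intro hc
    push_cast
    rcases Nat.eq_zero_or_pos f with rfl | hf0
    · rcases Nat.eq_zero_or_pos e with rfl | he0
      · have : f' = C := by omega
        have : e' = n := by omega
        subst f' e'; simp; linarith
      · have := e1 he0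
        rw [th_pos (by omega)] at this
        push_cast at this ⊢; linarith
    · have := f1 hf0; linarith
  · intro he0
    push_cast
    have := e1 he0
    linarith

theorem ROut.ne {k : ℝ} (hk : 1 < k) {A B C n v r : ℕ} (h : ROut k A B C n v r) :
    NE k v 0 (C + r + k * (B + n)) :=
  NE.of_le hk.le (by have := h.h1; push_cast; linarith)

/-- The partner sees all `v` chores at cost `k`, so `h2` multiplied by `k` leaves ample room. -/
theorem ROut.ne' {k : ℝ} (hk : 1 < k) {A B C n v r : ℕ} (h : ROut k A B C n v r) :
    NE k (B + C) (n + r) (k * v) := by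
  obtain ⟨hA, hr, h1, h2⟩ := h
  have hB := Nat.cast_nonneg (α := ℝ) B
  have hC := Nat.cast_nonneg (α := ℝ) C
  have hn := Nat.cast_nonneg (α := ℝ) n
  have hkk : k * (k * B + C + k * n + r - 1) ≤ k * v := mul_le_mul_of_nonneg_left h2.le (by linarith)
  have a1 : k * B ≤ k * k * B := by nlinarith [mul_nonneg hB (by linarith : (0:ℝ) ≤ k)]
  have a2 : (n : ℝ) * k ≤ n * k * k := by nlinarith [mul_nonneg hn (by linarith : (0:ℝ) ≤ k)]
  have a3 : (C : ℝ) ≤ k * C := by nlinarith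
  have a4 : (B : ℝ) ≤ k * B := by nlinarith
  constructor
  · intro h0
    have : (1 : ℝ) ≤ B + C := by exact_mod_cast h0
    push_cast
    nlinarith [mul_nonneg (by linarith : (0:ℝ) ≤ B + C - 1) (by linarith : (0:ℝ) ≤ k - 1)]
  · intro h0
    push_cast
    nlinarith

/-- If one agent exceeded `k * w` by too much, the bound on the total cost or on the number of
chores would leave so little to her partner that the gap contradicts balancedness. -/
theorem MOut.ne_of_total {k : ℝ} (hk : 1 < k) {A B C n f f' e e' w : ℕ}
    (h : MOut k A B C (n + 1) f f' e e')
    (hT : (A + B + C + k * n : ℝ) ≤ 2 * k * w - 2 * k + 1 ∨ A + B + C + n + 1 ≤ 2 * w)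
    (hown : (A : ℝ) - 1 ≤ k * w) : NE k (A + f) e (k * w) := by
  obtain ⟨hf, he, hA, hB, f1, e1, f2, e2⟩ := h
  have hC : (f : ℝ) + f' = C := by exact_mod_cast hf
  have hn : (e : ℝ) + e' = n + 1 := by exact_mod_cast he
  have hkn : k * e + k * e' = k * n + k := by rw [← mul_add, hn]; ring
  have tA := th_nonneg A
  have tA1 := th_le_one A
  have tB1 := th_le_one B
  have t3 : (k - 1) * th B ≤ k - 1 := by nlinarith
  have t4 : 0 ≤ (k - 1) * th A := mul_nonneg (by linarith) tA
  have hitems : (A + f + k * e : ℝ) > k * w → A + B + C + n + 1 ≤ 2 * w →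
      (B + f' + k * e' : ℝ) ≤ k * w - k := by
    intro h1 h2
    have h3 : (A + f + k * e : ℝ) ≤ k * (A + f + e) := by
      have hA := Nat.cast_nonneg (α := ℝ) A
      have hf := Nat.cast_nonneg (α := ℝ) f
      nlinarith
    have h4 : (w : ℝ) < A + f + e := by
      have := h1.trans_le h3
      exact lt_of_mul_lt_mul_left this (by linarith)
    have h5 : w < A + f + e := by exact_mod_cast h4
    have h6 : B + f' + e' + 1 ≤ w := by omega
    have h7 : (B + f' + e' + 1 : ℝ) ≤ w := by exact_mod_cast h6
    have hB := Nat.cast_nonneg (α := ℝ) B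
    have hf := Nat.cast_nonneg (α := ℝ) f'
    nlinarith
  constructor
  · intro h0
    push_cast
    by_contra! hlt
    have hgap : (A + f + k * e : ℝ) - (B + f' + k * e') > k + 1 := by
      rcases hT with hT | hT
      · linarith
      · have := hitems (by linarith) hT; linarith
    rcases Nat.eq_zero_or_pos f with rfl | hf0
    · rcases Nat.eq_zero_or_pos e with rfl | he0
      · push_cast at hlt; linarith
      · have := e1 he0
        rw [th_pos (show 0 < A by omega)] at this
        linarith
    · have := f1 hf0; linarith
  · intro h0
    push_cast
    by_contra! hlt
    have hgap : (A + f + k * e : ℝ) - (B + f' + k * e') > 2 * k := by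
      rcases hT with hT | hT
      · linarith
      · have := hitems (by linarith) hT; linarith
    have := e1 h0
    linarith

/-! ### Redivision among two agents after one more costly chore -/

theorem Out.card {k : ℝ} {A B C n c h c' h' : ℕ} (H : Out k A B C n c h c' h') :
    c + h + (c' + h') = A + B + C + n := by
  cases H with
  | bal H => have := H.hf; have := H.he; omega
  | left H => have := H.hA; omega
  | right H => have := H.hA; omega

theorem Out.total {k : ℝ} (hk : 1 < k) {A B C n c h c' h' : ℕ} (H : Out k A B C n c h c' h') :
    (A + B + C + k * n : ℝ) ≤ c + k * h + (c' + k * h') := by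
  cases H with
  | @bal f f' _ _ H =>
    have h1 : (f : ℝ) + f' = C := by exact_mod_cast H.hf
    have h2 : (h : ℝ) + h' = n := by exact_mod_cast H.he
    push_cast; rw [← h1, ← h2]; linarith
  | @left _ r H =>
    have h1 : (c : ℝ) + r = A := by exact_mod_cast H.hA
    push_cast; nlinarith [Nat.cast_nonneg (α := ℝ) r]
  | @right _ r H =>
    have h1 : (c' : ℝ) + r = B := by exact_mod_cast H.hA
    push_cast; nlinarith [Nat.cast_nonneg (α := ℝ) r]

theorem cast_le_mul {k : ℝ} (hk : 1 ≤ k) (n : ℕ) : (n : ℝ) ≤ k * n := by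
  nlinarith [Nat.cast_nonneg (α := ℝ) n]

theorem Out.ne_card {k : ℝ} (hk : 1 < k) {A B C n c h c' h' : ℕ} (H : Out k A B C n c h c' h') :
    NE k c h (k * (c' + h')) := by
  cases H with
  | @bal f f' e e' H =>
    refine (H.ne hk).mono ?_
    have := cast_le_mul hk.le f'; push_cast; linarith
  | @left v r H =>
    refine (H.ne hk).mono ?_
    have := cast_le_mul hk.le C; have := cast_le_mul hk.le r; push_cast; linarith
  | @right v r H =>
    refine (H.ne' hk).mono ?_
    push_cast; linarith

/-- The third agent has at most `w - 1` chores and the second does not envy her, so together they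
carry little. After one more costly chore and a new division, both still fit under `k * w`. The
cases compare the shapes of the two divisions; a division that becomes one-sided must have been
one-sided in the same direction before. -/
theorem Out.next_aux {k : ℝ} (hk : 1 < k) {A B C n c2 h2 c3 h3 c2' h2' c3' h3' w : ℕ}
    (H : Out k A B C n c2 h2 c3 h3) (H' : Out k A B C (n + 1) c2' h2' c3' h3')
    (hw : c3 + h3 + 1 ≤ w) : NE k c2' h2' (k * w) ∧ NE k c3' h3' (k * w) := by
  have hwR : (c3 + h3 + 1 : ℝ) ≤ w := by exact_mod_cast hw
  have hkw : k * (c3 + h3) ≤ k * w - k := by nlinarith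
  have hne := (H.ne_card hk).mono hkw
  have htot := H.total hk
  have hcard := H.card
  have hp3 : (c3 + k * h3 : ℝ) ≤ k * w - k := by
    have := cast_le_mul hk.le c3; linarith
  -- Without low chores for the second agent, only the costly ones can be removed, and a bound on
  -- the number of chores replaces the one on the total cost.
  have hT : (A + B + C + k * n : ℝ) ≤ 2 * k * w - 2 * k + 1 ∨ A + B + C + n + 1 ≤ 2 * w := by
    rcases Nat.eq_zero_or_pos c2 with rfl | hc
    · right
      have : h2 ≤ w := by
        by_contra! hh
        have h3 := hne.2 (by omega)
        have : (w : ℝ) + 1 ≤ h2 := by exact_mod_cast hh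
        push_cast at h3; nlinarith
      omega
    · left
      have := hne.1 hc
      linarith
  have hBC := cast_le_mul hk.le B
  have hCC := cast_le_mul hk.le C
  cases H' with
  | bal H' =>
    refine ⟨H'.ne_of_total hk hT ?_, H'.symm.ne_of_total hk ?_ ?_⟩
    · have key : (A + C : ℕ) ≤ c2 ∨ (∃ f, c2 = A + f) → (A : ℝ) - 1 ≤ k * w := by
        intro hc
        have hAc : (A : ℝ) ≤ c2 := by
          rcases hc with hc | ⟨f, rfl⟩
          · exact_mod_cast (by omega : A ≤ c2)
          · push_cast; linarith [Nat.cast_nonneg (α := ℝ) f]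
        rcases Nat.eq_zero_or_pos c2 with h0 | h0
        · subst h0; push_cast at hAc; nlinarith [Nat.cast_nonneg (α := ℝ) w]
        · have := hne.1 h0
          have : 0 ≤ k * h2 := by positivity
          linarith
      cases H with
      | bal H => exact key (Or.inr ⟨_, rfl⟩)
      | @left _ r H =>
        have := H'.hA; push_cast at this hwR hkw
        have : 0 ≤ k * r := by positivity
        linarith
      | right H => exact key (Or.inl le_rfl)
    · rcases hT with hT | hT
      · left; linarith
      · right; omega
    · have h0 : 0 ≤ k * w - w := by have := cast_le_mul hk.le w; linarith
      cases H with
      | bal H => push_cast at hwR; nlinarith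
      | left H => push_cast at hwR; nlinarith
      | @right _ r H =>
        have h1 := H'.hB
        have h2 := H.h2
        have h3 : (c3 : ℝ) + r = B := by exact_mod_cast H.hA
        push_cast at h1 hwR
        have : (1 : ℝ) ≤ w := by linarith [Nat.cast_nonneg (α := ℝ) c3]
        nlinarith
  | @left _ r' H' =>
    have hr' := H'.hr
    have h1' := H'.h1
    have h2' := H'.h2
    push_cast at hr' h1' h2'
    have hA' : (c2' : ℝ) + r' = A := by exact_mod_cast H'.hA
    cases H with
    | bal H => have := H.hA; linarith
    | right H => have := H.hr; have := cast_le_mul hk.le A; nlinarith [Nat.cast_nonneg (α := ℝ) n]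
    | @left _ r H =>
      have h1 := H.h1
      have h2 := H.h2
      have hA : (c2 : ℝ) + r = A := by exact_mod_cast H.hA
      -- With more common chores to share, no more of the exclusive ones need to be passed on.
      have hrr : r' ≤ r := by
        have : (r' : ℝ) < r + 1 := by linarith
        exact_mod_cast Nat.lt_succ_iff.1 (by exact_mod_cast this)
      have hrR : (r' : ℝ) ≤ r := by exact_mod_cast hrr
      have := cast_le_mul hk.le r
      have : k * r' ≤ k * r := mul_le_mul_of_nonneg_left hrR (by linarith)
      push_cast at hkw
      refine ⟨NE.of_le hk.le ?_, NE.of_le hk.le ?_⟩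
      · push_cast; linarith
      · push_cast; linarith
  | @right _ r' H' =>
    have hr' := H'.hr
    have h1' := H'.h1
    have h2' := H'.h2
    push_cast at hr' h1' h2'
    have hA' : (c3' : ℝ) + r' = B := by exact_mod_cast H'.hA
    cases H with
    | bal H => have := H.hB; linarith
    | left H => have := H.hr; have := cast_le_mul hk.le A; nlinarith [Nat.cast_nonneg (α := ℝ) n]
    | @right _ r H =>
      have h1 := H.h1
      have h2 := H.h2
      have hr := H.hr
      have hA : (c3 : ℝ) + r = B := by exact_mod_cast H.hA
      have hrr : r' ≤ r := by
        have : (r' : ℝ) < r + 1 := by linarith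
        exact_mod_cast Nat.lt_succ_iff.1 (by exact_mod_cast this)
      have hrR : (r' : ℝ) ≤ r := by exact_mod_cast hrr
      have hkr : k * r' ≤ k * r := mul_le_mul_of_nonneg_left hrR (by linarith)
      push_cast at hkw hwR hne
      have hrpos : (0 : ℝ) < r := by
        have h0 : 0 ≤ k * A + C + k * n := by positivity
        linarith [Nat.cast_nonneg (α := ℝ) A, hr, h1, h2]
      have hrpos' : 0 < r := by exact_mod_cast hrpos
      have hp2 : (A + C + k * (n + r) : ℝ) ≤ k * w := by
        rcases Nat.eq_zero_or_pos (A + C) with h0 | h0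
        · have := hne.2 (by omega)
          push_cast at this; linarith
        · have := hne.1 h0
          push_cast at this; linarith
      refine ⟨⟨fun h0 => ?_, fun _ => ?_⟩, NE.of_le hk.le ?_⟩
      · have := hne.1 h0
        push_cast at this ⊢; linarith
      · push_cast; linarith
      · push_cast
        -- The cost `Q` of the second bundle, as seen by its owner, would satisfy `w < Q` and `Q < 2
        -- * k * w - k * (k * w + 1)`, so that `w * (k - 1) ^ 2 + k < 0`.
        by_contra! hlt
        have hv : k * c3' = k * c3 + k * r - k * r' := by
          rw [← mul_add, ← mul_sub]; congr 1; linarith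
        have hv' : k * (k * w + 1) < k * c3' := mul_lt_mul_of_pos_left (by linarith) (by linarith)
        have hv'' : k * c3 ≤ k * (w - 1) := mul_le_mul_of_nonneg_left (by linarith) (by linarith)
        have hq : (A + C + k * (n + 1 + r') : ℝ) < 2 * k * w - k * (k * w + 1) := by linarith
        have hq' : k * w < k * (A + C + k * (n + 1 + r')) := by
          have e1 : (C : ℝ) ≤ k * C := cast_le_mul hk.le C
          have e2 : (n + 1 + r' : ℝ) ≤ k * (n + 1 + r') := by
            have := cast_le_mul hk.le (n + 1 + r'); push_cast at this; exact this
          have e3 : k * (n + 1 + r') ≤ k * (k * (n + 1 + r')) :=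
            mul_le_mul_of_nonneg_left e2 (by linarith)
          have := cast_le_mul hk.le r'
          linarith
        have hq'' := lt_of_mul_lt_mul_left hq' (by linarith)
        have : 0 ≤ (w : ℝ) * (k - 1) ^ 2 := by positivity
        nlinarith

end Chores

namespace Chores

/-! ### Removal of envy -/


open Finset

/-- A two by two table with given margins. It distributes a pooled number of chores over the two
types that were pooled. -/
theorem exists_split {f f' x y : ℕ} (h : f + f' = x + y) :
    ∃ p p' q q', p + p' = x ∧ q + q' = y ∧ p + q = f ∧ p' + q' = f' := by
  rcases le_total f x with h1 | h1
  · exact ⟨f, x - f, 0, y, by omega, by omega, by omega, by omega⟩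
  · exact ⟨x, 0, f - x, f', by omega, by omega, by omega, by omega⟩

/-- Agents `2` and `3` do not care whether a chore is low for `1`, so types are pooled accordingly,
and the `t` released private chores of `1` count as costly. Only the weight of `1` is raised. She
does not envy a bundle with at least `u - 1` chores, as each chore costs at least `1`. -/
theorem solv_of_mOut {k : ℝ} (hk : 1 < k) {u t a2 a3 b12 b13 b23 g H f f' e e' : ℕ}
    (h : MOut k (a2 + b12) (a3 + b13) (b23 + g) (H + t) f f' e e')
    (n2 : NE k (a2 + b12 + f) e (k * u)) (n3 : NE k (a3 + b13 + f') e' (k * u))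
    (u2 : u ≤ a2 + b12 + f + e + 1) (u3 : u ≤ a3 + b13 + f' + e' + 1) :
    Solv k (u + t) a2 a3 b12 b13 b23 g H := by
  have hne := h.ne hk
  have hne' := h.symm.ne hk
  obtain ⟨z2, z3, g2, g3, rfl, rfl, rfl, rfl⟩ := exists_split h.hf
  obtain ⟨h2, h3, t2, t3, rfl, rfl, rfl, rfl⟩ := exists_split h.he
  have u2' : (u : ℝ) ≤ a2 + b12 + (z2 + g2) + (h2 + t2) + 1 := by exact_mod_cast u2
  have u3' : (u : ℝ) ≤ a3 + b13 + (z3 + g3) + (h3 + t3) + 1 := by exact_mod_cast u3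
  have i1 := cast_le_mul hk.le a2
  have i2 := cast_le_mul hk.le a3
  have i3 := cast_le_mul hk.le z2
  have i4 := cast_le_mul hk.le z3
  have i5 := cast_le_mul hk.le h2
  have i6 := cast_le_mul hk.le h3
  rw [← add_assoc]
  apply solv_raise_one (by linarith)
  · apply NE.of_le hk.le; push_cast; linarith
  · apply NE.of_le hk.le; push_cast; linarith
  · convert n2 using 1 <;> ring
  · convert hne using 1
    · ring
    · ring
    · push_cast; ring
  · convert n3 using 1 <;> ring
  · convert hne' using 1
    · ring
    · ring
    · push_cast; ring

/-- Here agent `2` passes `r` chores to `3`, for whom they are high, so her weight must be raised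
together with that of `1`. -/
theorem solv_of_rOut {k : ℝ} (hk : 1 < k) {u t a2 a3 b12 b13 b23 g H v r : ℕ}
    (h : ROut k (a2 + b12) (a3 + b13) (b23 + g) (H + t) v r)
    (n2 : NE k v 0 (k * u)) (n3 : NE k (a3 + b13 + (b23 + g)) (H + t + r) (k * u))
    (u2 : u ≤ v + 1) (u3 : u ≤ a3 + b13 + (b23 + g) + (H + t + r) + 1) :
    Solv k (u + t) a2 a3 b12 b13 b23 g H := by
  have hne := h.ne hk
  have hne' := h.ne' hk
  obtain ⟨v2, v3, z2, z3, rfl, rfl, rfl, rfl⟩ := exists_split h.hA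
  have u2' : (u : ℝ) ≤ (v2 + z2) + 1 := by exact_mod_cast u2
  have u3' : (u : ℝ) ≤ a3 + b13 + (b23 + g) + (H + t + (v3 + z3)) + 1 := by exact_mod_cast u3
  have i1 := cast_le_mul hk.le v2
  have i2 := cast_le_mul hk.le (v3 + a3 + b23 + H)
  push_cast at i2
  have := solv_raise_two (k := k) (by linarith) (u := u) (u3 := t) (v := v2) (v3 := v3) (a3 := a3)
    (z1 := 0) (z2 := z2) (z3 := z3) (b13 := b13) (b23 := b23) (g := g) (H := H) ?_ ?_ ?_ ?_ ?_ ?_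
  · simpa using this
  · apply NE.of_le hk.le; push_cast; linarith
  · apply NE.of_le hk.le; push_cast; linarith
  · convert n2 using 1; push_cast; ring
  · convert hne using 1; push_cast; ring
  · convert n3 using 1
    · ring
    · ring
    · push_cast; ring
  · convert hne' using 1
    · ring
    · ring
    · push_cast; ring

theorem solv_of_out {k : ℝ} (hk : 1 < k) {u t a2 a3 b12 b13 b23 g H c h c' h' : ℕ}
    (O : Out k (a2 + b12) (a3 + b13) (b23 + g) (H + t) c h c' h')
    (n2 : NE k c h (k * u)) (n3 : NE k c' h' (k * u)) (u2 : u ≤ c + h + 1) (u3 : u ≤ c' + h' + 1) :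
    Solv k (u + t) a2 a3 b12 b13 b23 g H := by
  cases O with
  | bal O => exact solv_of_mOut hk O n2 n3 (by omega) (by omega)
  | left O => exact solv_of_rOut hk O n2 n3 (by omega) (by omega)
  | right O => exact (solv_of_rOut hk O n3 n2 (by omega) (by omega)).swap23

theorem Out.next {k : ℝ} (hk : 1 < k) {A B C n c2 h2 c3 h3 c2' h2' c3' h3' w : ℕ}
    (H : Out k A B C n c2 h2 c3 h3) (H' : Out k A B C (n + 1) c2' h2' c3' h3')
    (hw : c2 + h2 + 1 ≤ w ∨ c3 + h3 + 1 ≤ w) : NE k c2' h2' (k * w) ∧ NE k c3' h3' (k * w) := by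
  rcases hw with hw | hw
  · exact (H.symm.next_aux hk H'.symm hw).symm
  · exact H.next_aux hk H' hw

/-- If agent `1` receives `u` chores that are low only for her, the other agents share the rest,
and agent `1` is envious, then there is a solution. -/
theorem solv_of_envy {k : ℝ} (hk : 1 < k) {a2 a3 b12 b13 b23 g H : ℕ} (u : ℕ) : ∀ {t c h c' h' : ℕ},
    Out k (a2 + b12) (a3 + b13) (b23 + g) (H + t) c h c' h' → c + h + 1 < u ∨ c' + h' + 1 < u →
    Solv k (u + t) a2 a3 b12 b13 b23 g H := by
  induction u with
  | zero => intro t c h c' h' _ h; omega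
  | succ u ih =>
    intro t c h c' h' O hu
    -- Agent `1` releases one more private chore, and the other two divide anew.
    obtain ⟨d, e, d', e', O'⟩ := exists_out hk (a2 + b12) (a3 + b13) (b23 + g) (H + t + 1)
    rw [show u + 1 + t = u + (t + 1) by ring]
    by_cases hw : d + e + 1 < u ∨ d' + e' + 1 < u
    · exact ih O' hw
    -- Her envy has just ended. That she was envious with `u + 1` chores is what shows that nobody
    -- envies the remaining `u`.
    · have := O.next hk O' (w := u) (by omega)
      exact solv_of_out hk O' this.1 this.2 (by omega) (by omega)

/-- If there is no solution, then in any division of the other chores between agents `2` and `3`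
one of them envies agent `1` with her own chores, and agent `1` is not envious. -/
theorem Out.of_not_solv {k : ℝ} (hk : 1 < k) {a1 a2 a3 b12 b13 b23 g H c h c' h' : ℕ}
    (O : Out k (a2 + b12) (a3 + b13) (b23 + g) H c h c' h')
    (hS : ¬ Solv k a1 a2 a3 b12 b13 b23 g H) :
    a1 ≤ c + h + 1 ∧ a1 ≤ c' + h' + 1 ∧ ¬ (NE k c h (k * a1) ∧ NE k c' h' (k * a1)) := by
  by_cases hu : c + h + 1 < a1 ∨ c' + h' + 1 < a1
  · exact absurd (solv_of_envy hk (t := 0) a1 O hu) hS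
  · refine ⟨by omega, by omega, fun hN => hS ?_⟩
    exact solv_of_out hk (t := 0) O hN.1 hN.2 (by omega) (by omega)

end Chores

namespace Chores

/-! ### Balanced divisions among three agents -/


open Finset

/-- Averaging as in `MOut.ne_of_total`: an excess over `k * w` on one side forces a deficit on the
other that balancedness forbids. -/
theorem MOut.ne_of_le {k : ℝ} (hk : 1 < k) {A B C n f f' e e' w : ℕ}
    (h : MOut k A B C n f f' e e')
    (hT : (A + B + C + k * n : ℝ) ≤ 2 * k * w - k + 2)
    (hown : (A : ℝ) - 1 ≤ k * w) : NE k (A + f) e (k * w) := by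
  obtain ⟨hf, he, hA, hB, f1, e1, f2, e2⟩ := h
  have hC : (f : ℝ) + f' = C := by exact_mod_cast hf
  have hn : (e : ℝ) + e' = n := by exact_mod_cast he
  have hkn : k * e + k * e' = k * n := by rw [← mul_add, hn]
  have tA := th_nonneg A
  have tB1 := th_le_one B
  have t3 : (k - 1) * th B ≤ k - 1 := by nlinarith
  have t4 : 0 ≤ (k - 1) * th A := mul_nonneg (by linarith) tA
  constructor
  · intro h0
    push_cast
    by_contra! hlt
    rcases Nat.eq_zero_or_pos f with rfl | hf0
    · rcases Nat.eq_zero_or_pos e with rfl | he0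
      · push_cast at hlt; linarith
      · have := e1 he0
        rw [th_pos (show 0 < A by omega)] at this
        linarith
    · have := f1 hf0; linarith
  · intro h0
    push_cast
    by_contra! hlt
    have := e1 h0
    linarith

theorem Out.ne_of_le {k : ℝ} (hk : 1 < k) {A B C n c h c' h' w : ℕ}
    (O : Out k A B C n c h c' h') (hT : (A + B + C + k * n : ℝ) ≤ 2 * k * w - k + 2)
    (hA : A ≤ w ∨ ((A : ℝ) - 1 ≤ k * w ∧ (A : ℝ) - 1 ≤ k * B + C + k * n)) (hB : B ≤ w) :
    NE k c h (k * w) ∧ NE k c' h' (k * w) := by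
  have hw := cast_le_mul hk.le w
  have hB' : (B : ℝ) ≤ w := by exact_mod_cast hB
  cases O with
  | bal O =>
    refine ⟨O.ne_of_le hk hT ?_, O.symm.ne_of_le hk (by linarith) (by linarith)⟩
    rcases hA with hA | hA
    · have : (A : ℝ) ≤ w := by exact_mod_cast hA
      linarith
    · exact hA.1
  | left O =>
    have hr := O.hr
    rcases hA with hA | hA
    · have hv : (c : ℝ) ≤ w := by exact_mod_cast (by have := O.hA; omega : c ≤ w)
      refine ⟨NE.of_le hk.le (by push_cast; linarith), (O.ne' hk).mono ?_⟩
      exact mul_le_mul_of_nonneg_left hv (by linarith)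
    · linarith [hA.2]
  | right O =>
    have hv : (c' : ℝ) ≤ w := by exact_mod_cast (by have := O.hA; omega : c' ≤ w)
    refine ⟨(O.ne' hk).mono ?_, NE.of_le hk.le (by push_cast; linarith)⟩
    exact mul_le_mul_of_nonneg_left hv (by linarith)

/-- If the chores that agent `3` dislikes and agents `1`, `2` like are equally divided between
these two, agent `3` has the rest, and agent `1` or `2` is envious, then there is a solution. -/
theorem solv_of_balanced {k : ℝ} (hk : 1 < k) (n : ℕ) :
    ∀ {u u3 v v3 z1 z2 z3 a3 b13 b23 g H : ℕ}, u + z1 + (v + z2) = n →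
    u + z1 ≤ v + z2 + 1 → v + z2 ≤ u + z1 + 1 →
    ((u3 + z3 + b13 + g + k * (v3 + a3 + b23 + H) : ℝ) < u + z1 - 1 ∨
      (v3 + z3 + b23 + g + k * (u3 + a3 + b13 + H) : ℝ) < v + z2 - 1) →
    Solv k (u + u3) (v + v3) a3 (z1 + z2 + z3) b13 b23 g H := by
  induction n with
  | zero =>
    intro u u3 v v3 z1 z2 z3 a3 b13 b23 g H hn _ _ h
    have h1 : (u : ℝ) + z1 = 0 := by exact_mod_cast (by omega : u + z1 = 0)
    have h2 : (v : ℝ) + z2 = 0 := by exact_mod_cast (by omega : v + z2 = 0)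
    rw [h1, h2] at h
    have e1 : 0 ≤ (u3 + z3 + b13 + g + k * (v3 + a3 + b23 + H) : ℝ) := by positivity
    have e2 : 0 ≤ (v3 + z3 + b23 + g + k * (u3 + a3 + b13 + H) : ℝ) := by positivity
    rcases h with h | h <;> linarith
  | succ n ih =>
    have main : ∀ {u u3 v v3 z1 z2 z3 a3 b13 b23 g H : ℕ}, u + z1 + (v + z2) = n + 1 →
        u + z1 ≤ v + z2 + 1 → v + z2 ≤ u + z1 →
        ((u3 + z3 + b13 + g + k * (v3 + a3 + b23 + H) : ℝ) < u + z1 - 1 ∨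
          (v3 + z3 + b23 + g + k * (u3 + a3 + b13 + H) : ℝ) < v + z2 - 1) →
        Solv k (u + u3) (v + v3) a3 (z1 + z2 + z3) b13 b23 g H := by
      intro u u3 v v3 z1 z2 z3 a3 b13 b23 g H hn h12 h21 h
      -- Every chore costs at least `1`, so envy towards agent `3` means that she holds few chores.
      have hcard : u3 + v3 + z3 + a3 + b13 + b23 + g + H + 2 ≤ u + z1 := by
        have i1 := cast_le_mul hk.le (v3 + a3 + b23 + H)
        have i2 := cast_le_mul hk.le (u3 + a3 + b13 + H)
        push_cast at i1 i2
        have h21' : (v : ℝ) + z2 ≤ u + z1 := by exact_mod_cast h21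
        have : (u3 + v3 + z3 + a3 + b13 + b23 + g + H + 1 : ℝ) < u + z1 := by
          rcases h with h | h <;> linarith
        have : u3 + v3 + z3 + a3 + b13 + b23 + g + H + 1 < u + z1 := by exact_mod_cast this
        omega
      -- After one chore has been passed to `3`, either the envy persists and the induction goes on,
      -- or it has ended. In the latter case `3` still has no more chores than either of the others,
      -- all of whose chores cost her `k`, and both weights can be raised.
      have key : ∀ {u u3 z1 z3 : ℕ}, u + z1 + (v + z2) = n → v + z2 ≤ u + z1 + 1 →
          u + z1 ≤ v + z2 → u3 + v3 + z3 + a3 + b13 + b23 + g + H ≤ u + z1 →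
          Solv k (u + u3) (v + v3) a3 (z1 + z2 + z3) b13 b23 g H := by
        intro u u3 z1 z3 hn h1 h2 hc
        by_cases hE : ((u3 + z3 + b13 + g + k * (v3 + a3 + b23 + H) : ℝ) < u + z1 - 1 ∨
          (v3 + z3 + b23 + g + k * (u3 + a3 + b13 + H) : ℝ) < v + z2 - 1)
        · exact ih hn (by omega) h1 hE
        · push Not at hE
          have h1' : (v : ℝ) + z2 ≤ u + z1 + 1 := by exact_mod_cast h1
          have h2' : (u : ℝ) + z1 ≤ v + z2 := by exact_mod_cast h2
          have hc' : (u3 + v3 + z3 + a3 + b13 + b23 + g + H : ℝ) ≤ u + z1 := by exact_mod_cast hc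
          have i1 := cast_le_mul hk.le v
          have i2 := cast_le_mul hk.le u
          have i3 := cast_le_mul hk.le (a3 + b13 + b23 + g)
          push_cast at i3
          have j1 : k * (u3 + v3 + z3 + a3 + b13 + b23 + g + H : ℝ) ≤ k * (u + z1) :=
            mul_le_mul_of_nonneg_left hc' (by linarith)
          have j2 : k * (u + z1 : ℝ) ≤ k * (v + z2) :=
            mul_le_mul_of_nonneg_left h2' (by linarith)
          refine solv_raise_two (by linarith) ?_ ?_ ?_ ?_ ?_ ?_ <;> apply NE.of_le hk.le <;>
            push_cast <;> linarith [hE.1, hE.2]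
      -- Agent `1`, whose bundle is the larger one, gives a private chore if she has one and a chore
      -- low for `1` and `2` otherwise.
      rcases Nat.eq_zero_or_pos u with rfl | hu
      · obtain ⟨y, rfl⟩ : ∃ y, z1 = y + 1 := ⟨z1 - 1, by omega⟩
        rw [show y + 1 + z2 + z3 = y + z2 + (z3 + 1) by ring]
        exact key (by omega) (by omega) (by omega) (by omega)
      · obtain ⟨y, rfl⟩ : ∃ y, u = y + 1 := ⟨u - 1, by omega⟩
        rw [show y + 1 + u3 = y + (u3 + 1) by ring]
        exact key (by omega) (by omega) (by omega) (by omega)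
    intro u u3 v v3 z1 z2 z3 a3 b13 b23 g H hn h12 h21 h
    rcases le_total (v + z2) (u + z1) with hle | hle
    · exact main hn h12 hle h
    · rw [add_comm z1 z2]
      exact (main (by omega) h21 hle h.symm).swap12

/-! ### The potential for three agents -/

/-- The sum of the squared modified costs of a division of all chores in which the chores that are
low for somebody go to an agent for whom they are low. Agent `1` has `z12` of the chores that are
low for `1` and `2` only, and so on. -/
noncomputable def Phi (k : ℝ) (a1 a2 a3 z12 z21 z13 z31 z23 z32 g1 g2 g3 h1 h2 h3 : ℕ) : ℝ :=
  (a1 + z12 + z13 + g1 + k * h1 + (k - 1) * th a1) ^ 2 +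
  (a2 + z21 + z23 + g2 + k * h2 + (k - 1) * th a2) ^ 2 +
  (a3 + z31 + z32 + g3 + k * h3 + (k - 1) * th a3) ^ 2

/-- The given division minimizes `Phi`. -/
def IsMin (k : ℝ) (a1 a2 a3 z12 z21 z13 z31 z23 z32 g1 g2 g3 h1 h2 h3 : ℕ) : Prop :=
  ∀ y12 y21 y13 y31 y23 y32 f1 f2 f3 j1 j2 j3 : ℕ, y12 + y21 = z12 + z21 → y13 + y31 = z13 + z31 →
    y23 + y32 = z23 + z32 → f1 + f2 + f3 = g1 + g2 + g3 → j1 + j2 + j3 = h1 + h2 + h3 →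
    Phi k a1 a2 a3 z12 z21 z13 z31 z23 z32 g1 g2 g3 h1 h2 h3 ≤
      Phi k a1 a2 a3 y12 y21 y13 y31 y23 y32 f1 f2 f3 j1 j2 j3

theorem exists_isMin (k : ℝ) (a1 a2 a3 b12 b13 b23 g H : ℕ) :
    ∃ z12 z21 z13 z31 z23 z32 g1 g2 g3 h1 h2 h3, z12 + z21 = b12 ∧ z13 + z31 = b13 ∧
      z23 + z32 = b23 ∧ g1 + g2 + g3 = g ∧ h1 + h2 + h3 = H ∧
      IsMin k a1 a2 a3 z12 z21 z13 z31 z23 z32 g1 g2 g3 h1 h2 h3 := by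
  obtain ⟨⟨z12, z13, z23, g1, g2, h1, h2⟩, hm, hmin⟩ := exists_min_image
    ({s ∈ range (b12 + 1) ×ˢ range (b13 + 1) ×ˢ range (b23 + 1) ×ˢ range (g + 1) ×ˢ
      range (g + 1) ×ˢ range (H + 1) ×ˢ range (H + 1) |
      s.2.2.2.1 + s.2.2.2.2.1 ≤ g ∧ s.2.2.2.2.2.1 + s.2.2.2.2.2.2 ≤ H} :
      Finset (ℕ × ℕ × ℕ × ℕ × ℕ × ℕ × ℕ))
    (fun s => Phi k a1 a2 a3 s.1 (b12 - s.1) s.2.1 (b13 - s.2.1) s.2.2.1 (b23 - s.2.2.1)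
      s.2.2.2.1 s.2.2.2.2.1 (g - s.2.2.2.1 - s.2.2.2.2.1) s.2.2.2.2.2.1 s.2.2.2.2.2.2
      (H - s.2.2.2.2.2.1 - s.2.2.2.2.2.2)) ⟨(0, 0, 0, 0, 0, 0, 0), by simp⟩
  simp only [mem_filter, mem_product, mem_range] at hm
  refine ⟨z12, b12 - z12, z13, b13 - z13, z23, b23 - z23, g1, g2, g - g1 - g2, h1, h2,
    H - h1 - h2, by omega, by omega, by omega, by omega, by omega, ?_⟩
  intro y12 y21 y13 y31 y23 y32 f1 f2 f3 j1 j2 j3 e1 e2 e3 e4 e5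
  have := hmin (y12, y13, y23, f1, f2, j1, j2) (by
    simp only [mem_filter, mem_product, mem_range]; omega)
  simp only at this
  rwa [show b12 - y12 = y21 by omega, show b13 - y13 = y31 by omega, show b23 - y23 = y32 by omega,
    show g - f1 - f2 = f3 by omega, show H - j1 - j2 = j3 by omega] at this

theorem IsMin.swap12 {k : ℝ} {a1 a2 a3 z12 z21 z13 z31 z23 z32 g1 g2 g3 h1 h2 h3 : ℕ}
    (h : IsMin k a1 a2 a3 z12 z21 z13 z31 z23 z32 g1 g2 g3 h1 h2 h3) :
    IsMin k a2 a1 a3 z21 z12 z23 z32 z13 z31 g2 g1 g3 h2 h1 h3 := by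
  intro y12 y21 y13 y31 y23 y32 f1 f2 f3 j1 j2 j3 e1 e2 e3 e4 e5
  have := h y21 y12 y23 y32 y13 y31 f2 f1 f3 j2 j1 j3 (by omega) (by omega) (by omega) (by omega)
    (by omega)
  unfold Phi at *
  linarith

theorem IsMin.swap23 {k : ℝ} {a1 a2 a3 z12 z21 z13 z31 z23 z32 g1 g2 g3 h1 h2 h3 : ℕ}
    (h : IsMin k a1 a2 a3 z12 z21 z13 z31 z23 z32 g1 g2 g3 h1 h2 h3) :
    IsMin k a1 a3 a2 z13 z31 z12 z21 z32 z23 g1 g3 g2 h1 h3 h2 := by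
  intro y12 y21 y13 y31 y23 y32 f1 f2 f3 j1 j2 j3 e1 e2 e3 e4 e5
  have := h y13 y31 y12 y21 y32 y23 f1 f3 f2 j1 j3 j2 (by omega) (by omega) (by omega) (by omega)
    (by omega)
  unfold Phi at *
  linarith

theorem le_of_sq_shift {x y δ : ℝ} (hδ : 0 < δ) (h : x ^ 2 + y ^ 2 ≤ (x - δ) ^ 2 + (y + δ) ^ 2) :
    x ≤ y + δ := by
  have : 0 ≤ δ * (y + δ - x) := by nlinarith
  have := nonneg_of_mul_nonneg_right this hδ
  linarith

end Chores

namespace Chores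

/-! ### Properties of minimizers -/


section Min

variable {k : ℝ} {a1 a2 a3 z12 z21 z13 z31 z23 z32 g1 g2 g3 h1 h2 h3 : ℕ}

/-- Compare with the division in which one such chore moves from `1` to `2`. Private chores never
move, so the terms with `th` stay fixed. -/
theorem IsMin.low (hm : IsMin k a1 a2 a3 z12 z21 z13 z31 z23 z32 g1 g2 g3 h1 h2 h3)
    (h : 0 < z12 ∨ 0 < g1) : (a1 + z12 + z13 + g1 + k * h1 + (k - 1) * th a1 : ℝ) ≤
      a2 + z21 + z23 + g2 + k * h2 + (k - 1) * th a2 + 1 := by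
  apply le_of_sq_shift one_pos
  rcases h with h | h
  · obtain ⟨z, rfl⟩ : ∃ z, z12 = z + 1 := ⟨z12 - 1, by omega⟩
    have := hm z (z21 + 1) z13 z31 z23 z32 g1 g2 g3 h1 h2 h3 (by omega) rfl rfl rfl rfl
    unfold Phi at this; push_cast at this ⊢; linarith
  · obtain ⟨z, rfl⟩ : ∃ z, g1 = z + 1 := ⟨g1 - 1, by omega⟩
    have := hm z12 z21 z13 z31 z23 z32 z (g2 + 1) g3 h1 h2 h3 rfl rfl rfl (by omega) rfl
    unfold Phi at this; push_cast at this ⊢; linarith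

theorem IsMin.high (hk : 1 < k) (hm : IsMin k a1 a2 a3 z12 z21 z13 z31 z23 z32 g1 g2 g3 h1 h2 h3)
    (h : 0 < h1) : (a1 + z12 + z13 + g1 + k * h1 + (k - 1) * th a1 : ℝ) ≤
      a2 + z21 + z23 + g2 + k * h2 + (k - 1) * th a2 + k := by
  apply le_of_sq_shift (by linarith)
  obtain ⟨z, rfl⟩ : ∃ z, h1 = z + 1 := ⟨h1 - 1, by omega⟩
  have := hm z12 z21 z13 z31 z23 z32 g1 g2 g3 z (h2 + 1) h3 rfl rfl rfl rfl (by omega)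
  unfold Phi at this; push_cast at this ⊢; linarith

/-- An exchange along a path: `1` passes a chore to `2`, who passes another to `3`. The cost of `2`
is unchanged, so `1` and `3` compare as if the transfer were direct. -/
theorem IsMin.path (hm : IsMin k a1 a2 a3 z12 z21 z13 z31 z23 z32 g1 g2 g3 h1 h2 h3)
    (h : 0 < z12) (h' : 0 < z23 ∨ 0 < g2) : (a1 + z12 + z13 + g1 + k * h1 + (k - 1) * th a1 : ℝ) ≤
      a3 + z31 + z32 + g3 + k * h3 + (k - 1) * th a3 + 1 := by
  apply le_of_sq_shift one_pos
  obtain ⟨z, rfl⟩ : ∃ z, z12 = z + 1 := ⟨z12 - 1, by omega⟩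
  rcases h' with h' | h'
  · obtain ⟨y, rfl⟩ : ∃ z, z23 = z + 1 := ⟨z23 - 1, by omega⟩
    have := hm z (z21 + 1) z13 z31 y (z32 + 1) g1 g2 g3 h1 h2 h3 (by omega) rfl (by omega) rfl rfl
    unfold Phi at this; push_cast at this ⊢; linarith
  · obtain ⟨y, rfl⟩ : ∃ z, g2 = z + 1 := ⟨g2 - 1, by omega⟩
    have := hm z (z21 + 1) z13 z31 z23 z32 g1 y (g3 + 1) h1 h2 h3 (by omega) rfl rfl (by omega) rfl
    unfold Phi at this; push_cast at this ⊢; linarith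

/-- Any chore that could reach `3` at unit cost, directly or via `2`, would contradict minimality.
Costly chores of `1` give only a gap of at most `k`, which rules out envy up to a costly chore, and
also up to a cheap one if the charge for private chores applies to `1`. -/
theorem IsMin.of_envy (hk : 1 < k)
    (hm : IsMin k a1 a2 a3 z12 z21 z13 z31 z23 z32 g1 g2 g3 h1 h2 h3)
    (hE : ¬ NE k (a1 + z12 + z13 + g1) h1 (a3 + z31 + z32 + g3 + k * h3 + (k - 1) * (a3 + z32))) :
    z13 = 0 ∧ g1 = 0 ∧ (a1 = 0 ∨ h1 = 0) ∧ (0 < z12 → z23 = 0 ∧ g2 = 0) ∧ 0 < a1 + z12 ∧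
    (a3 + z31 + z32 + g3 + k * h3 + (k - 1) * (a3 + z32) : ℝ) < a1 + z12 + k * h1 - 1 := by
  have m13 := hm.swap23
  have t1 : (k - 1) * th a3 ≤ (k - 1) * (a3 + z32) :=
    mul_le_mul_of_nonneg_left ((th_le a3).trans (by simp)) (by linarith)
  have t2 : 0 ≤ (k - 1) * th a1 := mul_nonneg (by linarith) (th_nonneg a1)
  have hhigh : 0 < h1 → (a1 + z12 + z13 + g1 + k * h1 + (k - 1) * th a1 - k : ℝ) ≤
      a3 + z31 + z32 + g3 + k * h3 + (k - 1) * (a3 + z32) := fun h => by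
    have := m13.high hk h; linarith
  have hlow : 0 < a1 + z12 + z13 + g1 ∧
      (a3 + z31 + z32 + g3 + k * h3 + (k - 1) * (a3 + z32) : ℝ) <
        a1 + z12 + z13 + g1 + k * h1 - 1 := by
    by_contra hc
    apply hE
    constructor
    · intro h0; by_contra hlt; exact hc ⟨h0, by push_cast at hlt; linarith⟩
    · intro h0; have := hhigh h0; push_cast; linarith
  obtain ⟨hc, hD⟩ := hlow
  have hz : ¬ (0 < z13 ∨ 0 < g1) := fun h => by have := m13.low h; linarith
  have hz13 : z13 = 0 := by omega
  have hg1 : g1 = 0 := by omega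
  subst hz13 hg1
  refine ⟨rfl, rfl, ?_, fun hz => ?_, by omega, by push_cast at hD; linarith⟩
  · by_contra hc
    have := hhigh (by omega)
    rw [th_pos (by omega)] at this
    linarith
  · by_contra hc
    have := hm.path hz (by omega)
    linarith

/-- In a minimizer, an agent `1` who holds no chores that are low for `2` does not envy `3`, unless
`2` envies `3` and has more chores that are low for herself only. -/
theorem IsMin.single (hk : 1 < k)
    (hm : IsMin k a1 a2 a3 z12 z21 z13 z31 z23 z32 g1 g2 g3 h1 h2 h3)
    (hS : ¬ Solv k a1 a2 a3 (z12 + z21) (z13 + z31) (z23 + z32) (g1 + g2 + g3) (h1 + h2 + h3))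
    (hz : z12 = 0)
    (hE : ¬ NE k (a1 + z12 + z13 + g1) h1 (a3 + z31 + z32 + g3 + k * h3 + (k - 1) * (a3 + z32)))
    (hE2 : 0 < z21 →
      NE k (a2 + z21 + z23 + g2) h2 (a3 + z31 + z32 + g3 + k * h3 + (k - 1) * (a3 + z31))) :
    a1 < a2 ∧
    ¬ NE k (a2 + z21 + z23 + g2) h2 (a3 + z31 + z32 + g3 + k * h3 + (k - 1) * (a3 + z31)) := by
  subst hz
  obtain ⟨rfl, rfl, hah, -, ha1, hD⟩ := hm.of_envy hk hE
  have hh1 : h1 = 0 := by omega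
  subst hh1
  simp only [zero_add] at hS
  push_cast at hD
  by_contra hmax
  have w0 : 0 ≤ k * h3 := by positivity
  have w1 : 0 ≤ (k - 1) * (a3 + z32 : ℝ) := mul_nonneg (by linarith) (by positivity)
  have w2 : 0 ≤ (k - 1) * th a2 := mul_nonneg (by linarith) (th_nonneg a2)
  have w3 : (k - 1) * th a3 ≤ (k - 1) * (a3 + z32) :=
    mul_le_mul_of_nonneg_left ((th_le a3).trans (by simp)) (by linarith)
  have ha2 : (2 : ℝ) ≤ a1 := by
    have : (1 : ℝ) < a1 := by
      have : 0 ≤ (a3 + z31 + z32 + g3 : ℝ) := by positivity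
      linarith
    exact_mod_cast (by exact_mod_cast this : 1 < a1)
  have hk2 : (k - 1) * 2 ≤ (k - 1) * a1 := mul_le_mul_of_nonneg_left ha2 (by linarith)
  have hB : a3 + z31 ≤ a1 := by
    have : (a3 + z31 : ℝ) ≤ a1 := by
      have : 0 ≤ (z32 + g3 : ℝ) := by positivity
      linarith
    exact_mod_cast this
  -- Agent `1` keeps her private chores at a raised weight. What remains is to bound the total cost
  -- of the others and the chores low for `2` but not for `3`.
  obtain ⟨c, h, c', h', O⟩ := exists_out hk (a2 + z21) (a3 + z31) (z23 + z32 + (g2 + g3)) (h2 + h3)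
  refine (O.of_not_solv hk hS).2.2 (O.ne_of_le hk ?_ ?_ hB)
  all_goals push_cast
  all_goals
    -- If `2` holds a chore that is no worse for `3`, minimality bounds her cost by that of `3`.
    -- Otherwise she holds only low chores that are high for `3`, and the bound comes either from
    -- her not envying `3` or from `a2 ≤ a1`.
    by_cases hα : 0 < h2 ∨ 0 < z23 ∨ 0 < g2
  · have hp : (a2 + z21 + z23 + g2 + k * h2 : ℝ) ≤ a1 - 1 + k := by
      rcases hα with hα | hα
      · have := hm.swap12.swap23.high hk hα; linarith
      · have := hm.swap12.swap23.low hα; linarith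
    linarith
  · obtain ⟨rfl, rfl, rfl⟩ : h2 = 0 ∧ z23 = 0 ∧ g2 = 0 := by omega
    by_cases hE3 : NE k (a2 + z21 + 0 + 0) 0 (a3 + z31 + z32 + g3 + k * h3 + (k - 1) * (a3 + z31))
    · have hq : (a2 + z21 : ℝ) - 1 ≤ a3 + z31 + z32 + g3 + k * h3 + (k - 1) * (a3 + z31) := by
        rcases Nat.eq_zero_or_pos (a2 + z21) with h0 | h0
        · have : (a2 + z21 : ℝ) = 0 := by exact_mod_cast h0
          have w1 : 0 ≤ (k - 1) * (a3 + z31 : ℝ) := mul_nonneg (by linarith) (by positivity)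
          have : 0 ≤ (a3 + z31 + z32 + g3 : ℝ) := by positivity
          linarith
        · have := hE3.1 (by omega); push_cast at this; linarith
      have := cast_le_mul hk.le (z32 + g3)
      have i2 := cast_le_mul hk.le h3
      have hp3 : k * (a3 + z31 + z32 + g3 + k * h3) ≤ k * (a1 - 1) :=
        mul_le_mul_of_nonneg_left (by linarith) (by linarith)
      have : k * h3 ≤ k * (k * h3) := mul_le_mul_of_nonneg_left i2 (by linarith)
      push_cast at *
      linarith
    · have hz : z21 = 0 := by
        by_contra hne; exact hE3 (hE2 (Nat.pos_of_ne_zero hne))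
      subst hz
      have : ¬ a1 < a2 := fun h => hmax ⟨h, hE3⟩
      have : (a2 : ℝ) ≤ a1 := by exact_mod_cast (by omega : a2 ≤ a1)
      push_cast
      linarith
  · left
    have hp : (a2 + z21 : ℝ) < a1 := by
      have e0 : 0 ≤ (z23 + g2 : ℝ) := by positivity
      rcases hα with hα | hα
      · have := hm.swap12.swap23.high hk hα
        have : k * 1 ≤ k * h2 := mul_le_mul_of_nonneg_left (by exact_mod_cast hα) (by linarith)
        linarith
      · have := hm.swap12.swap23.low hα
        have : (1 : ℝ) ≤ z23 + g2 := by exact_mod_cast (by omega : 1 ≤ z23 + g2)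
        have : 0 ≤ k * h2 := by positivity
        linarith
    exact_mod_cast hp.le
  · obtain ⟨rfl, rfl, rfl⟩ : h2 = 0 ∧ z23 = 0 ∧ g2 = 0 := by omega
    by_cases hE3 : NE k (a2 + z21 + 0 + 0) 0 (a3 + z31 + z32 + g3 + k * h3 + (k - 1) * (a3 + z31))
    · right
      have hq : (a2 + z21 : ℝ) - 1 ≤ a3 + z31 + z32 + g3 + k * h3 + (k - 1) * (a3 + z31) := by
        rcases Nat.eq_zero_or_pos (a2 + z21) with h0 | h0
        · have : (a2 + z21 : ℝ) = 0 := by exact_mod_cast h0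
          have w1 : 0 ≤ (k - 1) * (a3 + z31 : ℝ) := mul_nonneg (by linarith) (by positivity)
          have : 0 ≤ (a3 + z31 + z32 + g3 : ℝ) := by positivity
          linarith
        · have := hE3.1 (by omega); push_cast at this; linarith
      have := cast_le_mul hk.le (z32 + g3)
      have i2 := cast_le_mul hk.le h3
      have hp3 : k * (a3 + z31 + z32 + g3 + k * h3) ≤ k * (a1 - 1) :=
        mul_le_mul_of_nonneg_left (by linarith) (by linarith)
      have : k * h3 ≤ k * (k * h3) := mul_le_mul_of_nonneg_left i2 (by linarith)
      push_cast at *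
      constructor <;> linarith
    · left
      have hz : z21 = 0 := by
        by_contra hne; exact hE3 (hE2 (Nat.pos_of_ne_zero hne))
      subst hz
      have : ¬ a1 < a2 := fun h => hmax ⟨h, hE3⟩
      omega

end Min

end Chores

namespace Chores

/-! ### Pairs that envy, with few costly chores -/


section Pair

variable {k : ℝ} {a1 a2 a3 z12 z21 z31 z32 g3 h1 h2 h3 : ℕ}

theorem exists_balanced {a1 a2 b : ℕ} (h1 : a1 ≤ a2 + b + 1) (h2 : a2 ≤ a1 + b + 1) :
    ∃ y1 y2, y1 + y2 = b ∧ a1 + y1 ≤ a2 + y2 + 1 ∧ a2 + y2 ≤ a1 + y1 + 1 := by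
  rcases le_total a1 a2 with h | h
  · exact ⟨(a1 + a2 + b) / 2 - a1, (a1 + a2 + b + 1) / 2 - a2, by omega, by omega, by omega⟩
  · exact ⟨(a1 + a2 + b + 1) / 2 - a1, (a1 + a2 + b) / 2 - a2, by omega, by omega, by omega⟩

/-- In a minimizer, if agents `1` and `2` only hold chores that are low for one of them and high
for `3`, and `1` holds some that are low for both, then `1` does not envy `3`. -/
theorem IsMin.pair_low (hk : 1 < k)
    (hm : IsMin k a1 a2 a3 z12 z21 0 z31 0 z32 0 0 g3 0 0 h3)
    (hS : ¬ Solv k a1 a2 a3 (z12 + z21) z31 z32 g3 h3) (hz : 0 < z12)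
    (hD : (a3 + z31 + z32 + g3 + k * h3 + (k - 1) * (a3 + z32) : ℝ) < a1 + z12 - 1) : False := by
  have hlow := hm.low (Or.inl hz)
  push_cast at hlow
  have t1 : (k - 1) * th a2 ≤ (k - 1) * 1 :=
    mul_le_mul_of_nonneg_left (th_le_one a2) (by linarith)
  have t2 : 0 ≤ (k - 1) * th a1 := mul_nonneg (by linarith) (th_nonneg a1)
  have e0 : 0 ≤ (a3 + z31 + z32 + g3 : ℝ) := by positivity
  have e1 : 0 ≤ k * h3 := by positivity
  have e2 : 0 ≤ (k - 1) * (a3 + z32 : ℝ) := mul_nonneg (by linarith) (by positivity)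
  have hc1 : 2 ≤ a1 + z12 := by
    have : (1 : ℝ) < a1 + z12 := by linarith
    exact_mod_cast this
  -- The chores of the pair can be split evenly unless one of them has too many private chores. For
  -- agent `1` this contradicts minimality; for agent `2` it is met by raising her weight.
  by_cases hA : a1 ≤ a2 + (z12 + z21) + 1
  · by_cases hB : a2 ≤ a1 + (z12 + z21) + 1
    · obtain ⟨y1, y2, hy, b1, b2⟩ := exists_balanced hA hB
      rw [← hy] at hS
      have hsum : (a1 + y1 + (a2 + y2) : ℝ) = a1 + z12 + (a2 + z21) := by
        exact_mod_cast (by omega : a1 + y1 + (a2 + y2) = a1 + z12 + (a2 + z21))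
      have b1' : (a1 + y1 : ℝ) ≤ a2 + y2 + 1 := by exact_mod_cast b1
      have b2' : (a2 + y2 : ℝ) ≤ a1 + y1 + 1 := by exact_mod_cast b2
      have p1 : (1 : ℝ) ≤ a1 + y1 := by exact_mod_cast (by omega : 1 ≤ a1 + y1)
      have p2 : (1 : ℝ) ≤ a2 + y2 := by exact_mod_cast (by omega : 1 ≤ a2 + y2)
      have q1 := mul_le_mul_of_nonneg_left p1 (by linarith : 0 ≤ k - 1)
      have q2 := mul_le_mul_of_nonneg_left p2 (by linarith : 0 ≤ k - 1)
      by_cases hE : ((0 : ℕ) + (0 : ℕ) + z31 + g3 + k * ((0 : ℕ) + a3 + z32 + h3) : ℝ) < a1 + y1 - 1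
        ∨ ((0 : ℕ) + (0 : ℕ) + z32 + g3 + k * ((0 : ℕ) + a3 + z31 + h3) : ℝ) < a2 + y2 - 1
      · exact hS (solv_of_balanced hk _ rfl b1 b2 hE)
      · push Not at hE
        obtain ⟨E1, E2⟩ := hE
        push_cast at E1 E2
        apply hS
        have n1 := mul_nonneg (by linarith : 0 ≤ k - 1) (Nat.cast_nonneg (α := ℝ) a1)
        have n2 := mul_nonneg (by linarith : 0 ≤ k - 1) (Nat.cast_nonneg (α := ℝ) a2)
        have := solv_flat (k := k) (by linarith) (a1 := a1) (a2 := a2) (a3 := a3) (z12 := y1)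
          (z21 := y2) (z13 := 0) (z31 := z31) (z23 := 0) (z32 := z32) (g1 := 0) (g2 := 0) (g3 := g3)
          (h1 := 0) (h2 := 0) (h3 := h3) ?_ ?_ ?_ ?_ ?_ ?_
        · simpa using this
        all_goals apply NE.of_le hk.le
        all_goals push_cast
        all_goals linarith
    · have hab : a1 + (z12 + z21) + 2 ≤ a2 := by omega
      have hab' : (a1 + (z12 + z21) + 2 : ℝ) ≤ a2 := by exact_mod_cast hab
      -- Agent `2` keeps just her private chores, while `1` and `3` divide all others.
      obtain ⟨c, h, c', h', O⟩ := exists_out hk (a1 + (z12 + z21)) (a3 + z32) (z31 + g3) h3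
      have hB : a3 + z32 ≤ a2 := by
        have : (a3 + z32 : ℝ) ≤ a2 := by
          have : 0 ≤ (z31 + g3 : ℝ) := by positivity
          linarith [Nat.cast_nonneg (α := ℝ) z21]
        exact_mod_cast this
      have h2a : (2 : ℝ) ≤ a2 := by exact_mod_cast (by omega : 2 ≤ a2)
      have := mul_le_mul_of_nonneg_left h2a (by linarith : 0 ≤ k - 1)
      refine (O.of_not_solv hk fun h => hS h.swap12).2.2
        (O.ne_of_le hk ?_ (Or.inl (by omega)) hB)
      push_cast
      linarith [Nat.cast_nonneg (α := ℝ) z21]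
  · have : (a2 + (z12 + z21) + 2 : ℝ) ≤ a1 := by
      exact_mod_cast (by omega : a2 + (z12 + z21) + 2 ≤ a1)
    rw [th_pos (by omega)] at hlow
    linarith [Nat.cast_nonneg (α := ℝ) z12]

/-! ### Arithmetic of passing a costly chore to agent `3` -/

theorem exists_ceil_div (hk : 1 < k) (t : ℕ) :
    ∃ q : ℕ, (t : ℝ) - 1 ≤ k * q ∧ (q = 0 ∨ k * (q - 1) < (t : ℝ) - 1) := by
  have hk0 : 0 < k := by linarith
  refine ⟨⌈((t : ℝ) - 1) / k⌉₊, ?_, ?_⟩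
  · have := Nat.le_ceil (((t : ℝ) - 1) / k)
    rwa [div_le_iff₀' hk0] at this
  · rcases Nat.eq_zero_or_pos ⌈((t : ℝ) - 1) / k⌉₊ with h | h
    · exact Or.inl h
    · right
      have := Nat.ceil_lt_add_one (Nat.ceil_pos.1 h).le
      rw [← sub_lt_iff_lt_add, lt_div_iff₀' hk0] at this
      exact this

-- Agent `2` passes a costly chore to `3` and receives `s` chores low for `1` and `2` from `1`. Here
-- `t` counts the low chores of `3`, `dis` those of them that are high for `1`, and `q` costly
-- chores make up for all but one of the `t`. The conclusions say that `1` does not envy `2`, that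
-- `3` envies neither `1` nor `2`, and that `2` envies neither `1` nor `3`. The first and third
-- bound `s` from below, the others from above. The larger of the two lower bounds is taken; both
-- are shown to respect every upper bound.
set_option maxHeartbeats 1600000 in
theorem exists_shift (hk : 1 < k) {t dis q : ℕ} (hz : 0 < z12) (hh : 0 < h2)
    (hq1 : (t : ℝ) - 1 ≤ k * q) (hq2 : q = 0 ∨ k * (q - 1) < (t : ℝ) - 1)
    (hdis : a3 ≤ dis) (hdt : dis ≤ t)
    (F1 : (t + k * h3 + (k - 1) * dis : ℝ) < a1 + z12 - 1)
    (F2 : (a2 + z21 + k * h2 + (k - 1) * th a2 : ℝ) ≤ t + k * h3 + (k - 1) * th a3 + k)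
    (F3 : (a1 + z12 + (k - 1) * th a1 : ℝ) ≤ a2 + z21 + k * h2 + (k - 1) * th a2 + 1)
    (M4 : 2 < k → 2 ≤ z12 → dis + 2 ≤ t →
      (a2 + z21 + k * h2 + (k - 1) * th a2 : ℝ) ≤ t + k * h3 + (k - 1) * th a3 + (k - 2))
    (M5 : 2 ≤ z12 → dis + 1 ≤ t →
      (a1 + z12 + (k - 1) * th a1 : ℝ) ^ 2 + (a2 + z21 + k * h2 + (k - 1) * th a2) ^ 2 +
        (t + k * h3 + (k - 1) * th a3) ^ 2 ≤
      (a1 + z12 + (k - 1) * th a1 - 1 : ℝ) ^ 2 + (a2 + z21 + k * h2 + (k - 1) * th a2 + (2 - k)) ^ 2 +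
        (t + k * h3 + (k - 1) * th a3 + (k - 1)) ^ 2) :
    ∃ s ≤ z12, (a1 + z12 - s - 1 : ℝ) ≤ a2 + z21 + k * h2 - k + s + (k - 1) * a2 ∧
      1 + h3 + q + s ≤ a1 + z12 ∧ 1 + h3 + q + 1 ≤ a2 + z21 + s + h2 ∧
      (a2 + z21 + k * h2 - k + s - 1 : ℝ) ≤ a1 + z12 - s + (k - 1) * a1 ∧
      (a2 + z21 + k * h2 - k + s - 1 : ℝ) ≤ t + k * h3 + k + (k - 1) * th a3 := by
  have hk1 : 0 ≤ k - 1 := by linarith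
  have tA3 := mul_le_mul_of_nonneg_left ((th_le a3).trans (Nat.cast_le.2 hdis)) hk1
  have tA3' := mul_le_mul_of_nonneg_left (th_le_one a3) hk1
  have tA30 := mul_nonneg hk1 (th_nonneg a3)
  have tA2 := mul_le_mul_of_nonneg_left (th_le a2) hk1
  have tA2' := mul_le_mul_of_nonneg_left (th_le_one a2) hk1
  have tA20 := mul_nonneg hk1 (th_nonneg a2)
  have tA1 := mul_le_mul_of_nonneg_left (th_le a1) hk1
  have tA10 := mul_nonneg hk1 (th_nonneg a1)
  have hd0 := mul_nonneg hk1 (Nat.cast_nonneg (α := ℝ) dis)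
  have hh' : (1 : ℝ) ≤ h2 := by exact_mod_cast hh
  have hkh : k * 1 ≤ k * h2 := mul_le_mul_of_nonneg_left hh' (by linarith)
  have hkq : k * q ≤ (t : ℝ) - 1 + k ∨ t = 0 := by
    rcases hq2 with rfl | h
    · rcases Nat.eq_zero_or_pos t with h | h
      · exact Or.inr h
      · left; have : (1 : ℝ) ≤ t := by exact_mod_cast h
        push_cast; linarith
    · left; linarith
  have ht0 : t = 0 → q = 0 := by
    rintro rfl
    rcases hq2 with h | h
    · exact h
    · by_contra hne
      have : (1 : ℝ) ≤ q := by exact_mod_cast Nat.pos_of_ne_zero hne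
      have := mul_nonneg (by linarith : 0 ≤ k) (by linarith : (0 : ℝ) ≤ q - 1)
      push_cast at h; linarith
  have hqt : 1 ≤ t → q + 1 ≤ t := by
    intro h1
    rcases hq2 with rfl | h
    · omega
    · have : (1 : ℝ) ≤ t := by exact_mod_cast h1
      have : (q : ℝ) < t := by
        by_contra hc
        have := mul_nonneg hk1 (by linarith : (0 : ℝ) ≤ q - 1)
        linarith
      exact_mod_cast this
  have hkh3 := cast_le_mul hk.le h3
  have hNa : t + h3 + 2 ≤ a1 + z12 := by
    have : (t + h3 + 1 : ℝ) < a1 + z12 := by linarith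
    exact_mod_cast this
  have hp2 : (a2 + z21 + k * h2 : ℝ) < a1 + z12 - 1 + k := by linarith
  have hkc : (a2 + z21 + k * h2 + (k - 1) * th a2 : ℝ) ≤ k * (a2 + z21 + h2) := by
    have := mul_nonneg hk1 (Nat.cast_nonneg (α := ℝ) z21)
    linarith
  -- the lower bounds for `s`
  obtain ⟨s1, hs1⟩ : ∃ s1 : ℕ, s1 = ⌈((a1 + z12) - (a2 + z21 + k * h2) + k - 1 - (k - 1) * a2 : ℝ) / 2⌉₊ :=
    ⟨_, rfl⟩
  obtain ⟨s2, hs2⟩ : ∃ s2 : ℕ, s2 = 1 + h3 + q + 1 - (a2 + z21 + h2) := ⟨_, rfl⟩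
  have l1 : ((a1 + z12) - (a2 + z21 + k * h2) + k - 1 - (k - 1) * a2 : ℝ) / 2 ≤ s1 :=
    hs1 ▸ Nat.le_ceil _
  have l1' : s1 = 0 ∨
      2 * (s1 : ℝ) < (a1 + z12) - (a2 + z21 + k * h2) + k + 1 - (k - 1) * a2 := by
    rcases Nat.eq_zero_or_pos s1 with h | h
    · exact Or.inl h
    · right
      rw [hs1] at h
      have := Nat.ceil_lt_add_one (Nat.ceil_pos.1 h).le
      rw [← hs1] at this
      linarith
  have A2nn := mul_nonneg hk1 (Nat.cast_nonneg (α := ℝ) a2)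
  have A1nn := mul_nonneg hk1 (Nat.cast_nonneg (α := ℝ) a1)
  have c1z : s1 ≤ z12 := by
    rw [hs1, Nat.ceil_le]
    rcases Nat.eq_zero_or_pos a1 with h0 | h0
    · subst h0; push_cast at *; linarith [Nat.cast_nonneg (α := ℝ) a2, Nat.cast_nonneg (α := ℝ) z21]
    · rw [th_pos h0] at F3
      have : (1 : ℝ) ≤ z12 := by exact_mod_cast hz
      linarith
  have hlow : (t + k * h3 + (k - 1) * th a1 : ℝ) < k * (a2 + z21 + h2) := by linarith
  have c1a : 1 + h3 + q + s1 ≤ a1 + z12 := by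
    have hN : 1 + h3 + q ≤ a1 + z12 := by
      rcases Nat.eq_zero_or_pos t with h0 | h0
      · have := ht0 h0; omega
      · have := hqt h0; omega
    suffices h : s1 ≤ a1 + z12 - (1 + h3 + q) by omega
    rw [hs1, Nat.ceil_le]
    push_cast [hN]
    by_contra! hlt
    have e0 : (0 : ℝ) ≤ a2 := Nat.cast_nonneg _
    have e1 : (0 : ℝ) ≤ z21 := Nat.cast_nonneg _
    have hNa' : (t + h3 + 2 : ℝ) ≤ a1 + z12 := by exact_mod_cast hNa
    have hh3 : h3 = 0 := by
      have : (k - 1) * h3 < (k - 1) * 1 := by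
        rcases Nat.eq_zero_or_pos t with h0 | h0
        · have := ht0 h0; subst h0 this; push_cast at *; linarith
        · have : (q + 1 : ℝ) ≤ t := by exact_mod_cast hqt h0
          linarith
      have := lt_of_mul_lt_mul_left this hk1
      have : h3 < 1 := by exact_mod_cast this
      omega
    subst hh3
    rcases Nat.eq_zero_or_pos t with h0 | h0
    · have := ht0 h0; subst h0 this; push_cast at *; linarith
    · have hqt' : (q + 1 : ℝ) ≤ t := by exact_mod_cast hqt h0
      push_cast at *
      rcases hq2 with rfl | hq2
      · push_cast at *; linarith
      · have h2q : (2 : ℝ) < q := by linarith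
        have := mul_le_mul_of_nonneg_left (by linarith : (1 : ℝ) ≤ q - 1) hk1
        linarith
  have hq3 : 1 ≤ t → k * (q - 1) < (t : ℝ) := by
    intro h1
    rcases hkq with h | h
    · linarith
    · omega
  have hcard : 1 + h3 + q ≤ a2 + z21 + h2 + 1 ∧ (t = 0 ∨ 0 < a1 → 1 + h3 + q ≤ a2 + z21 + h2) := by
    have e1 : ∀ x : ℝ, k * (h3 + q - x) ≤ t + k * h3 + (k - 1) * th a1 →
        (h3 + q - x : ℝ) < a2 + z21 + h2 := fun x hx =>
      lt_of_mul_lt_mul_left (hx.trans_lt hlow) (by linarith)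
    constructor
    · suffices h : h3 + q < a2 + z21 + h2 + 1 by omega
      have := e1 1 (by
        rcases Nat.eq_zero_or_pos t with h0 | h0
        · have := ht0 h0; subst h0 this; push_cast; linarith
        · have := hq3 h0; linarith)
      have h : (h3 + q : ℝ) < a2 + z21 + h2 + 1 := by linarith
      exact_mod_cast h
    · intro h
      suffices h : h3 + q < a2 + z21 + h2 by omega
      have := e1 0 (by
        rcases Nat.eq_zero_or_pos t with h0 | h0
        · have := ht0 h0; subst h0 this; push_cast; linarith
        · rw [th_pos (by omega)]
          have := hq3 h0; linarith [hkq.resolve_right (by omega)])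
      rw [sub_zero] at this
      exact_mod_cast this
  have c2a : 1 + h3 + q + s2 ≤ a1 + z12 := by
    rcases Nat.eq_zero_or_pos t with h0 | h0
    · have := ht0 h0; have := hcard.2 (Or.inl h0); omega
    · have := hqt h0; have := hcard.1; omega
  have c2z : s2 ≤ z12 := by
    rcases Nat.eq_zero_or_pos a1 with h0 | h0
    · omega
    · have := hcard.2 (Or.inr h0); omega
  have c1r : (a2 + z21 + k * h2 - k + s1 - 1 : ℝ) ≤ a1 + z12 - s1 + (k - 1) * a1 := by
    rcases l1' with rfl | h
    · push_cast; linarith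
    · linarith
  have c1t : (a2 + z21 + k * h2 - k + s1 - 1 : ℝ) ≤ t + k * h3 + k + (k - 1) * th a3 := by
    rcases l1' with rfl | h
    · push_cast; linarith
    · rcases Nat.eq_zero_or_pos s1 with rfl | h0
      · push_cast; linarith
      · have : (1 : ℝ) ≤ s1 := by exact_mod_cast h0
        linarith
  -- `s2 ≤ 1` is easy, and `s2 = 2` is the largest possible value. Only there are the exchanges `M4`
  -- (for `2 < k`) and `M5` (for `k ≤ 2`) needed.
  have c2r : (a2 + z21 + k * h2 - k + s2 - 1 : ℝ) ≤ a1 + z12 - s2 + (k - 1) * a1 := by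
    by_cases hs : s2 ≤ 1
    · have : (s2 : ℝ) ≤ 1 := by exact_mod_cast hs
      linarith
    have ht : t ≠ 0 := fun h => by have := hcard.2 (Or.inl h); omega
    have ha1 : a1 = 0 := by
      by_contra h; have := hcard.2 (Or.inr (Nat.pos_of_ne_zero h)); omega
    have hs2' : s2 = 2 := by have := hcard.1; omega
    have hc : a2 + z21 + h2 = h3 + q := by omega
    have hcR : (a2 + z21 + h2 : ℝ) = h3 + q := by exact_mod_cast hc
    rw [hs2']
    subst ha1
    by_contra! hlt
    push_cast at *
    rw [hcR] at hlow hkc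
    have hq0 : q ≠ 0 := by
      rintro rfl; push_cast at *; linarith [Nat.cast_nonneg (α := ℝ) t]
    have hq1' : (1 : ℝ) ≤ q := by exact_mod_cast Nat.pos_of_ne_zero hq0
    have hkq' := hq2.resolve_left hq0
    have ht2 : 2 ≤ t := by
      have : (1 : ℝ) < t := by
        have := mul_nonneg (by linarith : 0 ≤ k) (by linarith : (0 : ℝ) ≤ q - 1); linarith
      exact_mod_cast this
    have hz2 : 2 ≤ z12 := by omega
    have hp2' : (a2 + z21 + k * h2 : ℝ) = k * (h3 + q) - (k - 1) * (a2 + z21) := by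
      rw [← hcR]; ring
    have hsmall : (k - 1) * (a2 + z21 + dis : ℝ) < 1 := by linarith
    rcases le_or_gt k 2 with hk2 | hk2
    · have hdt' : dis + 1 ≤ t := by
        by_contra hne
        have : t = dis := by omega
        subst this
        have h1 : k * (t - 1 : ℝ) < k * q := by
          have := mul_nonneg hk1 (by positivity : (0 : ℝ) ≤ a2 + z21)
          linarith
        have h1 := lt_of_mul_lt_mul_left h1 (by linarith)
        have h2 : (t : ℝ) ≤ q := by
          have : (t : ℝ) < q + 1 := by linarith
          exact_mod_cast Nat.lt_succ_iff.1 (by exact_mod_cast this)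
        have h3 := mul_le_mul_of_nonneg_left h2 (by linarith : 0 ≤ k)
        have ht2' : (2 : ℝ) ≤ t := by exact_mod_cast ht2
        have := mul_le_mul_of_nonneg_left ht2' hk1
        linarith
      have hM := M5 hz2 hdt'
      rw [th_zero] at hM
      have hA : 0 < (z12 : ℝ) - (t + k * h3 + (k - 1) * th a3) - 1 := by linarith
      have hB : 0 < (t + k * h3 + (k - 1) * th a3) + (k - 1) -
        (a2 + z21 + k * h2 + (k - 1) * th a2) := by
        have := mul_nonneg hk1 (Nat.cast_nonneg (α := ℝ) z21)
        linarith
      generalize (t + k * h3 + (k - 1) * th a3 : ℝ) = c at *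
      generalize (a2 + z21 + k * h2 + (k - 1) * th a2 : ℝ) = b at *
      have := mul_nonneg (by linarith : 0 ≤ 2 - k) hB.le
      nlinarith
    · have h0 : (a2 + z21 + dis : ℝ) < 1 := by
        by_contra! hc
        have := mul_le_mul_of_nonneg_left hc hk1
        linarith
      have h0 : a2 + z21 + dis < 1 := by exact_mod_cast h0
      have hM := M4 hk2 hz2 (by omega)
      have : a3 = 0 := by omega
      subst this
      rw [th_zero] at hM
      linarith
  have c2t : (a2 + z21 + k * h2 - k + s2 - 1 : ℝ) ≤ t + k * h3 + k + (k - 1) * th a3 := by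
    rcases Nat.eq_zero_or_pos s2 with h0 | h0
    · rw [h0]; push_cast; linarith
    · have hs : (s2 + (a2 + z21 + h2) : ℝ) = 1 + h3 + q + 1 := by
        exact_mod_cast (by omega : s2 + (a2 + z21 + h2) = 1 + h3 + q + 1)
      suffices h : k * ((k - 1) * h2 + h3 + q + 1) ≤ k * (t + k * h3 + 2 * k) by
        have := le_of_mul_le_mul_left h (by linarith); linarith
      have e1 : (k * h2 : ℝ) ≤ t + k * h3 + (k - 1) + k := by
        linarith [Nat.cast_nonneg (α := ℝ) a2, Nat.cast_nonneg (α := ℝ) z21]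
      have e2 := mul_le_mul_of_nonneg_left e1 hk1
      have e3 : k * q ≤ (t : ℝ) - 1 + k := by
        rcases hkq with h | h
        · exact h
        · rw [ht0 h, h]; push_cast; linarith
      nlinarith
  rcases le_total s1 s2 with h | h
  · have h' : (s1 : ℝ) ≤ s2 := by exact_mod_cast h
    exact ⟨s2, c2z, by linarith, c2a, by omega, c2r, c2t⟩
  · exact ⟨s1, c1z, by linarith, c1a, by omega, c1r, c1t⟩

end Pair

end Chores

namespace Chores

/-! ### Pairs that envy, the second agent holding costly chores -/


section Pair

variable {k : ℝ} {a1 a2 a3 z12 z21 z31 z32 g3 h1 h2 h3 : ℕ}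

/-- Agent `3` may pass `j` chores to agent `1` that are low for both. -/
theorem exists_pass {z31 g3 j : ℕ} (h : j ≤ z31 + g3) :
    ∃ x y x' y', x + x' = z31 ∧ y + y' = g3 ∧ x + y = j := by
  rcases le_total j z31 with h1 | h1
  · exact ⟨j, 0, z31 - j, g3, by omega, by omega, by omega⟩
  · exact ⟨z31, j - z31, 0, z31 + g3 - j, by omega, by omega, by omega⟩

/-- In a minimizer, if agent `1` has no chores with high cost, agent `2` has some, and the low
chores of both are high for `3`, then `1` does not envy `3`. -/
theorem IsMin.pair_high_two (hk : 1 < k)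
    (hm : IsMin k a1 a2 a3 z12 z21 0 z31 0 z32 0 0 g3 0 h2 h3)
    (hS : ¬ Solv k a1 a2 a3 (z12 + z21) z31 z32 g3 (h2 + h3)) (hz : 0 < z12) (hh : 0 < h2)
    (hD : (a3 + z31 + z32 + g3 + k * h3 + (k - 1) * (a3 + z32) : ℝ) < a1 + z12 - 1) : False := by
  obtain ⟨p, rfl⟩ : ∃ p, h2 = p + 1 := ⟨h2 - 1, by omega⟩
  have F3 := hm.low (Or.inl hz)
  have F2 := hm.swap12.swap23.high hk hh
  push_cast at F2 F3
  obtain ⟨q, hq1, hq2⟩ := exists_ceil_div hk (a3 + z31 + z32 + g3)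
  obtain ⟨s, hs, c12, c13, c32, c21, c23⟩ := exists_shift (a1 := a1) (a2 := a2) (a3 := a3)
    (z12 := z12) (z21 := z21) (h2 := p + 1) (h3 := h3) (dis := a3 + z32)
    hk hz hh hq1 hq2 (by omega) (by omega) (by push_cast; linarith) (by push_cast; linarith)
    (by push_cast; linarith) (by
      intro hk2 hz2 ht
      obtain ⟨z, rfl⟩ : ∃ z, z12 = z + 2 := ⟨z12 - 2, by omega⟩
      obtain ⟨x, y, x', y', rfl, rfl, hxy⟩ := exists_pass (by omega : 2 ≤ z31 + g3)
      have hxy' : (x + y : ℝ) = 2 := by exact_mod_cast hxy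
      -- A cyclic exchange: two cheap chores go from `1` to `2`, a costly one from `2` to `3`, two
      -- cheap ones from `3` to `1`. The net effect is a shift of `k - 2` from `2` to `3`.
      have := hm z (z21 + 2) x x' 0 z32 y 0 y' 0 p (h3 + 1) (by omega) (by omega) (by omega)
        (by omega) (by omega)
      apply le_of_sq_shift (by linarith)
      obtain rfl : y = 2 - x := by omega
      have hx : x ≤ 2 := by omega
      unfold Phi at this; push_cast [hx] at this ⊢; linarith) (by
      intro hz2 ht
      obtain ⟨z, rfl⟩ : ∃ z, z12 = z + 2 := ⟨z12 - 2, by omega⟩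
      obtain ⟨x, y, x', y', rfl, rfl, hxy⟩ := exists_pass (by omega : 1 ≤ z31 + g3)
      -- With only one chore returning to `1`, the three costs change by `-1`, `2 - k` and `k - 1`.
      have := hm z (z21 + 2) x x' 0 z32 y 0 y' 0 p (h3 + 1) (by omega) (by omega) (by omega)
        (by omega) (by omega)
      obtain rfl : y = 1 - x := by omega
      have hx : x ≤ 1 := by omega
      unfold Phi at this; push_cast [hx] at this ⊢; linarith)
  obtain ⟨z, rfl⟩ : ∃ z, z12 = s + z := ⟨z12 - s, by omega⟩
  push_cast at c12 c21 c23 hq1 F2 F3 hD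
  have c13' : (1 + h3 + q : ℝ) ≤ a1 + z := by exact_mod_cast (by omega : 1 + h3 + q ≤ a1 + z)
  have c32' : (1 + h3 + q : ℝ) ≤ a2 + z21 + s + p := by
    exact_mod_cast (by omega : 1 + h3 + q ≤ a2 + z21 + s + p)
  have k13 := mul_le_mul_of_nonneg_left c13' (by linarith : 0 ≤ k)
  have k32 := mul_le_mul_of_nonneg_left c32' (by linarith : 0 ≤ k)
  have hk1 : 0 ≤ k - 1 := by linarith
  have tA3 := mul_le_mul_of_nonneg_left (th_le a3) hk1
  have tA2 := mul_le_mul_of_nonneg_left (th_le_one a2) hk1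
  have tA10 := mul_nonneg hk1 (th_nonneg a1)
  have n1 := mul_nonneg hk1 (Nat.cast_nonneg (α := ℝ) z31)
  have n2 := mul_nonneg hk1 (Nat.cast_nonneg (α := ℝ) z32)
  have hkq : 0 ≤ k * q := by positivity
  apply hS
  have := solv_flat (k := k) (by linarith) (a1 := a1) (a2 := a2) (a3 := a3) (z12 := z)
    (z21 := s + z21) (z13 := 0) (z31 := z31) (z23 := 0) (z32 := z32) (g1 := 0) (g2 := 0) (g3 := g3)
    (h1 := 0) (h2 := p) (h3 := h3 + 1) ?_ ?_ ?_ ?_ ?_ ?_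
  · convert this using 1 <;> ring
  · apply NE.of_le hk.le; push_cast; linarith
  · apply NE.of_le hk.le; push_cast; linarith
  · apply NE.of_le hk.le; push_cast; linarith
  · apply NE.of_le hk.le; push_cast; linarith
  · constructor
    · intro _; push_cast; linarith
    · intro _; push_cast
      rcases Nat.eq_zero_or_pos (a3 + z31 + z32 + g3) with h0 | h0
      · have : (a3 + z31 + z32 + g3 : ℝ) = 0 := by exact_mod_cast h0
        linarith
      · have : (1 : ℝ) ≤ a3 + z31 + z32 + g3 := by exact_mod_cast h0
        linarith
  · constructor
    · intro _; push_cast; linarith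
    · intro _; push_cast
      linarith

end Pair

end Chores

namespace Chores

/-! ### Pairs that envy, the first agent holding costly chores -/


section Pair

variable {k : ℝ} {a1 a2 a3 z12 z21 z31 z32 g3 h1 h2 h3 : ℕ}

theorem lt_of_not_ne (hk : 1 ≤ k) {c h : ℕ} {D : ℝ} (hN : ¬ NE k c h D) : D < c + k * h - 1 := by
  by_contra hc
  exact hN (NE.of_le hk (not_lt.1 hc))

/-- The solutions in which agent `3` takes one more chore with high cost from the agents `1` and
`2`, who share all the other chores. -/
theorem solv_of_take (hk : 1 < k) {z b13 g x1 x2 y1 y2 j1 j2 : ℕ} (ha3 : a3 ≤ 1)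
    (hx : x1 + x2 = z) (hy : y1 + y2 = g) (hj : j1 + j2 + 1 = h1 + h2)
    (e12 : NE k (x1 + b13 + y1) j1 (a2 + x2 + y2 + k * j2 + (k - 1) * a2))
    (e13 : NE k (x1 + b13 + y1) j1 (k * (h3 + a3 + 1)))
    (e21 : NE k (a2 + x2 + y2) j2 (x1 + b13 + y1 + k * j1 + (k - 1) * b13))
    (e23 : NE k (a2 + x2 + y2) j2 (k * (h3 + a3 + 1)))
    (e31 : k * (h3 + a3) ≤ x1 + b13 + y1 + k * j1 + (k - 1) * x1)
    (e32 : k * (h3 + a3) ≤ a2 + x2 + y2 + k * j2 + (k - 1) * (a2 + x2)) :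
    Solv k 0 a2 a3 z b13 0 g (h1 + h2 + h3) := by
  subst hx hy
  have := solv_flat (k := k) (by linarith) (a1 := 0) (a2 := a2) (a3 := a3) (z12 := x1)
    (z21 := x2) (z13 := b13) (z31 := 0) (z23 := 0) (z32 := 0) (g1 := y1) (g2 := y2) (g3 := 0)
    (h1 := j1) (h2 := j2) (h3 := h3 + 1) ?_ ?_ ?_ ?_ ?_ ?_
  · convert this using 1 <;> omega
  · convert e12 using 1
    · ring
    · push_cast; ring
  · convert e13 using 1
    · ring
    · push_cast; ring
  · convert e21 using 1 <;> push_cast <;> ring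
  · convert e23 using 1 <;> push_cast <;> ring
  -- Agent `3` holds `a3 ≤ 1` cheap chores and `h3 + 1` costly ones. Removing a cheapest one leaves
  -- `k * (h3 + a3)` for `a3 = 0` and for `a3 = 1` alike.
  · interval_cases a3 <;> constructor <;> intro h <;> push_cast at * <;> first | omega | linarith
  · interval_cases a3 <;> constructor <;> intro h <;> push_cast at * <;> first | omega | linarith

set_option maxHeartbeats 1000000 in
/-- In a minimizer, if agent `1` has some chores with high cost, and the low chores of agents `1`
and `2` are high for `3`, and `1` holds some that are low for both, then `1` does not envy `3`. -/
theorem IsMin.pair_high_one (hk : 1 < k)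
    (hm : IsMin k 0 a2 a3 z12 z21 0 z31 0 z32 0 0 g3 h1 h2 h3)
    (hS : ¬ Solv k 0 a2 a3 (z12 + z21) z31 z32 g3 (h1 + h2 + h3)) (hz : 0 < z12) (hh : 0 < h1)
    (hD : (a3 + z31 + z32 + g3 + k * h3 + (k - 1) * (a3 + z32) : ℝ) < z12 + k * h1 - 1) :
    False := by
  have hk1 : 0 ≤ k - 1 := by linarith
  obtain ⟨j, rfl⟩ : ∃ j, h1 = j + 1 := ⟨h1 - 1, by omega⟩
  have G3 := hm.low (Or.inl hz)
  have M2 := hm.swap23.high hk hh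
  rw [th_zero] at M2 G3
  push_cast at M2 G3 hD
  -- Envy and minimality leave agent `3` at most one chore that is low for her and high for `1`,
  -- necessarily a private one.
  have hsmall : (a3 : ℝ) + z32 < th a3 + 1 := by
    have : (k - 1) * (a3 + z32 : ℝ) < (k - 1) * (th a3 + 1) := by linarith
    exact lt_of_mul_lt_mul_left this hk1
  have hz32 : z32 = 0 ∧ a3 ≤ 1 ∧ th a3 = a3 := by
    rcases Nat.eq_zero_or_pos a3 with rfl | h0
    · rw [th_zero] at hsmall ⊢
      have : 0 + z32 < 0 + 1 := by exact_mod_cast hsmall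
      exact ⟨by omega, by omega, by simp⟩
    · rw [th_pos h0] at hsmall ⊢
      have : a3 + z32 < 1 + 1 := by exact_mod_cast hsmall
      have h3 : a3 = 1 := by omega
      subst h3
      exact ⟨by omega, le_rfl, by simp⟩
  obtain ⟨rfl, ha3, hth⟩ := hz32
  rw [hth] at M2
  push_cast at M2 hD
  -- A costly chore goes from `1` to `3` and `s` cheap ones come back, a net shift of `k - s`.
  -- Taking `s = ⌈k - 1⌉` shows that `3` has fewer than `k - 1` cheap chores to return.
  have M3 : ∀ s : ℕ, s ≤ z31 + g3 → (s : ℝ) < k →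
      (z12 + k * (j + 1) : ℝ) ≤ z31 + g3 + k * (h3 + a3) + (k - s) := by
    intro s hs hsk
    obtain ⟨x, y, x', y', rfl, rfl, hxy⟩ := exists_pass hs
    have hxy' : (x + y : ℝ) = s := by exact_mod_cast hxy
    have := hm z12 z21 x x' 0 0 y 0 y' j h2 (h3 + 1) (by omega) (by omega) (by omega)
      (by omega) (by omega)
    apply le_of_sq_shift (by linarith)
    rw [← hxy']
    unfold Phi at this; rw [th_zero, hth] at this; push_cast at this ⊢; linarith
  have ht : (z31 + g3 : ℝ) < k - 1 := by
    by_contra! hc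
    have := M3 ⌈k - 1⌉₊ (by rw [Nat.ceil_le]; push_cast; exact hc) (by
      have := Nat.ceil_lt_add_one hk1; linarith)
    have := Nat.le_ceil (k - 1)
    linarith
  have G2 := M3 (z31 + g3) le_rfl (by push_cast; linarith)
  push_cast at G2
  have G1 : (z31 + g3 + k * (h3 + a3) + 1 : ℝ) < z12 + k * (j + 1) := by
    linarith
  have G4 : 0 < h2 → (a2 + z21 + k * h2 + (k - 1) * th a2 : ℝ) ≤
      z31 + g3 + k * (h3 + a3) + k := fun h => by
    have := hm.swap12.swap23.high hk h
    rw [hth] at this; push_cast at this; linarith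
  have hz1 : (1 : ℝ) ≤ z12 := by exact_mod_cast hz
  have e31 : (0 : ℝ) ≤ z31 := Nat.cast_nonneg _
  have eg3 : (0 : ℝ) ≤ g3 := Nat.cast_nonneg _
  have hjh : j + 1 ≤ h3 + a3 := by
    have : k * (j + 1 : ℝ) < k * (h3 + a3 + 1) := by linarith
    have := lt_of_mul_lt_mul_left this (by linarith)
    have : j + 1 < h3 + a3 + 1 := by exact_mod_cast this
    omega
  have hjh' : (j + 1 : ℝ) ≤ h3 + a3 := by exact_mod_cast hjh
  have hkj := mul_le_mul_of_nonneg_left hjh' (by linarith : 0 ≤ k)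
  have hkz := mul_le_mul_of_nonneg_left hz1 hk1
  have kz31 := mul_nonneg hk1 e31
  have tA2 := mul_le_mul_of_nonneg_left (th_le a2) hk1
  have tA2' := mul_le_mul_of_nonneg_left (th_le_one a2) hk1
  have tA20 := mul_nonneg hk1 (th_nonneg a2)
  have hj0 : 0 ≤ k * j := by positivity
  have z21nn := mul_nonneg hk1 (Nat.cast_nonneg (α := ℝ) z21)
  have sol : ∀ {x1 x2 y1 y2 j1 j2 : ℕ}, _ := fun {x1 x2 y1 y2 j1 j2} hx hy hj i12 i13 i21 i23 i31
    i32 => hS (solv_of_take (x1 := x1) (x2 := x2) (y1 := y1) (y2 := y2) (j1 := j1) (j2 := j2)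
      hk ha3 hx hy hj i12 i13 i21 i23 i31 i32)
  classical
  -- without moving further chores
  have start : NE k (a2 + z21) h2 (z12 + z31 + g3 + k * j + (k - 1) * z31) →
      NE k (a2 + z21) h2 (k * (h3 + a3 + 1)) → False := by
    intro n1 n2
    refine sol (x1 := z12) (x2 := z21) (y1 := g3) (y2 := 0) (j1 := j) (j2 := h2) rfl rfl
      (by omega) (NE.of_le hk.le ?_) (NE.of_le hk.le ?_) n1 n2 ?_ ?_
    all_goals push_cast
    all_goals linarith
  rcases Nat.eq_zero_or_pos z21 with rfl | hz21
  swap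
  · have G5 := hm.swap12.low (Or.inl hz21)
    rw [th_zero] at G5
    push_cast at G5
    -- The least number of chores that `2` must pass to `1` in order not to envy her. Minimality of
    -- `s` keeps the bundle of `2` heavy enough for the others.
    have hex : ∃ s, s ≤ z21 ∧
        NE k (a2 + (z21 - s)) h2 (z12 + s + z31 + g3 + k * j + (k - 1) * z31) := by
      rcases Nat.eq_zero_or_pos a2 with rfl | ha2
      · refine ⟨z21, le_rfl, fun h => by omega, fun h => ?_⟩
        rw [th_zero] at G5
        have : (1 : ℝ) ≤ z21 := by exact_mod_cast hz21
        simp only [Nat.sub_self]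
        push_cast at *; linarith
      · refine ⟨1, hz21, NE.of_le hk.le ?_⟩
        rw [th_pos ha2] at G5
        push_cast [hz21]; linarith
    obtain ⟨hs, hN⟩ := Nat.find_spec hex
    have hmin := fun r => Nat.find_min (m := r) hex
    generalize Nat.find hex = s at *
    rcases Nat.eq_zero_or_pos s with rfl | hs0
    · refine start (by simpa using hN) (NE.of_le hk.le ?_)
      push_cast; linarith
    · obtain ⟨r, rfl⟩ : ∃ r, s = r + 1 := ⟨s - 1, by omega⟩
      have hr : ¬ NE k (a2 + (z21 - r)) h2 (z12 + r + z31 + g3 + k * j + (k - 1) * z31) :=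
        fun h => hmin r (by omega) ⟨by omega, h⟩
      have hr := lt_of_not_ne hk.le hr
      obtain ⟨z, rfl⟩ : ∃ z, z21 = r + 1 + z := ⟨z21 - (r + 1), by omega⟩
      have e1 : r + 1 + z - r = z + 1 := by omega
      rw [e1] at hr
      rw [Nat.add_sub_cancel_left] at hN
      push_cast at hr G5 hN
      have er : (0 : ℝ) ≤ r := Nat.cast_nonneg _
      have ker := mul_nonneg hk1 er
      have ea2 := mul_nonneg hk1 (Nat.cast_nonneg (α := ℝ) a2)
      have ez := mul_nonneg hk1 (Nat.cast_nonneg (α := ℝ) z)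
      refine sol (x1 := z12 + (r + 1)) (x2 := z) (y1 := g3) (y2 := 0) (j1 := j) (j2 := h2) (by omega)
        rfl (by omega) (NE.of_le hk.le ?_) (NE.of_le hk.le ?_) ?_ (NE.of_le hk.le ?_) ?_ ?_
      · push_cast; linarith
      · push_cast; linarith
      · convert hN using 1 <;> push_cast <;> ring
      · push_cast; linarith
      · push_cast; linarith
      · push_cast
        rcases Nat.eq_zero_or_pos (a2 + z) with h0 | h0
        · obtain ⟨rfl, rfl⟩ : a2 = 0 ∧ z = 0 := by omega
          push_cast at *
          have h2lt : k * (h3 + a3) < k * (h2 + 1 : ℝ) := by linarith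
          have h2lt := lt_of_mul_lt_mul_left h2lt (by linarith)
          have : h3 + a3 ≤ h2 := by
            have : h3 + a3 < h2 + 1 := by exact_mod_cast h2lt
            omega
          have : (h3 + a3 : ℝ) ≤ h2 := by exact_mod_cast this
          have := mul_le_mul_of_nonneg_left this (by linarith : 0 ≤ k)
          linarith
        · have : (1 : ℝ) ≤ a2 + z := by exact_mod_cast h0
          have := mul_le_mul_of_nonneg_left this hk1
          linarith
  push_cast at G3 G4
  rcases Nat.eq_zero_or_pos a2 with rfl | ha2
  · rw [th_zero] at G3 G4
    push_cast at G3 G4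
    have hlt : k * (h3 + a3) < k * (h2 : ℝ) := by linarith
    have hlt := lt_of_mul_lt_mul_left hlt (by linarith)
    have hlt : h3 + a3 < h2 := by exact_mod_cast hlt
    have hlt2 : k * (h2 : ℝ) < k * (h3 + a3 + 2) := by
      have := G4 (by omega); linarith
    have hlt2 := lt_of_mul_lt_mul_left hlt2 (by linarith)
    have hlt2 : h2 < h3 + a3 + 2 := by exact_mod_cast hlt2
    -- With `a2 = z21 = 0` the exchanges determine `h2`. Now `2` gives the costly chore to `3`, and
    -- `1` relieves herself by passing the least sufficient number of cheap chores to `2`.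
    obtain rfl : h2 = h3 + a3 + 1 := by omega
    have hex : ∃ s, s ≤ z12 + g3 ∧
        (z12 + k * (j + 1) + (z31 + g3) - s - 1 : ℝ) ≤ k * (h3 + a3) + s := by
      refine ⟨z12 + g3, le_rfl, ?_⟩
      push_cast
      rcases Nat.lt_or_ge (j + 1) (h3 + a3) with h | h
      · have : (j + 1 + 1 : ℝ) ≤ h3 + a3 := by exact_mod_cast h
        have := mul_le_mul_of_nonneg_left this (by linarith : 0 ≤ k)
        linarith
      · have : (h3 + a3 : ℝ) ≤ j + 1 := by exact_mod_cast h
        have := mul_le_mul_of_nonneg_left this (by linarith : 0 ≤ k)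
        linarith
    obtain ⟨hs, hN⟩ := Nat.find_spec hex
    have hmin := fun r => Nat.find_min (m := r) hex
    generalize Nat.find hex = s at *
    rcases Nat.eq_zero_or_pos s with rfl | hs0
    · push_cast at hN; linarith
    obtain ⟨r, rfl⟩ : ∃ r, s = r + 1 := ⟨s - 1, by omega⟩
    have hr : ¬ (z12 + k * (j + 1) + (z31 + g3) - r - 1 : ℝ) ≤ k * (h3 + a3) + r :=
      fun h => hmin r (by omega) ⟨by omega, h⟩
    push Not at hr
    obtain ⟨x, y, x', y', hx, hy, hxy⟩ := exists_pass hs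
    have hx' : (x + x' : ℝ) = z12 := by exact_mod_cast hx
    have hy' : (y + y' : ℝ) = g3 := by exact_mod_cast hy
    have hxy' : (x + y : ℝ) = r + 1 := by exact_mod_cast hxy
    have ex := mul_nonneg hk1 (Nat.cast_nonneg (α := ℝ) x)
    have ex' := mul_nonneg hk1 (Nat.cast_nonneg (α := ℝ) x')
    push_cast at hN
    have er : (0 : ℝ) ≤ r := Nat.cast_nonneg _
    refine sol (x1 := x') (x2 := x) (y1 := y') (y2 := y) (j1 := j + 1) (j2 := h3 + a3) (by omega)
        (by omega) (by omega) (NE.of_le hk.le ?_) (NE.of_le hk.le ?_) (NE.of_le hk.le ?_)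
        (NE.of_le hk.le ?_) ?_ ?_
    all_goals push_cast
    all_goals linarith
  · rw [th_pos ha2] at G3 G4
    have ha2' : (1 : ℝ) ≤ a2 := by exact_mod_cast ha2
    have ka2 := mul_le_mul_of_nonneg_left ha2' hk1
    rcases Nat.eq_zero_or_pos h2 with rfl | hh2
    · push_cast at G3
      have ha2 : 2 ≤ a2 := by
        by_contra hlt
        obtain rfl : a2 = 1 := by omega
        apply start <;> apply NE.of_le hk.le <;> push_cast <;> linarith
      have ha2' : (2 : ℝ) ≤ a2 := by exact_mod_cast ha2
      have ka2 := mul_le_mul_of_nonneg_left ha2' hk1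
      -- Agent `2` holds at least two chores, all private: she keeps them at a raised weight, and
      -- `1` and `3` divide the rest.
      obtain ⟨c, h, c', h', O⟩ := exists_out hk (0 + (z12 + 0)) (a3 + 0) (z31 + g3)
        (j + 1 + 0 + h3)
      have ea3 : (0 : ℝ) ≤ (k - 1) * a3 := mul_nonneg hk1 (Nat.cast_nonneg _)
      have hA : 0 + (z12 + 0) ≤ a2 := by
        have : (z12 : ℝ) ≤ a2 := by linarith
        have : z12 ≤ a2 := by exact_mod_cast this
        omega
      refine (O.of_not_solv hk fun h => hS h.swap12).2.2
        (O.ne_of_le hk ?_ (Or.inl hA) (by omega))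
      push_cast
      linarith
    · have G4 := G4 hh2
      obtain ⟨i, rfl⟩ : ∃ i, h2 = i + 1 := ⟨h2 - 1, by omega⟩
      by_cases hX : NE k (a2 + 0) (i + 1) (z12 + z31 + g3 + k * j + (k - 1) * z31)
      · refine start hX (NE.of_le hk.le ?_)
        push_cast at *; linarith
      have hX := lt_of_not_ne hk.le hX
      push_cast at hX G4 G3
      have hai : k * (h3 + a3) < k * (a2 + i + 1 : ℝ) := by linarith
      have hai := lt_of_mul_lt_mul_left hai (by linarith)
      have hai : h3 + a3 < a2 + i + 1 := by exact_mod_cast hai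
      have hai : (h3 + a3 : ℝ) ≤ a2 + i := by exact_mod_cast (by omega : h3 + a3 ≤ a2 + i)
      have hai := mul_le_mul_of_nonneg_left hai (by linarith : 0 ≤ k)
      -- Agent `2` would envy `1` if `1` gave up a costly chore, so `2` gives one to `3` instead and
      -- accepts `s` cheap chores. The least `s` is used, so that `2` does not become envious in
      -- turn.
      have hex : ∃ s, s ≤ z12 + g3 ∧
          NE k (z31 + (z12 + g3 - s)) (j + 1) (a2 + s + k * i + (k - 1) * a2) ∧
          NE k (z31 + (z12 + g3 - s)) (j + 1) (k * (h3 + a3 + 1)) := by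
        refine ⟨z12 + g3, le_rfl, ⟨fun h => ?_, fun h => ?_⟩, NE.of_le hk.le ?_⟩
        · have : (1 : ℝ) ≤ z31 := by exact_mod_cast (by omega : 1 ≤ z31)
          have := mul_le_mul_of_nonneg_left this hk1
          rw [Nat.sub_self]; push_cast; linarith
        · rw [Nat.sub_self]; push_cast
          rcases Nat.eq_zero_or_pos z31 with rfl | h0
          · push_cast at *; linarith
          · have : (1 : ℝ) ≤ z31 := by exact_mod_cast h0
            have := mul_le_mul_of_nonneg_left this hk1
            linarith
        · rw [Nat.sub_self]; push_cast; linarith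
      obtain ⟨hs, hN1, hN2⟩ := Nat.find_spec hex
      have hmin := fun r => Nat.find_min (m := r) hex
      generalize Nat.find hex = s at *
      obtain ⟨x, y, x', y', hx, hy, hxy⟩ := exists_pass hs
      have hx' : (x + x' : ℝ) = z12 := by exact_mod_cast hx
      have hy' : (y + y' : ℝ) = g3 := by exact_mod_cast hy
      have hxy' : (x + y : ℝ) = s := by exact_mod_cast hxy
      have ex := mul_nonneg hk1 (Nat.cast_nonneg (α := ℝ) x)
      have ex' := mul_nonneg hk1 (Nat.cast_nonneg (α := ℝ) x')
      have ey := Nat.cast_nonneg (α := ℝ) y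
      have hlows : z31 + (z12 + g3 - s) = x' + z31 + y' := by omega
      rw [hlows] at hN1 hN2
      have hcase : (s : ℝ) = 0 ∨ (a2 + (s - 1) + k * i + (k - 1) * a2 : ℝ) <
            z12 + z31 + g3 - (s - 1) + k * (j + 1) - 1 ∨
          k * (h3 + a3 + 1) < (z12 + z31 + g3 - (s - 1) + k * (j + 1) - 1 : ℝ) := by
        rcases Nat.eq_zero_or_pos s with h0 | h0
        · exact Or.inl (by exact_mod_cast h0)
        · right
          have hr := hmin (s - 1) (by omega)
          have e1 : z31 + (z12 + g3 - (s - 1)) = x' + z31 + y' + 1 := by omega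
          rw [e1] at hr
          by_contra hc
          push Not at hc
          refine hr ⟨by omega, NE.of_le hk.le ?_, NE.of_le hk.le ?_⟩
          · push_cast [h0]; linarith [hc.1]
          · push_cast; linarith [hc.2]
      refine sol (x1 := x') (x2 := x) (y1 := y') (y2 := y) (j1 := j + 1) (j2 := i) (by omega)
        (by omega) (by omega) ?_ hN2 (NE.of_le hk.le ?_) (NE.of_le hk.le ?_) ?_ ?_
      · convert hN1 using 1; linarith
      all_goals push_cast
      all_goals rcases hcase with h0 | hc | hc
      all_goals linarith

end Pair

end Chores

namespace Chores

/-! ### Existence of solutions -/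


open Finset

section Min

variable {k : ℝ} {a1 a2 a3 z12 z21 z13 z31 z23 z32 g1 g2 g3 h1 h2 h3 : ℕ}

theorem IsMin.ne_of_pair (hk : 1 < k)
    (hm : IsMin k a1 a2 a3 z12 z21 z13 z31 z23 z32 g1 g2 g3 h1 h2 h3)
    (hS : ¬ Solv k a1 a2 a3 (z12 + z21) (z13 + z31) (z23 + z32) (g1 + g2 + g3) (h1 + h2 + h3))
    (hz : 0 < z12) :
    NE k (a1 + z12 + z13 + g1) h1 (a3 + z31 + z32 + g3 + k * h3 + (k - 1) * (a3 + z32)) := by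
  by_contra hE
  obtain ⟨rfl, rfl, hah, hz0, -, hD⟩ := hm.of_envy hk hE
  obtain ⟨rfl, rfl⟩ := hz0 hz
  simp only [zero_add] at hS
  rcases Nat.eq_zero_or_pos h1 with rfl | hh1
  · push_cast at hD
    rcases Nat.eq_zero_or_pos h2 with rfl | hh2
    · exact hm.pair_low hk (by simpa using hS) hz (by linarith)
    · exact hm.pair_high_two hk (by simpa using hS) hz hh2 (by linarith)
  · obtain rfl : a1 = 0 := by omega
    push_cast at hD
    exact hm.pair_high_one hk hS hz hh1 (by linarith)

/-- If `1` envies `3`, then `IsMin.single` says that `2` does too and has more private chores. The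
same argument with `1` and `2` exchanged gives the opposite strict inequality. -/
theorem IsMin.ne (hk : 1 < k)
    (hm : IsMin k a1 a2 a3 z12 z21 z13 z31 z23 z32 g1 g2 g3 h1 h2 h3)
    (hS : ¬ Solv k a1 a2 a3 (z12 + z21) (z13 + z31) (z23 + z32) (g1 + g2 + g3) (h1 + h2 + h3)) :
    NE k (a1 + z12 + z13 + g1) h1 (a3 + z31 + z32 + g3 + k * h3 + (k - 1) * (a3 + z32)) := by
  by_contra hE
  have hS' : ¬ Solv k a2 a1 a3 (z21 + z12) (z23 + z32) (z13 + z31) (g2 + g1 + g3) (h2 + h1 + h3) := by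
    intro h; apply hS; convert h.swap12 using 1 <;> ring
  have e : (a3 + z32 + z31 + g3 + k * h3 + (k - 1) * (a3 + z31) : ℝ) =
      a3 + z31 + z32 + g3 + k * h3 + (k - 1) * (a3 + z31) := by ring
  have e' : (a3 + z32 + z31 + g3 + k * h3 + (k - 1) * (a3 + z32) : ℝ) =
      a3 + z31 + z32 + g3 + k * h3 + (k - 1) * (a3 + z32) := by ring
  have hp := hm.swap12.ne_of_pair hk hS'
  rw [e] at hp
  obtain ⟨hlt, hE2⟩ := hm.single hk hS (by by_contra hz; exact hE (hm.ne_of_pair hk hS (by omega)))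
    hE hp
  have := (hm.swap12.single hk hS' (by by_contra hz; exact hE2 (hp (by omega)))
    (by rw [e]; exact hE2) (by rw [e']; exact fun h => hm.ne_of_pair hk hS h)).1
  omega

end Min

theorem solv {k : ℝ} (hk : 1 < k) (a1 a2 a3 b12 b13 b23 g H : ℕ) :
    Solv k a1 a2 a3 b12 b13 b23 g H := by
  by_contra hS
  obtain ⟨z12, z21, z13, z31, z23, z32, g1, g2, g3, h1, h2, h3, rfl, rfl, rfl, rfl, rfl, hm⟩ :=
    exists_isMin k a1 a2 a3 b12 b13 b23 g H
  have n13 := hm.ne hk hS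
  have n23 := hm.swap12.ne hk fun h => hS (by convert h.swap12 using 1 <;> ring)
  have n12 := hm.swap23.ne hk fun h => hS (by convert h.swap23 using 1 <;> ring)
  have n32 := hm.swap23.swap12.ne hk fun h => hS (by convert h.swap12.swap23 using 1 <;> ring)
  have n21 := hm.swap12.swap23.ne hk fun h => hS (by convert h.swap23.swap12 using 1 <;> ring)
  have n31 := hm.swap23.swap12.swap23.ne hk
    fun h => hS (by convert h.swap23.swap12.swap23 using 1 <;> ring)
  apply hS
  apply solv_flat (by linarith)
  · convert n12 using 1; ring
  · convert n13 using 1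
  · convert n21 using 1; all_goals ring
  · convert n23 using 1; ring
  · convert n31 using 1; all_goals ring
  · convert n32 using 1; ring

/-! ### Costs zero and one -/

/-- Solutions for instances with costs `0` and `1`. -/
theorem countSol_zero {a1 a2 a3 z12 z21 z13 z31 z23 z32 g1 g2 g3 h1 h2 h3 : ℕ}
    (e12 : (0 < a1 + z12 + z13 + g1 → h1 ≤ h2 + a2 + z23) ∧ h1 ≤ h2 + a2 + z23 + 1)
    (e13 : (0 < a1 + z12 + z13 + g1 → h1 ≤ h3 + a3 + z32) ∧ h1 ≤ h3 + a3 + z32 + 1)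
    (e21 : (0 < a2 + z21 + z23 + g2 → h2 ≤ h1 + a1 + z13) ∧ h2 ≤ h1 + a1 + z13 + 1)
    (e23 : (0 < a2 + z21 + z23 + g2 → h2 ≤ h3 + a3 + z31) ∧ h2 ≤ h3 + a3 + z31 + 1)
    (e31 : (0 < a3 + z31 + z32 + g3 → h3 ≤ h1 + a1 + z12) ∧ h3 ≤ h1 + a1 + z12 + 1)
    (e32 : (0 < a3 + z31 + z32 + g3 → h3 ≤ h2 + a2 + z21) ∧ h3 ≤ h2 + a2 + z21 + 1) :
    CountSol 0 1 (cnt a1 a2 a3 (z12 + z21) (z13 + z31) (z23 + z32) (g1 + g2 + g3)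
      (h1 + h2 + h3)) := by
  set X := mat ![g1, g2, g3] ![z12, z21, 0] ![z13, 0, z31] ![0, z23, z32] ![a1, 0, 0] ![0, a2, 0]
    ![0, 0, a3] ![h1, h2, h3] with hX
  have hcc : ∀ i h, ccost 0 1 X i h =
      ((if i = 0 then X (false, true, true) h + X (false, true, false) h + X (false, false, true) h
          + X (false, false, false) h else
        if i = 1 then X (true, false, true) h + X (true, false, false) h + X (false, false, true) h
          + X (false, false, false) h else
        X (true, true, false) h + X (true, false, false) h + X (false, true, false) h
          + X (false, false, false) h : ℕ) : ℝ) := by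
    intro i h
    rw [ccost, sum_typ]
    fin_cases i <;> simp [val, low] <;> ring
  refine ⟨fun _ => false, X, fun _ _ => rfl, ?_, ?_, ?_⟩
  · rw [forall_typ]; simp [hX, mat, cnt]
  · rw [forall_typ]; simp [hX, mat, lev, low, Fin.forall_fin_succ]
  · have key : ∀ i h L, 0 < X L i → (if low L i then ccost 0 1 X i i ≤ ccost 0 1 X i h else
        ccost 0 1 X i i ≤ ccost 0 1 X i h + 1) := by
      simp only [hcc]
      norm_cast
      intro i h
      fin_cases i <;> fin_cases h <;> rw [forall_typ] <;> simp [hX, mat, low] <;> omega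
    intro i h L hL
    have := key i h L hL
    unfold val
    split_ifs at this ⊢ <;> linarith

/-- Divide the chores high for all evenly. A single surplus chore goes to an agent without private
chores, who gives up her other low chores so that only costly ones can be removed; if all have
private chores, these offset the surplus in the eyes of its holder. Two surplus chores go to the
agents other than one with private chores. If there are no private chores, the chores low for two
agents decide who is spared. -/
theorem countSol_zero_one (a1 a2 a3 b12 b13 b23 g H : ℕ) :
    CountSol 0 1 (cnt a1 a2 a3 b12 b13 b23 g H) := by
  obtain ⟨q, r, hr, rfl⟩ : ∃ q r, r < 3 ∧ H = 3 * q + r :=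
    ⟨H / 3, H % 3, Nat.mod_lt _ (by norm_num), (Nat.div_add_mod H 3).symm⟩
  have one : ∀ {a1 a2 a3 b12 b13 b23 : ℕ}, a1 = 0 →
      CountSol 0 1 (cnt a1 a2 a3 b12 b13 b23 g (3 * q + 1)) := by
    rintro a1 a2 a3 b12 b13 b23 rfl
    have := countSol_zero (a1 := 0) (a2 := a2) (a3 := a3) (z12 := 0) (z21 := b12) (z13 := 0)
      (z31 := b13) (z23 := b23) (z32 := 0) (g1 := 0) (g2 := g) (g3 := 0) (h1 := q + 1) (h2 := q)
      (h3 := q) (by omega) (by omega) (by omega) (by omega) (by omega) (by omega)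
    convert this using 2 <;> omega
  have two : ∀ {a1 a2 a3 b12 b13 b23 : ℕ}, 0 < a1 →
      CountSol 0 1 (cnt a1 a2 a3 b12 b13 b23 g (3 * q + 2)) := by
    intro a1 a2 a3 b12 b13 b23 h
    have := countSol_zero (a1 := a1) (a2 := a2) (a3 := a3) (z12 := 0) (z21 := b12) (z13 := 0)
      (z31 := b13) (z23 := b23) (z32 := 0) (g1 := 0) (g2 := g) (g3 := 0) (h1 := q) (h2 := q + 1)
      (h3 := q + 1) (by omega) (by omega) (by omega) (by omega) (by omega) (by omega)
    convert this using 2 <;> omega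
  have two' : ∀ {a1 a2 a3 b12 b13 b23 : ℕ}, a2 = 0 → a3 = 0 → b23 = 0 ∨ 0 < b13 →
      CountSol 0 1 (cnt a1 a2 a3 b12 b13 b23 g (3 * q + 2)) := by
    intro a1 a2 a3 b12 b13 b23 h2 h3 h
    have := countSol_zero (a1 := a1) (a2 := a2) (a3 := a3) (z12 := b12) (z21 := 0) (z13 := b13)
      (z31 := 0) (z23 := b23) (z32 := 0) (g1 := g) (g2 := 0) (g3 := 0) (h1 := q) (h2 := q + 1)
      (h3 := q + 1) (by omega) (by omega) (by omega) (by omega) (by omega) (by omega)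
    convert this using 2 <;> omega
  interval_cases r
  · have := countSol_zero (a1 := a1) (a2 := a2) (a3 := a3) (z12 := 0) (z21 := b12) (z13 := 0)
      (z31 := b13) (z23 := b23) (z32 := 0) (g1 := 0) (g2 := g) (g3 := 0) (h1 := q) (h2 := q)
      (h3 := q) (by omega) (by omega) (by omega) (by omega) (by omega) (by omega)
    convert this using 2 <;> omega
  · by_cases h1 : a1 = 0
    · exact one h1
    by_cases h2 : a2 = 0
    · exact (one h2).swap12
    by_cases h3 : a3 = 0
    · exact (one h3).swap12.swap23
    have := countSol_zero (a1 := a1) (a2 := a2) (a3 := a3) (z12 := 0) (z21 := b12) (z13 := 0)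
      (z31 := b13) (z23 := b23) (z32 := 0) (g1 := 0) (g2 := g) (g3 := 0) (h1 := q + 1) (h2 := q)
      (h3 := q) (by omega) (by omega) (by omega) (by omega) (by omega) (by omega)
    convert this using 2 <;> omega
  · by_cases h1 : 0 < a1
    · exact two h1
    by_cases h2 : 0 < a2
    · exact (two h2).swap12
    by_cases h3 : 0 < a3
    · exact (two h3).swap12.swap23
    by_cases h : b13 = 0
    · exact (two' (by omega) (by omega) (Or.inl h)).swap12
    · exact two' (by omega) (by omega) (Or.inr (by omega))

/-- Every bivalued instance with three agents has a solution, given by thresholds. -/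
theorem exists_solution {m : ℕ} {I : ChoreInstance 3 m} (hI : I.Bivalued) :
    ∃ (lam : Fin 3 → Bool) (u v : Typ → ℕ), Adm I lam ∧ (∀ L, u L ≤ m ∧ v L ≤ m) ∧
      Compl I lam (thresh (ty I) u v) ∧ I.EFX (thresh (ty I) u v) := by
  obtain ⟨a, b, ha, hab, hd⟩ := exists_val hI
  refine CountSol.exists_thresh hab hd ?_ ha
  generalize hN : (fun L => #{j | ty I j = L}) = N
  have hcnt : N = cnt (N (true, false, false)) (N (false, true, false)) (N (false, false, true))
      (N (true, true, false)) (N (true, false, true)) (N (false, true, true))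
      (N (true, true, true)) (N (false, false, false)) := by
    funext ⟨x, y, z⟩
    cases x <;> cases y <;> cases z <;> rfl
  rw [hcnt]
  rcases ha.eq_or_lt with rfl | ha
  · have := (countSol_zero_one (N (true, false, false)) (N (false, true, false))
      (N (false, false, true)) (N (true, true, false)) (N (true, false, true))
      (N (false, true, true)) (N (true, true, true)) (N (false, false, false))).scale hab
    simpa using this
  · have hk : 1 < b / a := by rw [lt_div_iff₀ ha]; linarith
    have := (solv hk (N (true, false, false)) (N (false, true, false))
      (N (false, false, true)) (N (true, true, false)) (N (true, false, true))
      (N (false, true, true)) (N (true, true, true)) (N (false, false, false))).scale ha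
    rwa [mul_one, mul_div_cancel₀ b ha.ne'] at this

theorem exists_efx_fpo {m : ℕ} (I : ChoreInstance 3 m) (hI : I.Bivalued) :
    ∃ x : Allocation 3 m, I.EFX x ∧ I.FPO x := by
  obtain ⟨lam, u, v, h1, -, h2, h3⟩ := exists_solution hI
  exact ⟨_, h3, h2.fpo hI h1⟩

end Chores

namespace Chores

/-! ### Running time and size of numbers -/


open RAM

/-- The program `P` leads from state `σ` to state `σ'` in `t` steps. -/
def Runs (P : Program) (σ σ' : State) (t : ℕ) : Prop :=
  ∀ k, step^[t] (P :: k, σ) = (k, σ')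

theorem Runs.skip (σ : State) : Runs .skip σ σ 1 := fun _ => rfl

theorem Runs.op (o : Op) (σ : State) : Runs (.op o) σ (o.exec σ) 1 := fun _ => rfl

theorem Runs.seq {P Q : Program} {σ σ' σ'' : State} {s t : ℕ} (h : Runs P σ σ' s)
    (h' : Runs Q σ' σ'' t) : Runs (.seq P Q) σ σ'' (t + s + 1) := fun k => by
  rw [Function.iterate_succ_apply, step, Function.iterate_add_apply, h, h']

theorem Runs.ite_pos {b : Test} {P Q : Program} {σ σ' : State} {t : ℕ} (hb : b.Holds σ)
    (h : Runs P σ σ' t) : Runs (.ite b P Q) σ σ' (t + 1) := fun k => by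
  rw [Function.iterate_succ_apply, step, if_pos hb, h]

theorem Runs.ite_neg {b : Test} {P Q : Program} {σ σ' : State} {t : ℕ} (hb : ¬ b.Holds σ)
    (h : Runs Q σ σ' t) : Runs (.ite b P Q) σ σ' (t + 1) := fun k => by
  rw [Function.iterate_succ_apply, step, if_neg hb, h]

theorem Runs.while_neg {b : Test} {P : Program} {σ : State} (hb : ¬ b.Holds σ) :
    Runs (.while b P) σ σ 1 := fun k => by
  rw [Function.iterate_one, step, if_neg hb]

theorem Runs.while_pos {b : Test} {P : Program} {σ σ' σ'' : State} {s t : ℕ} (hb : b.Holds σ)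
    (h : Runs P σ σ' s) (h' : Runs (.while b P) σ' σ'' t) :
    Runs (.while b P) σ σ'' (t + s + 1) := fun k => by
  rw [Function.iterate_succ_apply, step, if_pos hb, Function.iterate_add_apply, h, h']

open Polynomial in
/-- A bound for the running time of a program whose loops are executed at most `X` times each. -/
noncomputable def time : Program → Polynomial ℕ
  | .skip => 1
  | .op _ => 1
  | .seq P Q => time P + time Q + 1
  | .ite _ P Q => time P + time Q + 1
  | .while _ P => X * (time P + 1) + 1

/-- Total correctness, with a time bound. -/
def Tr (N : ℕ) (A : State → Prop) (P : Program) (B : State → Prop) : Prop :=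
  ∀ σ, A σ → ∃ σ' t, t ≤ (time P).eval N ∧ Runs P σ σ' t ∧ B σ'

section Rules

variable {N : ℕ} {A A' B B' C : State → Prop} {P Q : Program} {b : Test}

theorem Tr.mono (h : Tr N A P B) (hA : ∀ σ, A' σ → A σ) (hB : ∀ σ, B σ → B' σ) : Tr N A' P B' :=
  fun σ hσ => by
    obtain ⟨σ', t, ht, hr, h⟩ := h σ (hA σ hσ)
    exact ⟨σ', t, ht, hr, hB _ h⟩

theorem Tr.skip (h : ∀ σ, A σ → B σ) : Tr N A .skip B :=
  fun σ hσ => ⟨σ, 1, by simp [time], .skip σ, h σ hσ⟩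

theorem Tr.op {o : Op} (h : ∀ σ, A σ → B (o.exec σ)) : Tr N A (.op o) B :=
  fun σ hσ => ⟨_, 1, by simp [time], .op o σ, h σ hσ⟩

theorem Tr.seq (h : Tr N A P B) (h' : Tr N B Q C) : Tr N A (.seq P Q) C := fun σ hσ => by
  obtain ⟨σ', t, ht, hr, h⟩ := h σ hσ
  obtain ⟨σ'', t', ht', hr', h'⟩ := h' σ' h
  refine ⟨σ'', _, ?_, hr.seq hr', h'⟩
  simp only [time, Polynomial.eval_add, Polynomial.eval_one]; omega

theorem Tr.ite (h : Tr N (fun σ => A σ ∧ b.Holds σ) P B)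
    (h' : Tr N (fun σ => A σ ∧ ¬ b.Holds σ) Q B) :
    Tr N A (.ite b P Q) B := fun σ hσ => by
  by_cases hb : b.Holds σ
  · obtain ⟨σ', t, ht, hr, h⟩ := h σ ⟨hσ, hb⟩
    refine ⟨σ', _, ?_, hr.ite_pos hb, h⟩
    simp only [time, Polynomial.eval_add, Polynomial.eval_one]; omega
  · obtain ⟨σ', t, ht, hr, h⟩ := h' σ ⟨hσ, hb⟩
    refine ⟨σ', _, ?_, hr.ite_neg hb, h⟩
    simp only [time, Polynomial.eval_add, Polynomial.eval_one]; omega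

/-- The invariant is indexed by the rounds completed, of which there are exactly `M`. -/
theorem Tr.while {I : ℕ → State → Prop} {M : ℕ} (hM : M ≤ N)
    (hP : ∀ j < M, Tr N (I j) P (I (j + 1))) (hb : ∀ j < M, ∀ σ, I j σ → b.Holds σ)
    (hb' : ∀ σ, I M σ → ¬ b.Holds σ) : Tr N (I 0) (.while b P) (I M) := by
  have key : ∀ j ≤ M, ∀ σ, I (M - j) σ → ∃ σ' t, t ≤ j * ((time P).eval N + 1) + 1 ∧
      Runs (.while b P) σ σ' t ∧ I M σ' := by
    intro j
    induction j with
    | zero => intro _ σ hσ; exact ⟨σ, 1, by simp, .while_neg (hb' σ hσ), hσ⟩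
    | succ j ih =>
      intro hj σ hσ
      obtain ⟨σ', t, ht, hr, h⟩ := hP (M - (j + 1)) (by omega) σ hσ
      rw [show M - (j + 1) + 1 = M - j by omega] at h
      obtain ⟨σ'', t', ht', hr', h'⟩ := ih (by omega) σ' h
      refine ⟨σ'', _, ?_, .while_pos (hb _ (by omega) σ hσ) hr hr', h'⟩
      rw [add_mul]; omega
  intro σ hσ
  obtain ⟨σ', t, ht, hr, h⟩ := key M le_rfl σ (by rwa [Nat.sub_self])
  refine ⟨σ', t, ht.trans ?_, hr, h⟩
  simp only [time, Polynomial.eval_add, Polynomial.eval_one, Polynomial.eval_mul, Polynomial.eval_X]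
  exact Nat.add_le_add_right (Nat.mul_le_mul_right _ hM) 1

end Rules

/-- A sequence of operations. -/
def block : List Op → Program
  | [] => .skip
  | o :: l => .seq (.op o) (block l)

theorem Tr.block {N : ℕ} {A B : State → Prop} {l : List Op}
    (h : ∀ σ, A σ → B (l.foldl (fun σ o => o.exec σ) σ)) : Tr N A (block l) B := by
  induction l generalizing A with
  | nil => exact .skip h
  | cons o l ih =>
    refine Tr.seq (B := fun σ => ∃ σ', A σ' ∧ σ = o.exec σ') (.op fun σ hσ => ⟨σ, hσ, rfl⟩) (ih ?_)
    rintro _ ⟨σ, hσ, rfl⟩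
    exact h σ hσ

/-! ### Growth of the numbers -/

/-- Operations that increase the encoding length of numbers by a constant only. -/
def TameOp : Op → Prop
  | .natConst _ c => c ≤ 3
  | .natAdd _ _ _ => True
  | .natSub _ _ _ => True
  | .natLoad _ _ => True
  | .natStore _ _ => True
  | .realConst _ _ => False
  | .realAdd _ _ _ => True
  | .realSub _ _ _ => True
  | .realMul _ _ _ => False
  | .realDiv _ _ _ => False
  | .realLoad _ _ => True
  | .realStore _ _ => True

/-- Programs that use only tame operations. -/
def Tame : Program → Prop
  | .skip => True
  | .op o => TameOp o
  | .seq P Q => Tame P ∧ Tame Q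
  | .ite _ P Q => Tame P ∧ Tame Q
  | .while _ P => Tame P

/-- All naturals are bounded by `M`, and all reals are multiples of `1 / Q` with numerator
bounded by `W`. -/
structure Small (M Q W : ℕ) (σ : State) : Prop where
  natReg : ∀ r, σ.natReg r ≤ M
  natMem : ∀ r, σ.natMem r ≤ M
  realReg : ∀ r, ∃ z : ℤ, σ.realReg r = z / Q ∧ z.natAbs ≤ W
  realMem : ∀ r, ∃ z : ℤ, σ.realMem r = z / Q ∧ z.natAbs ≤ W

theorem forall_update {α : Type*} {p : α → Prop} {f : ℕ → α} {r : ℕ} {x : α} (hf : ∀ r, p (f r))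
    (hx : p x) : ∀ s, p (Function.update f r x s) := by
  intro s
  rw [Function.update_apply]
  split_ifs
  exacts [hx, hf s]

theorem Small.mono {M Q W M' W' : ℕ} {σ : State} (h : Small M Q W σ) (hM : M ≤ M') (hW : W ≤ W') :
    Small M' Q W' σ :=
  ⟨fun r => (h.natReg r).trans hM, fun r => (h.natMem r).trans hM,
    fun r => (h.realReg r).imp fun _ hz => ⟨hz.1, hz.2.trans hW⟩,
    fun r => (h.realMem r).imp fun _ hz => ⟨hz.1, hz.2.trans hW⟩⟩

/-- Without products and quotients the common denominator `Q` never changes, and sums or differences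
at most double the bounds. Constants are at most `3`, whence `3 ≤ M`. -/
theorem Small.exec {M Q W : ℕ} {σ : State} {o : Op} (hM : 3 ≤ M) (ho : TameOp o)
    (h : Small M Q W σ) : Small (2 * M) Q (2 * W) (o.exec σ) := by
  have h2 := h.mono (show M ≤ 2 * M by omega) (show W ≤ 2 * W by omega)
  obtain ⟨h1', h2', h3', h4'⟩ := h2
  let p : ℝ → Prop := fun x => ∃ z : ℤ, x = z / Q ∧ z.natAbs ≤ 2 * W
  cases o with
  | natConst r c =>
    have : c ≤ 3 := ho
    exact ⟨forall_update (p := (· ≤ 2 * M)) h1' (by omega), h2', h3', h4'⟩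
  | natAdd r s t =>
    have := h.natReg s; have := h.natReg t
    exact ⟨forall_update (p := (· ≤ 2 * M)) h1' (by omega), h2', h3', h4'⟩
  | natSub r s t =>
    have := h.natReg s
    exact ⟨forall_update (p := (· ≤ 2 * M)) h1' (by omega), h2', h3', h4'⟩
  | natLoad r a => exact ⟨forall_update (p := (· ≤ 2 * M)) h1' (h2' _), h2', h3', h4'⟩
  | natStore a s => exact ⟨h1', forall_update (p := (· ≤ 2 * M)) h2' (h1' _), h3', h4'⟩
  | realConst r c => exact ho.elim
  | realAdd r s t =>
    obtain ⟨x, hx, hx'⟩ := h.realReg s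
    obtain ⟨y, hy, hy'⟩ := h.realReg t
    refine ⟨h1', h2', forall_update (p := p) h3' ⟨x + y, ?_, ?_⟩, h4'⟩
    · rw [hx, hy]; push_cast; ring
    · omega
  | realSub r s t =>
    obtain ⟨x, hx, hx'⟩ := h.realReg s
    obtain ⟨y, hy, hy'⟩ := h.realReg t
    refine ⟨h1', h2', forall_update (p := p) h3' ⟨x - y, ?_, ?_⟩, h4'⟩
    · rw [hx, hy]; push_cast; ring
    · omega
  | realMul r s t => exact ho.elim
  | realDiv r s t => exact ho.elim
  | realLoad r a => exact ⟨h1', h2', forall_update (p := p) h3' (h4' _), h4'⟩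
  | realStore a s => exact ⟨h1', h2', h3', forall_update (p := p) h4' (h3' _)⟩

theorem Small.step {M Q W : ℕ} {c : Config} (hM : 3 ≤ M) (ht : ∀ P ∈ c.1, Tame P)
    (h : Small M Q W c.2) : (∀ P ∈ (RAM.step c).1, Tame P) ∧
      Small (2 * M) Q (2 * W) (RAM.step c).2 := by
  have h2 := h.mono (show M ≤ 2 * M by omega) (show W ≤ 2 * W by omega)
  obtain ⟨l, σ⟩ := c
  match l with
  | [] => exact ⟨ht, h2⟩
  | .skip :: k => exact ⟨fun P hP => ht P (.tail _ hP), h2⟩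
  | .op o :: k => exact ⟨fun P hP => ht P (.tail _ hP), h.exec hM (ht _ (.head _))⟩
  | .seq P Q :: k =>
    have hPQ : Tame P ∧ Tame Q := ht _ (.head _)
    refine ⟨fun R hR => ?_, h2⟩
    simp only [RAM.step, List.mem_cons] at hR
    rcases hR with rfl | rfl | hR
    exacts [hPQ.1, hPQ.2, ht R (.tail _ hR)]
  | .ite b P Q :: k =>
    have hPQ : Tame P ∧ Tame Q := ht (.ite b P Q) (.head _)
    by_cases hb : b.Holds σ
    · simp only [RAM.step, if_pos hb]
      refine ⟨fun R hR => ?_, h2⟩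
      rcases List.mem_cons.1 hR with rfl | hR
      exacts [hPQ.1, ht R (.tail _ hR)]
    · simp only [RAM.step, if_neg hb]
      refine ⟨fun R hR => ?_, h2⟩
      rcases List.mem_cons.1 hR with rfl | hR
      exacts [hPQ.2, ht R (.tail _ hR)]
  | .while b P :: k =>
    by_cases hb : b.Holds σ
    · simp only [RAM.step, if_pos hb]
      refine ⟨fun R hR => ?_, h2⟩
      rcases List.mem_cons.1 hR with rfl | hR
      exacts [ht (.while b R) (.head _), ht R hR]
    · simp only [RAM.step, if_neg hb]
      exact ⟨fun R hR => ht R (.tail _ hR), h2⟩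

theorem Small.runFor {M Q W : ℕ} {P : Program} {σ : State} (hM : 3 ≤ M) (hP : Tame P)
    (h : Small M Q W σ) (t : ℕ) : Small (2 ^ t * M) Q (2 ^ t * W) (runFor P σ t).2 := by
  have key : (∀ R ∈ (RAM.runFor P σ t).1, Tame R) ∧
      Small (2 ^ t * M) Q (2 ^ t * W) (RAM.runFor P σ t).2 := by
    induction t with
    | zero =>
      refine ⟨fun R hR => ?_, by simpa [RAM.runFor] using h⟩
      simp only [RAM.runFor, Function.iterate_zero, id, List.mem_singleton] at hR
      rwa [hR]
    | succ t ih =>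
      have := Small.step (c := RAM.runFor P σ t)
        (hM.trans (Nat.le_mul_of_pos_left M (by positivity))) ih.1 ih.2
      rw [RAM.runFor, Function.iterate_succ_apply']
      rw [pow_succ, mul_comm (2 ^ t) 2, mul_assoc, mul_assoc]
      exact this
  exact key.2

theorem runFor_of_halted {P : Program} {σ : State} {t T : ℕ} (hT : (runFor P σ T).1 = [])
    (h : T ≤ t) : runFor P σ t = runFor P σ T := by
  obtain ⟨s, rfl⟩ := Nat.exists_eq_add_of_le' h
  rw [runFor, Function.iterate_add_apply]
  change step^[s] (runFor P σ T) = _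
  induction s with
  | zero => rfl
  | succ s ih =>
    rw [Function.iterate_succ_apply', ih (by omega)]
    rcases hc : runFor P σ T with ⟨l, τ⟩
    rw [hc] at hT
    obtain rfl : l = [] := hT
    rfl

theorem size_mul_le (a b : ℕ) : Nat.size (a * b) ≤ Nat.size a + Nat.size b := by
  rw [Nat.size_le, pow_add]
  rcases Nat.eq_zero_or_pos b with rfl | hb
  · simp
  · exact Nat.mul_lt_mul'' (Nat.lt_size_self a) (Nat.lt_size_self b)

theorem Small.fitsIn {M Q W : ℕ} {σ : State} (hQ : 0 < Q) (h : Small M Q W σ) :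
    σ.FitsIn (Nat.size M + Nat.size W + Nat.size Q) := by
  have hr : ∀ r : ℝ, (∃ z : ℤ, r = z / Q ∧ z.natAbs ≤ W) → ∃ q : ℚ, r = (q : ℝ) ∧
      ratSize q ≤ Nat.size M + Nat.size W + Nat.size Q := by
    rintro r ⟨z, rfl, hz⟩
    have hQ0 : (Q : ℤ) ≠ 0 := by exact_mod_cast hQ.ne'
    refine ⟨Rat.divInt z Q, by rw [Rat.divInt_eq_div]; push_cast; rfl, ?_⟩
    have h1 : Nat.size (Rat.divInt z Q).num.natAbs ≤ Nat.size W := by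
      apply Nat.size_le_size
      rcases eq_or_ne z 0 with rfl | hz0
      · simp
      · exact (Nat.le_of_dvd (Int.natAbs_pos.2 hz0)
          (Int.natAbs_dvd_natAbs.2 (Rat.num_dvd z hQ0))).trans hz
    have h2 : Nat.size (Rat.divInt z Q).den ≤ Nat.size Q := by
      apply Nat.size_le_size
      exact Nat.le_of_dvd hQ (Int.natCast_dvd_natCast.1 (Rat.den_dvd z Q))
    unfold ratSize
    omega
  refine ⟨fun r => ?_, fun r => ?_, fun r => hr _ (h.realReg r), fun r => hr _ (h.realMem r)⟩
  · have := Nat.size_le_size (h.natReg r); omega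
  · have := Nat.size_le_size (h.natMem r); omega

theorem _root_.RAM.State.FitsIn.mono {σ : State} {B B' : ℕ} (h : σ.FitsIn B)
    (hB : B ≤ B') : σ.FitsIn B' :=
  ⟨fun r => (h.natReg r).trans hB, fun r => (h.natMem r).trans hB,
    fun r => (h.realReg r).imp fun _ hq => ⟨hq.1, hq.2.trans hB⟩,
    fun r => (h.realMem r).imp fun _ hq => ⟨hq.1, hq.2.trans hB⟩⟩

theorem size_prod_le {ι : Type*} (s : Finset ι) (f : ι → ℕ) :
    Nat.size (∏ i ∈ s, f i) ≤ 1 + ∑ i ∈ s, Nat.size (f i) := by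
  classical
  induction s using Finset.induction_on with
  | empty => simp
  | insert i s hi ih =>
    rw [Finset.prod_insert hi, Finset.sum_insert hi]
    have := size_mul_le (f i) (∏ i ∈ s, f i)
    omega

theorem size_prod_den_le {n m : ℕ} (D : Fin n → Fin m → ℚ) :
    Nat.size (∏ i, ∏ j, (D i j).den) ≤ inputSize D + 1 := by
  rw [← Finset.prod_product']
  refine (size_prod_le _ _).trans ?_
  rw [Finset.sum_product, inputSize]
  have : ∑ i, ∑ j, Nat.size (D i j).den ≤ ∑ i, ∑ j, ratSize (D i j) :=
    Finset.sum_le_sum fun i _ => Finset.sum_le_sum fun j _ => by unfold ratSize; omega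
  simp only
  omega

/-- The product of all denominators has barely more digits than the whole instance, so it can serve
as the common denominator. -/
theorem small_initState {n m : ℕ} (I : ChoreInstance n m) (D : Fin n → Fin m → ℚ)
    (hD : ∀ i j, I.d i j = (D i j : ℝ)) :
    Small (n + m + 3) (∏ i, ∏ j, (D i j).den) (2 ^ (2 * inputSize D + 1)) (initState I) := by
  set Q := ∏ i, ∏ j, (D i j).den with hQ
  have hQ0 : 0 < Q := Finset.prod_pos fun i _ => Finset.prod_pos fun j _ => (D i j).den_pos
  have hQs : Nat.size Q ≤ inputSize D + 1 := size_prod_den_le D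
  have hz : ∃ z : ℤ, (0 : ℝ) = z / Q ∧ z.natAbs ≤ 2 ^ (2 * inputSize D + 1) := ⟨0, by simp, by simp⟩
  refine ⟨fun r => ?_, fun r => by simp [initState], fun r => hz, fun r => ?_⟩
  · simp only [initState]; split_ifs <;> omega
  · simp only [initState]
    split_ifs with h
    swap
    · exact hz
    generalize (⟨r % n, Nat.mod_lt r h.1⟩ : Fin n) = i
    generalize (⟨r / n, h.2⟩ : Fin m) = j
    obtain ⟨c, hc⟩ : (D i j).den ∣ Q :=
      (Finset.dvd_prod_of_mem (fun j => (D i j).den) (Finset.mem_univ j)).trans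
        (Finset.dvd_prod_of_mem (fun i => ∏ j, (D i j).den) (Finset.mem_univ i))
    have hc0 : c ≠ 0 := by rintro rfl; omega
    refine ⟨(D i j).num * c, ?_, ?_⟩
    · have hden : ((D i j).den : ℝ) ≠ 0 := by exact_mod_cast (D i j).den_ne_zero
      have hcR : (c : ℝ) ≠ 0 := by exact_mod_cast hc0
      rw [hD, hc, Rat.cast_def]
      push_cast
      field_simp
    · rw [Int.natAbs_mul, Int.natAbs_natCast]
      have h1 : Nat.size (D i j).num.natAbs ≤ inputSize D := by
        have h2 : ratSize (D i j) ≤ ∑ j, ratSize (D i j) :=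
          Finset.single_le_sum (f := fun j => ratSize (D i j)) (fun _ _ => Nat.zero_le _)
            (Finset.mem_univ j)
        have h3 : ∑ j, ratSize (D i j) ≤ ∑ i, ∑ j, ratSize (D i j) :=
          Finset.single_le_sum (f := fun i => ∑ j, ratSize (D i j)) (fun _ _ => Nat.zero_le _)
            (Finset.mem_univ i)
        unfold inputSize
        have : Nat.size (D i j).num.natAbs ≤ ratSize (D i j) := by unfold ratSize; omega
        omega
      have h2 : c ≤ Q := by
        rw [hc]; exact Nat.le_mul_of_pos_left c (D i j).den_pos
      have h3 := size_mul_le (D i j).num.natAbs c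
      have h4 := Nat.size_le_size h2
      exact (Nat.size_le.1 (by omega : Nat.size ((D i j).num.natAbs * c) ≤ 2 * inputSize D + 1)).le

/-- A tame program that halts in polynomial time only computes numbers of polynomial encoding
length. -/
theorem fitsIn_of_tame {n m : ℕ} {P : Program} (hP : Tame P) (I : ChoreInstance n m)
    (D : Fin n → Fin m → ℚ) (hD : ∀ i j, I.d i j = (D i j : ℝ)) {T : ℕ}
    (hT : (runFor P (initState I) T).1 = []) (t : ℕ) :
    (runFor P (initState I) t).2.FitsIn (2 * T + 4 * inputSize D + 10) := by
  have key : ∀ t ≤ T, (runFor P (initState I) t).2.FitsIn (2 * T + 4 * inputSize D + 10) := by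
    intro t ht
    have h := (small_initState I D hD).runFor (by omega) hP t
    have hQ0 : 0 < ∏ i, ∏ j, (D i j).den :=
      Finset.prod_pos fun i _ => Finset.prod_pos fun j _ => (D i j).den_pos
    have h := h.fitsIn hQ0
    have h1 := size_mul_le (2 ^ t) (n + m + 3)
    have h2 := size_prod_den_le D
    have h3 : Nat.size (n + m + 3) ≤ n + m + 3 := Nat.size_le.2 Nat.lt_two_pow_self
    have h4 : n + m ≤ inputSize D := by unfold inputSize; omega
    rw [Nat.size_pow] at h1
    rw [← pow_add, Nat.size_pow] at h
    exact h.mono (by omega)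
  rcases le_total t T with h | h
  · exact key t h
  · rw [runFor_of_halted hT h]; exact key T le_rfl

end Chores

namespace Chores

/-! ### Loops -/


open RAM Finset

section Rules

variable {N : ℕ} {A A' B B' C : State → Prop} {P Q : Program}

theorem Tr.exists {α : Type*} {A : α → State → Prop} (h : ∀ x, Tr N (A x) P B) :
    Tr N (fun σ => ∃ x, A x σ) P B := fun σ ⟨x, hx⟩ => h x σ hx

theorem Tr.pure {p : Prop} (h : p → Tr N A P B) : Tr N (fun σ => p ∧ A σ) P B :=
  fun σ hσ => h hσ.1 σ hσ.2

/-- Branching on the outcome of a test. -/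
def branch (b : Test) (F : Bool → Program) : Program := .ite b (F true) (F false)

/-- When the outcome of a test is determined by the instance, only the corresponding branch needs
verification. -/
theorem Tr.branch {b : Test} {F : Bool → Program} (c : Bool)
    (hb : ∀ σ, A σ → (b.Holds σ ↔ c = true)) (h : Tr N A (F c) B) : Tr N A (branch b F) B := by
  cases c with
  | true =>
    exact .ite (h.mono (fun _ h => h.1) (fun _ h => h))
      (fun σ hσ => (hσ.2 ((hb σ hσ.1).2 rfl)).elim)
  | false =>
    exact .ite (fun σ hσ => nomatch (hb σ hσ.1).1 hσ.2)
      (h.mono (fun _ h => h.1) (fun _ h => h))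

theorem tame_branch {b : Test} {F : Bool → Program} (h : ∀ c, Tame (F c)) : Tame (branch b F) :=
  ⟨h true, h false⟩

theorem tame_block {l : List Op} (h : ∀ o ∈ l, TameOp o) : Tame (block l) := by
  induction l with
  | nil => trivial
  | cons o l ih => exact ⟨h o (.head _), ih fun o ho => h o (.tail _ ho)⟩

end Rules

/-- The states that differ from `σ` only in the registers used for a loop over all chores. -/
structure SameOutside (σ σ' : State) : Prop where
  natReg : ∀ r, r < 7 ∨ 11 < r → σ'.natReg r = σ.natReg r
  natMem : σ'.natMem = σ.natMem
  realReg : ∀ r, r < 2 ∨ 4 < r → σ'.realReg r = σ.realReg r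
  realMem : σ'.realMem = σ.realMem

/-- The instance and the constants that are kept during the whole computation. -/
structure Base {m : ℕ} (I : ChoreInstance 3 m) (σ : State) : Prop where
  three : σ.natReg 0 = 3
  size : σ.natReg 1 = m
  one : σ.natReg 2 = 1
  zero : σ.natReg 3 = 0
  size_succ : σ.natReg 4 = m + 1
  two : σ.natReg 13 = 2
  real_zero : σ.realReg 1 = 0
  mem : ∀ (i : Fin 3) (j : Fin m), σ.realMem (3 * (j : ℕ) + (i : ℕ)) = I.d i j

/-- Chore `j` has been loaded. -/
structure Loaded {m : ℕ} (I : ChoreInstance 3 m) (j : Fin m) (σ : State) : Prop where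
  cur : σ.natReg 7 = j
  cur_succ : σ.natReg 8 = j + 1
  addr : ∀ h : Fin 3, σ.natReg (9 + h) = 3 * j + h
  cost : ∀ h : Fin 3, σ.realReg (2 + h) = I.d h j

theorem Base.congr {m : ℕ} {I : ChoreInstance 3 m} {σ σ' : State} (h : Base I σ)
    (h1 : ∀ r, r < 5 ∨ r = 13 → σ'.natReg r = σ.natReg r) (h2 : σ'.realReg 1 = σ.realReg 1)
    (h3 : σ'.realMem = σ.realMem) : Base I σ' := by
  obtain ⟨a, b, c, d, e, f, g, k⟩ := h
  exact ⟨(h1 _ (by omega)).trans a, (h1 _ (by omega)).trans b, (h1 _ (by omega)).trans c,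
    (h1 _ (by omega)).trans d, (h1 _ (by omega)).trans e, (h1 _ (by omega)).trans f, h2.trans g,
    by rwa [h3]⟩

theorem Loaded.congr {m : ℕ} {I : ChoreInstance 3 m} {j : Fin m} {σ σ' : State}
    (h : Loaded I j σ) (h1 : ∀ r, 7 ≤ r → r ≤ 11 → σ'.natReg r = σ.natReg r)
    (h2 : ∀ r, 2 ≤ r → r ≤ 4 → σ'.realReg r = σ.realReg r) : Loaded I j σ' := by
  obtain ⟨a, b, c, d⟩ := h
  exact ⟨(h1 _ (by omega) (by omega)).trans a, (h1 _ (by omega) (by omega)).trans b,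
    fun h => (h1 _ (by omega) (by omega)).trans (c h),
    fun h => (h2 _ (by omega) (by omega)).trans (d h)⟩

/-- Execute `leaf` for each chore. -/
def forChores (leaf : Program) : Program :=
  .seq (block [.natConst 7 0, .natConst 8 1, .natConst 9 0, .natConst 10 1, .natConst 11 2])
    (.while (.natLE 8 1) (.seq (block [.realLoad 2 9, .realLoad 3 10, .realLoad 4 11])
      (.seq leaf (block [.natAdd 7 7 2, .natAdd 8 8 2, .natAdd 9 9 0, .natAdd 10 10 0,
        .natAdd 11 11 0]))))

theorem tame_forChores {leaf : Program} (h : Tame leaf) : Tame (forChores leaf) :=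
  ⟨tame_block (by simp [TameOp]), tame_block (by simp [TameOp]), h, tame_block (by simp [TameOp])⟩

/-- The loop overwrites its own counters, addresses and loaded costs, so the invariant `Q` must not
depend on them; this is `hs`. -/
theorem Tr.forChores {N m : ℕ} {I : ChoreInstance 3 m} {leaf : Program} {Q : ℕ → State → Prop}
    (hN : m ≤ N) (hQ : ∀ j σ, Q j σ → Base I σ)
    (hs : ∀ j σ σ', Q j σ → SameOutside σ σ' → Q j σ')
    (hl : ∀ j : Fin m, Tr N (fun σ => Loaded I j σ ∧ Q j σ) leaf
      (fun σ => Loaded I j σ ∧ Q (j + 1) σ)) :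
    Tr N (Q 0) (forChores leaf) (Q m) := by
  refine Tr.seq (B := fun σ => (σ.natReg 7 = 0 ∧ σ.natReg 8 = 0 + 1 ∧ σ.natReg 9 = 3 * 0 ∧
    σ.natReg 10 = 3 * 0 + 1 ∧ σ.natReg 11 = 3 * 0 + 2) ∧ Q 0 σ) (.block fun σ hσ => ?_)
    (Tr.mono (Tr.while (I := fun j σ => (σ.natReg 7 = j ∧ σ.natReg 8 = j + 1 ∧
      σ.natReg 9 = 3 * j ∧ σ.natReg 10 = 3 * j + 1 ∧ σ.natReg 11 = 3 * j + 2) ∧ Q j σ) hN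
      (fun j hj => ?_) ?_ ?_) (fun _ h => h) fun σ h => h.2)
  · refine ⟨by simp [Op.exec], hs 0 σ _ hσ ⟨fun r hr => ?_, rfl,
      fun r hr => rfl, rfl⟩⟩
    simp only [List.foldl_cons, List.foldl_nil, Op.exec]
    iterate 5 rw [Function.update_of_ne (by omega)]
  · refine Tr.seq (.block fun σ hσ => ?_) (.seq (hl ⟨j, hj⟩) (.block fun σ hσ => ?_))
    · obtain ⟨⟨h7, h8, h9, h10, h11⟩, hσ⟩ := hσ
      have hm := (hQ j σ hσ).mem
      have hm0 := hm 0 ⟨j, hj⟩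
      have hm1 := hm 1 ⟨j, hj⟩
      have hm2 := hm 2 ⟨j, hj⟩
      refine ⟨⟨h7, h8, fun h => ?_, fun h => ?_⟩, hs j σ _ hσ ⟨fun r hr => rfl, rfl,
        fun r hr => ?_, rfl⟩⟩
      · fin_cases h
        exacts [h9, h10, h11]
      · fin_cases h
        · simpa [Op.exec, Function.update_apply, h9] using hm0
        · simpa [Op.exec, Function.update_apply, h10] using hm1
        · simpa [Op.exec, Function.update_apply, h11] using hm2
      · simp only [List.foldl_cons, List.foldl_nil, Op.exec]
        iterate 3 rw [Function.update_of_ne (by omega)]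
    · obtain ⟨⟨h7, h8, h9, -⟩, hσ⟩ := hσ
      have hB := hQ _ σ hσ
      have a0 := h9 0
      have a1 := h9 1
      have a2 := h9 2
      simp only [Fin.val_zero, Fin.val_one, Fin.val_two, Nat.reduceAdd] at a0 a1 a2
      refine ⟨⟨?_, ?_, ?_, ?_, ?_⟩, hs _ σ _ hσ ⟨fun r hr => ?_, rfl, fun r hr => rfl, rfl⟩⟩
      · simp [Op.exec, h7, hB.one]
      · simp [Op.exec, h8, hB.one]
      · simp [Op.exec, a0, hB.three]; omega
      · simp [Op.exec, a1, hB.three]; omega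
      · simp [Op.exec, a2, hB.three]; omega
      · simp only [List.foldl_cons, List.foldl_nil, Op.exec]
        iterate 5 rw [Function.update_of_ne (by omega)]
  · rintro j hj σ ⟨⟨-, h8, -⟩, hσ⟩
    simp only [Test.Holds, h8, (hQ _ σ hσ).size]
    omega
  · rintro σ ⟨⟨-, h8, -⟩, hσ⟩
    simp only [Test.Holds, h8, (hQ _ σ hσ).size]
    omega

/-! ### Exhaustive search over registers -/

/-- Execute `B` for all values between zero and the number of chores plus one of the registers in
the list. -/
def loops : List ℕ → Program → Program
  | [], B => B
  | r :: rs, B => .seq (.op (.natConst r 0))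
      (.while (.natLE r 4) (.seq (loops rs B) (.op (.natAdd r r 2))))

theorem tame_loops {B : Program} (h : Tame B) : ∀ rs, Tame (loops rs B)
  | [] => h
  | _ :: rs => ⟨Nat.zero_le 3, tame_loops h rs, trivial⟩

/-- In `S f p`, `f` records the registers searched through and `p` what is known to imply success.
Each run of the body adds `G f` to `p` as an alternative, so in the end `p` covers every tuple of
values; the final register contents are irrelevant. -/
theorem Tr.loops {N m : ℕ} {I : ChoreInstance 3 m} {B : Program} (hN : m + 2 ≤ N)
    {S : (ℕ → ℕ) → Prop → State → Prop} {G : (ℕ → ℕ) → Prop}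
    (hbase : ∀ f p σ, S f p σ → Base I σ) (hreg : ∀ f p σ, S f p σ → ∀ r, 20 ≤ r → σ.natReg r = f r)
    (himp : ∀ f (p q : Prop) σ, (q → p) → S f p σ → S f q σ)
    (hupd : ∀ f p σ r c, 20 ≤ r → S f p σ → S (Function.update f r c) p
      { σ with natReg := Function.update σ.natReg r c })
    (hB : ∀ f p, Tr N (S f p) B (S f (p ∨ G f))) (rs : List ℕ) (hrs : ∀ r ∈ rs, 20 ≤ r)
    (hnd : rs.Nodup) (f : ℕ → ℕ) (p : Prop) :
    Tr N (S f p) (loops rs B) (fun σ => ∃ f', (∀ s, s ∉ rs → f' s = f s) ∧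
      S f' (p ∨ ∃ g, (∀ s, s ∉ rs → g s = f s) ∧ (∀ s ∈ rs, g s ≤ m + 1) ∧ G g) σ) := by
  induction rs generalizing f p with
  | nil =>
    refine (hB f p).mono (fun _ h => h) fun σ h => ⟨f, fun _ _ => rfl, himp _ _ _ _ ?_ h⟩
    rintro (h | ⟨g, hg, -, hG⟩)
    · exact .inl h
    · obtain rfl : g = f := funext fun s => hg s (by simp)
      exact .inr hG
  | cons r rs ih =>
    have hr : 20 ≤ r := hrs r (.head _)
    obtain ⟨hrn, hnd⟩ := List.nodup_cons.1 hnd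
    refine Tr.seq (B := fun σ => ∃ f', (∀ s, s ∉ r :: rs → f' s = f s) ∧ f' r = 0 ∧
      S f' (p ∨ ∃ g, (∀ s, s ∉ r :: rs → g s = f s) ∧ g r < 0 ∧ (∀ s ∈ rs, g s ≤ m + 1) ∧ G g) σ)
      (.op fun σ hσ => ⟨Function.update f r 0, fun s hs => ?_, by simp,
        himp _ p _ _ ?_ (hupd f p σ r 0 hr hσ)⟩) (Tr.mono (Tr.while (M := m + 2)
      (I := fun k σ => ∃ f', (∀ s, s ∉ r :: rs → f' s = f s) ∧ f' r = k ∧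
      S f' (p ∨ ∃ g, (∀ s, s ∉ r :: rs → g s = f s) ∧ g r < k ∧ (∀ s ∈ rs, g s ≤ m + 1) ∧ G g) σ)
      hN (fun k hk => ?_) ?_ ?_) (fun _ h => h) ?_)
    · rw [Function.update_of_ne (fun h => hs (by simp [h]))]
    · rintro (h | ⟨g, -, h, -⟩)
      · exact h
      · omega
    · refine Tr.exists fun f' => .pure fun h1 => .pure fun h2 => .seq
        (ih (fun s hs => hrs s (.tail _ hs)) hnd f' _) (.op ?_)
      rintro σ ⟨f2, h3, h4⟩
      have hrk : σ.natReg r = k := by rw [hreg _ _ _ h4 r hr, h3 r hrn, h2]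
      have e : (Op.natAdd r r 2).exec σ =
          { σ with natReg := Function.update σ.natReg r (k + 1) } := by
        simp [Op.exec, hrk, (hbase _ _ _ h4).one]
      rw [e]
      refine ⟨Function.update f2 r (k + 1), fun s hs => ?_, by simp,
        himp _ _ _ _ ?_ (hupd _ _ σ r (k + 1) hr h4)⟩
      · rw [List.mem_cons, not_or] at hs
        rw [Function.update_of_ne hs.1, h3 s hs.2, h1 s (by simp [hs])]
      · rintro (h | ⟨g, h5, h6, h7⟩)
        · exact .inl (.inl h)
        rcases (Nat.lt_succ_iff.1 h6).lt_or_eq with h | h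
        · exact .inl (.inr ⟨g, h5, h, h7⟩)
        · refine .inr ⟨g, fun s hs => ?_, h7⟩
          rcases eq_or_ne s r with rfl | hsr
          · rw [h, h2]
          · rw [h5 s (by simp [hs, hsr]), h1 s (by simp [hs, hsr])]
    · rintro k hk σ ⟨f', -, h2, h3⟩
      simp only [Test.Holds, (hbase _ _ _ h3).size_succ, hreg _ _ _ h3 r hr, h2]
      omega
    · rintro σ ⟨f', -, h2, h3⟩
      simp only [Test.Holds, (hbase _ _ _ h3).size_succ, hreg _ _ _ h3 r hr, h2]
      omega
    · rintro σ ⟨f', h1, -, h3⟩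
      refine ⟨f', h1, himp _ _ _ _ ?_ h3⟩
      rintro (h | ⟨g, h4, h5, h6⟩)
      · exact .inl h
      · exact .inr ⟨g, h4, Nat.lt_succ_iff.2 (h5 r (.head _)), fun s hs => h5 s (.tail _ hs), h6⟩

end Chores

namespace Chores

/-! ### Examination of an allocation -/


open RAM Finset

variable {N m : ℕ} {I : ChoreInstance 3 m}

/-- The number of a type. -/
def typCode (L : Typ) : ℕ :=
  (if L.1 then 4 else 0) + (if L.2.1 then 2 else 0) + (if L.2.2 then 1 else 0)

/-- The thresholds for the first agent that are stored in the registers. -/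
def uOf (f : ℕ → ℕ) (L : Typ) : ℕ := f (20 + typCode L)

/-- The thresholds for the second agent that are stored in the registers. -/
def vOf (f : ℕ → ℕ) (L : Typ) : ℕ := f (28 + typCode L)

/-- The weights that are stored in the registers. -/
def lamOf (f : ℕ → ℕ) (i : Fin 3) : Bool := decide (1 ≤ f (36 + i))

/-- The allocation described by the registers. -/
noncomputable def allocOf (I : ChoreInstance 3 m) (f : ℕ → ℕ) : Allocation 3 m :=
  thresh (ty I) (uOf f) (vOf f)

/-- The registers describe a solution. -/
def Good (I : ChoreInstance 3 m) (f : ℕ → ℕ) : Prop :=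
  Adm I (lamOf f) ∧ Compl I (lamOf f) (allocOf I f) ∧ I.EFX (allocOf I f)

/-! ### The smallest cost -/

/-- Replace the current minimum by a smaller value. -/
def keepMin (r : ℕ) : Program := .ite (.realLE r 0) (.op (.realAdd 0 r 1)) .skip

/-- The current minimum is a lower bound for the costs in `S`. -/
structure MinOf (I : ChoreInstance 3 m) (S : Fin 3 → Fin m → Prop) (σ : State) : Prop where
  base : Base I σ
  found : σ.natReg 5 = 0
  attained : 0 < m → ∃ i j, σ.realReg 0 = I.d i j
  le : ∀ i j, S i j → σ.realReg 0 ≤ I.d i j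

theorem Tr.keepMin (h : Fin 3) (j : Fin m) (S : Fin 3 → Fin m → Prop) :
    Tr N (fun σ => Loaded I j σ ∧ MinOf I S σ) (keepMin (2 + h))
      (fun σ => Loaded I j σ ∧ MinOf I (fun i j' => S i j' ∨ i = h ∧ j' = j) σ) := by
  refine .ite (.op ?_) (.skip ?_)
  · rintro σ ⟨⟨hl, hm⟩, hb⟩
    have e : (Op.realAdd 0 (2 + h) 1).exec σ =
        { σ with realReg := Function.update σ.realReg 0 (I.d h j) } := by
      simp [Op.exec, hl.cost, hm.base.real_zero]
    simp only [Test.Holds, hl.cost] at hb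
    rw [e]
    refine ⟨hl.congr (fun _ _ _ => rfl) (fun r hr _ => ?_),
      hm.base.congr (fun _ _ => rfl) ?_ rfl, hm.found, fun _ => ⟨h, j, ?_⟩, ?_⟩
    · exact Function.update_of_ne (by omega) _ _
    · simp
    · simp
    · intro i j' hij
      change Function.update σ.realReg 0 _ 0 ≤ _
      rw [Function.update_self]
      rcases hij with hij | ⟨rfl, rfl⟩
      · exact hb.trans (hm.le i j' hij)
      · exact le_rfl
  · rintro σ ⟨⟨hl, hm⟩, hb⟩
    simp only [Test.Holds, hl.cost, not_le] at hb
    refine ⟨hl, hm.base, hm.found, hm.attained, ?_⟩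
    rintro i j' (hij | ⟨rfl, rfl⟩)
    exacts [hm.le i j' hij, hb.le]

/-- Compute the smallest cost. -/
def findMin : Program := forChores (.seq (keepMin 2) (.seq (keepMin 3) (keepMin 4)))

theorem Tr.findMin (hN : m ≤ N) :
    Tr N (MinOf I fun _ j => (j : ℕ) < 0) findMin (MinOf I fun _ j => (j : ℕ) < m) := by
  refine Tr.forChores (Q := fun k => MinOf I fun _ j => (j : ℕ) < k) hN (fun _ _ h => h.base)
    (fun k σ σ' h hs => ⟨h.base.congr (fun r hr => hs.natReg r (by omega)) (hs.realReg 1 (by omega))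
      hs.realMem, (hs.natReg 5 (by omega)).trans h.found, ?_, ?_⟩) fun j => ?_
  · rw [hs.realReg 0 (by omega)]; exact h.attained
  · rw [hs.realReg 0 (by omega)]; exact h.le
  · refine Tr.mono (.seq (Tr.keepMin 0 j fun _ j' => (j' : ℕ) < j)
      (.seq (Tr.keepMin 1 j _) (Tr.keepMin 2 j _))) (fun _ h => h) ?_
    rintro σ ⟨hl, hm⟩
    refine ⟨hl, hm.base, hm.found, hm.attained, fun i j' hj' => hm.le i j' ?_⟩
    rcases (Nat.lt_succ_iff.1 hj').lt_or_eq with h | h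
    · exact .inl (.inl (.inl h))
    · obtain rfl := Fin.ext h
      fin_cases i
      exacts [.inl (.inl (.inr ⟨rfl, rfl⟩)), .inl (.inr ⟨rfl, rfl⟩), .inr ⟨rfl, rfl⟩]

/-- The constants, the smallest cost, and the registers that are searched through. -/
structure Env (I : ChoreInstance 3 m) (f : ℕ → ℕ) (σ : State) : Prop where
  base : Base I σ
  low : ∀ i j, I.d i j ≤ σ.realReg 0 ↔ isLow I i j = true
  reg : ∀ r, 20 ≤ r → σ.natReg r = f r

theorem Env.congr {f : ℕ → ℕ} {σ σ' : State} (h : Env I f σ)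
    (h1 : ∀ r, r < 5 ∨ 12 < r → σ'.natReg r = σ.natReg r)
    (h2 : ∀ r < 2, σ'.realReg r = σ.realReg r) (h3 : σ'.realMem = σ.realMem) : Env I f σ' :=
  ⟨h.base.congr (fun r hr => h1 r (by omega)) (h2 1 (by omega)) h3,
    by rw [h2 0 (by omega)]; exact h.low, fun r hr => (h1 r (by omega)).trans (h.reg r hr)⟩

theorem MinOf.env {σ : State} (h : MinOf I (fun _ j => (j : ℕ) < m) σ) : Env I σ.natReg σ := by
  refine ⟨h.base, fun i j => ?_, fun _ _ => rfl⟩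
  rw [isLow, decide_eq_true_iff]
  refine ⟨fun hij i' j' => hij.trans (h.le i' j' j'.2), fun hij => ?_⟩
  obtain ⟨i', j', e⟩ := h.attained (Fin.pos j)
  rw [e]
  exact hij i' j'

/-! ### Case distinctions for a chore -/

/-- Determine the type of the current chore, the weights, and the agent who receives the
chore. -/
def classify (F : Typ → (Fin 3 → Bool) → Fin 3 → Program) : Program :=
  branch (.realLE 2 0) fun a => branch (.realLE 3 0) fun b => branch (.realLE 4 0) fun c =>
  branch (.natLE 2 36) fun k => branch (.natLE 2 37) fun l => branch (.natLE 2 38) fun n =>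
  branch (.natLE 8 (20 + typCode (a, b, c))) fun p =>
  branch (.natLE 8 (28 + typCode (a, b, c))) fun q =>
  F (a, b, c) ![k, l, n] (if p then 0 else if q then 1 else 2)

theorem tame_classify {F : Typ → (Fin 3 → Bool) → Fin 3 → Program}
    (h : ∀ L lam i, Tame (F L lam i)) : Tame (classify F) :=
  tame_branch fun _ => tame_branch fun _ => tame_branch fun _ => tame_branch fun _ =>
  tame_branch fun _ => tame_branch fun _ => tame_branch fun _ => tame_branch fun _ => h _ _ _

theorem Tr.classify {f : ℕ → ℕ} {j : Fin m} {A B : State → Prop}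
    {F : Typ → (Fin 3 → Bool) → Fin 3 → Program} (hA : ∀ σ, A σ → Loaded I j σ ∧ Env I f σ)
    (h : Tr N A (F (ty I j) (lamOf f) (allocOf I f j)) B) : Tr N A (classify F) B := by
  have hlam : ∀ i : Fin 3, ∀ σ, A σ →
      ((Test.natLE 2 (36 + i)).Holds σ ↔ decide (1 ≤ f (36 + i)) = true) := by
    intro i σ hσ
    have h2 := (hA σ hσ).2
    simp only [Test.Holds, h2.base.one, h2.reg (36 + i) (by omega), decide_eq_true_iff]
  have hlow : ∀ i : Fin 3, ∀ σ, A σ →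
      ((Test.realLE (2 + i) 0).Holds σ ↔ isLow I i j = true) := by
    intro i σ hσ
    simp only [Test.Holds, (hA σ hσ).1.cost, (hA σ hσ).2.low]
  have hreg : ∀ r, 20 ≤ r → ∀ σ, A σ →
      ((Test.natLE 8 r).Holds σ ↔ decide ((j : ℕ) < f r) = true) := by
    intro r hr σ hσ
    simp only [Test.Holds, (hA σ hσ).1.cur_succ, (hA σ hσ).2.reg r hr, decide_eq_true_iff,
      Nat.succ_le_iff]
  refine .branch _ (hlow 0) (.branch _ (hlow 1) (.branch _ (hlow 2) (.branch _ (hlam 0)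
    (.branch _ (hlam 1) (.branch _ (hlam 2) (.branch _ (hreg _ (by omega))
    (.branch _ (hreg _ (by omega)) ?_)))))))
  convert h using 1
  congr 1
  · funext i
    fin_cases i <;> rfl
  · simp only [decide_eq_true_iff]
    rfl

/-! ### Checking an allocation -/

/-- The cost for `h` of the chores with number less than `k` in the bundle of `i`. -/
noncomputable def costTo (I : ChoreInstance 3 m) (x : Allocation 3 m) (k : ℕ) (h i : Fin 3) : ℝ :=
  ∑ j ∈ univ.filter (fun j : Fin m => (j : ℕ) < k ∧ x j = i), I.d h j

theorem costTo_zero (x : Allocation 3 m) (h i : Fin 3) : costTo I x 0 h i = 0 := by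
  simp [costTo]

theorem costTo_size (x : Allocation 3 m) (h i : Fin 3) :
    costTo I x m h i = I.cost h (x.bundle i) := by
  simp [costTo, ChoreInstance.cost, Allocation.bundle]

theorem costTo_succ (x : Allocation 3 m) (j : Fin m) (h i : Fin 3) :
    costTo I x (j + 1) h i = costTo I x j h i + if x j = i then I.d h j else 0 := by
  have e : ∀ k, costTo I x k h i = ∑ j' : Fin m, if (j' : ℕ) < k ∧ x j' = i then I.d h j' else 0 :=
    fun k => sum_filter _ _
  rw [e, e, ← sub_eq_iff_eq_add', ← sum_sub_distrib, sum_eq_single j]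
  · simp
  · intro j' _ hj'
    have : (j' : ℕ) < j + 1 ↔ (j' : ℕ) < j := by
      have := Fin.val_ne_of_ne hj'
      omega
    simp [this]
  · simp

/-- The first `k` chores have been assigned, and the allocation has not been discarded if and only
if `p` holds. -/
structure Work (I : ChoreInstance 3 m) (f : ℕ → ℕ) (k : ℕ) (p : Prop) (σ : State) : Prop where
  env : Env I f σ
  found : σ.natReg 5 = 0
  mem : ∀ j : Fin m, (j : ℕ) < k → σ.natMem j = allocOf I f j
  ok : 0 < σ.natReg 6 ↔ p
  acc : ∀ h i : Fin 3, σ.realReg (10 + 3 * h + i) = costTo I (allocOf I f) k h i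

theorem Work.of_iff {f : ℕ → ℕ} {k : ℕ} {p q : Prop} {σ : State} (h : Work I f k p σ)
    (hpq : p ↔ q) : Work I f k q σ := ⟨h.env, h.found, h.mem, h.ok.trans hpq, h.acc⟩

theorem Work.sameOutside {f : ℕ → ℕ} {k : ℕ} {p : Prop} {σ σ' : State} (h : Work I f k p σ)
    (hs : SameOutside σ σ') : Work I f k p σ' :=
  ⟨h.env.congr (fun r hr => hs.natReg r (by omega)) (fun r hr => hs.realReg r (by omega))
    hs.realMem, (hs.natReg 5 (by omega)).trans h.found, fun j hj => by rw [hs.natMem, h.mem j hj],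
    by rw [hs.natReg 6 (by omega)]; exact h.ok,
    fun a i => (hs.realReg _ (by omega)).trans (h.acc a i)⟩

/-- Discard the current allocation. -/
def discard : Program := .op (.natConst 6 0)

theorem Tr.discard {f : ℕ → ℕ} {k : ℕ} {p q : Prop} {A : State → Prop}
    (hA : ∀ σ, A σ → A ((Op.natConst 6 0).exec σ)) (hq : ¬ q) :
    Tr N (fun σ => A σ ∧ Work I f k p σ) discard (fun σ => A σ ∧ Work I f k q σ) := by
  refine .op fun σ hσ => ⟨hA σ hσ.1, ?_⟩
  obtain ⟨-, h⟩ := hσ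
  refine ⟨h.env.congr (fun r hr => ?_) (fun _ _ => rfl) rfl, h.found, h.mem, ?_, h.acc⟩
  · exact Function.update_of_ne (by omega) _ _
  · simp [Op.exec, hq]

theorem Tr.discard_unless {f : ℕ → ℕ} {k : ℕ} {p c : Prop} {b : Test} {A : State → Prop}
    (hA : ∀ σ, A σ → A ((Op.natConst 6 0).exec σ))
    (hb : ∀ σ, A σ → Work I f k p σ → (b.Holds σ ↔ c)) :
    Tr N (fun σ => A σ ∧ Work I f k p σ) (.ite b .skip Chores.discard)
      (fun σ => A σ ∧ Work I f k (p ∧ c) σ) := by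
  by_cases hc : c
  · exact .ite (.skip fun σ hσ => ⟨hσ.1.1, hσ.1.2.of_iff (by simp [hc])⟩)
      fun σ hσ => (hσ.2 ((hb σ hσ.1.1 hσ.1.2).2 hc)).elim
  · exact .ite (fun σ hσ => (hc ((hb σ hσ.1.1 hσ.1.2).1 hσ.2)).elim)
      ((Tr.discard hA (by simp [hc])).mono (fun _ h => h.1) fun _ h => h)

theorem Tr.discard_if {f : ℕ → ℕ} {k : ℕ} {p c : Prop} {b : Test} {A : State → Prop}
    (hA : ∀ σ, A σ → A ((Op.natConst 6 0).exec σ))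
    (hb : ∀ σ, A σ → Work I f k p σ → (b.Holds σ ↔ ¬ c)) :
    Tr N (fun σ => A σ ∧ Work I f k p σ) (.ite b Chores.discard .skip)
      (fun σ => A σ ∧ Work I f k (p ∧ c) σ) := by
  by_cases hc : c
  · exact .ite (fun σ hσ => ((hb σ hσ.1.1 hσ.1.2).1 hσ.2 hc).elim)
      (.skip fun σ hσ => ⟨hσ.1.1, hσ.1.2.of_iff (by simp [hc])⟩)
  · exact .ite ((Tr.discard hA (by simp [hc])).mono (fun _ h => h.1) fun _ h => h)
      fun σ hσ => (hσ.2 ((hb σ hσ.1.1 hσ.1.2).2 hc)).elim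

theorem Loaded.discard {j : Fin m} {σ : State} (h : Loaded I j σ) :
    Loaded I j ((Op.natConst 6 0).exec σ) :=
  h.congr (fun _ _ _ => Function.update_of_ne (by omega) _ _) fun _ _ _ => rfl

/-- Discard the allocation if chores of type `L` may not be assigned to `i`. -/
def checkPattern (L : Typ) (lam : Fin 3 → Bool) (i : Fin 3) : Program :=
  if ∀ h, lev lam L i ≤ lev lam L h then .skip else discard

/-- Discard the allocation if the weights require the costs to be positive, and some cost of the
current chore is not. -/
def checkPositive (lam : Fin 3 → Bool) : Program :=
  if ∀ i, lam i = false then .skip else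
    .seq (.ite (.realLE 2 1) discard .skip) (.seq (.ite (.realLE 3 1) discard .skip)
      (.ite (.realLE 4 1) discard .skip))

/-- Assign the current chore to `i`. -/
def assign (i : Fin 3) : Program :=
  block [.natStore 7 (![3, 2, 13] i), .realAdd (10 + i) (10 + i) 2, .realAdd (13 + i) (13 + i) 3,
    .realAdd (16 + i) (16 + i) 4]

/-- The assignment of `j` agrees with the pattern, and its costs are positive if necessary. -/
def Conforms (I : ChoreInstance 3 m) (f : ℕ → ℕ) (j : Fin m) : Prop :=
  (∀ h, lev (lamOf f) (ty I j) (allocOf I f j) ≤ lev (lamOf f) (ty I j) h) ∧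
    ((∀ i, lamOf f i = false) ∨ ∀ h, 0 < I.d h j)

theorem Tr.checkPattern {f : ℕ → ℕ} {k : ℕ} {p : Prop} (j : Fin m) (L : Typ) (lam : Fin 3 → Bool)
    (i : Fin 3) : Tr N (fun σ => Loaded I j σ ∧ Work I f k p σ) (checkPattern L lam i)
      (fun σ => Loaded I j σ ∧ Work I f k (p ∧ ∀ h, lev lam L i ≤ lev lam L h) σ) := by
  unfold Chores.checkPattern
  split_ifs with hc
  · exact .skip fun σ hσ => ⟨hσ.1, hσ.2.of_iff (by simp [hc])⟩
  · exact Tr.discard (fun _ h => h.discard) (fun h => hc h.2)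

theorem Tr.checkPositive {f : ℕ → ℕ} {k : ℕ} {p : Prop} (j : Fin m) (lam : Fin 3 → Bool) :
    Tr N (fun σ => Loaded I j σ ∧ Work I f k p σ) (checkPositive lam)
      (fun σ => Loaded I j σ ∧ Work I f k (p ∧ ((∀ i, lam i = false) ∨ ∀ h, 0 < I.d h j)) σ) := by
  unfold Chores.checkPositive
  split_ifs with hc
  · exact .skip fun σ hσ => ⟨hσ.1, hσ.2.of_iff (by simp [hc])⟩
  · have key : ∀ (h : Fin 3) (p : Prop), Tr N (fun σ => Loaded I j σ ∧ Work I f k p σ)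
        (.ite (.realLE (2 + h) 1) Chores.discard .skip)
        (fun σ => Loaded I j σ ∧ Work I f k (p ∧ 0 < I.d h j) σ) := fun h p =>
      Tr.discard_if (A := Loaded I j) (fun _ h => h.discard) fun σ hl hw => by
        simp only [Test.Holds, hl.cost, hw.env.base.real_zero, not_lt]
    refine Tr.mono (.seq (key 0 _) (.seq (key 1 _) (key 2 _))) (fun _ h => h)
      fun σ hσ => ⟨hσ.1, hσ.2.of_iff ?_⟩
    rw [Fin.forall_fin_succ (P := fun h => 0 < I.d h j), Fin.forall_fin_two]
    simp only [hc, false_or, and_assoc]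
    rfl

theorem Tr.assign {f : ℕ → ℕ} {p : Prop} (j : Fin m) :
    Tr N (fun σ => Loaded I j σ ∧ Work I f j p σ) (assign (allocOf I f j))
      (fun σ => Loaded I j σ ∧ Work I f (j + 1) p σ) := by
  refine .block ?_
  rintro σ ⟨hl, hw⟩
  have h0 := hl.cost 0
  have h1 := hl.cost 1
  have h2 := hl.cost 2
  have hi : σ.natReg (![3, 2, 13] (allocOf I f j)) = allocOf I f j := by
    have hb := hw.env.base
    generalize allocOf I f j = i
    fin_cases i
    exacts [hb.zero, hb.one, hb.two]
  have hlt := (allocOf I f j).2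
  refine ⟨hl.congr (fun _ _ _ => rfl) (fun r hr hr' => ?_),
    hw.env.congr (fun _ _ => rfl) (fun r hr => ?_) rfl, hw.found, fun j' hj' => ?_, hw.ok, ?_⟩
  · simp only [List.foldl_cons, List.foldl_nil, Op.exec]
    iterate 3 rw [Function.update_of_ne (by omega)]
  · simp only [List.foldl_cons, List.foldl_nil, Op.exec]
    iterate 3 rw [Function.update_of_ne (by omega)]
  · simp only [List.foldl_cons, List.foldl_nil, Op.exec, hi, hl.cur]
    rcases eq_or_ne j' j with rfl | hne
    · rw [Function.update_self]
    · have := Fin.val_ne_of_ne hne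
      rw [Function.update_of_ne this]
      exact hw.mem j' (by omega)
  · intro h i
    have ha := hw.acc h i
    have hi' := i.2
    rw [costTo_succ, ← ha]
    simp only [← Fin.val_inj]
    generalize (allocOf I f j).val = a at *
    simp only [List.foldl_cons, List.foldl_nil, Op.exec, Function.update_apply]
    fin_cases h
    all_goals
      simp only [Fin.zero_eta, Fin.mk_one, Fin.reduceFinMk]
      split_ifs
    all_goals first
      | omega
      | simp_all

/-- Process the current chore, of type `L`, which is assigned to `i`. -/
def addChore (L : Typ) (lam : Fin 3 → Bool) (i : Fin 3) : Program :=
  .seq (checkPattern L lam i) (.seq (checkPositive lam) (assign i))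

/-- Discard the allocation if `i`, who owns the current chore, envies `h` without it. -/
def checkEnvy (i h : Fin 3) : Program := .ite (.realLE 5 (10 + 3 * i + h)) .skip discard

/-- Discard the allocation if `i`, who owns the current chore, is envious without it. -/
def checkChore (i : Fin 3) : Program :=
  .seq (.op (.realSub 5 (10 + 3 * i + i) (2 + i)))
    (.seq (checkEnvy i 0) (.seq (checkEnvy i 1) (checkEnvy i 2)))

/-- The owner of the chore `j` does not envy anybody after its removal. -/
def NoEnvy (I : ChoreInstance 3 m) (x : Allocation 3 m) (j : Fin m) : Prop :=
  ∀ h, costTo I x m (x j) (x j) - I.d (x j) j ≤ costTo I x m (x j) h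

theorem Tr.addChore {f : ℕ → ℕ} {p : Prop} (j : Fin m) :
    Tr N (fun σ => Loaded I j σ ∧ Work I f j p σ)
      (addChore (ty I j) (lamOf f) (allocOf I f j))
      (fun σ => Loaded I j σ ∧ Work I f (j + 1) (p ∧ Conforms I f j) σ) :=
  Tr.mono (.seq (.checkPattern j _ _ _) (.seq (.checkPositive j _) (.assign j))) (fun _ h => h)
    fun _ hσ => ⟨hσ.1, hσ.2.of_iff (by rw [Conforms, and_assoc])⟩

theorem Tr.checkChore {f : ℕ → ℕ} {p : Prop} (j : Fin m) :
    Tr N (fun σ => Loaded I j σ ∧ Work I f m p σ) (checkChore (allocOf I f j))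
      (fun σ => Loaded I j σ ∧ Work I f m (p ∧ NoEnvy I (allocOf I f) j) σ) := by
  generalize hi : allocOf I f j = i
  set v := costTo I (allocOf I f) m i i - I.d i j with hv
  have key : ∀ (h : Fin 3) (p : Prop),
      Tr N (fun σ => (Loaded I j σ ∧ σ.realReg 5 = v) ∧ Work I f m p σ) (checkEnvy i h)
        (fun σ => (Loaded I j σ ∧ σ.realReg 5 = v) ∧
          Work I f m (p ∧ v ≤ costTo I (allocOf I f) m i h) σ) := fun h p =>
    Tr.discard_unless (A := fun σ => Loaded I j σ ∧ σ.realReg 5 = v)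
      (fun _ h => ⟨h.1.discard, h.2⟩) fun σ hl hw => by
      simp only [Test.Holds, hl.2, hw.acc]
  refine Tr.seq (B := fun σ => (Loaded I j σ ∧ σ.realReg 5 = v) ∧ Work I f m p σ) (.op ?_)
    (Tr.mono (.seq (key 0 _) (.seq (key 1 _) (key 2 _))) (fun _ h => h)
      fun σ hσ => ⟨hσ.1.1, hσ.2.of_iff ?_⟩)
  · rintro σ ⟨hl, hw⟩
    refine ⟨⟨hl.congr (fun _ _ _ => rfl) fun r _ _ => ?_, ?_⟩,
      hw.env.congr (fun _ _ => rfl) (fun r hr => ?_) rfl, hw.found, hw.mem, hw.ok, fun h i => ?_⟩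
    · exact Function.update_of_ne (by omega) _ _
    · simp [Op.exec, hw.acc, hl.cost, hv]
    · exact Function.update_of_ne (by omega) _ _
    · rw [← hw.acc h i]
      exact Function.update_of_ne (by omega) _ _
  · rw [NoEnvy, hi, ← hv, Fin.forall_fin_succ, Fin.forall_fin_two]
    simp only [and_assoc]
    rfl

/-- A chore determines its owner, so EFX can be tested chore by chore against the three bundles.
Admissibility of the weights likewise splits into a condition on each chore. -/
theorem good_iff {f : ℕ → ℕ} :
    Good I f ↔ (∀ j, Conforms I f j) ∧ ∀ j, NoEnvy I (allocOf I f) j := by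
  have h1 : (Adm I (lamOf f) ∧ Compl I (lamOf f) (allocOf I f)) ↔ ∀ j, Conforms I f j := by
    constructor
    · rintro ⟨ha, hc⟩ j
      refine ⟨hc j, ?_⟩
      by_contra! h
      obtain ⟨⟨i, hi⟩, h, hh⟩ := h
      exact hi (ha ⟨h, j, hh⟩ i)
    · intro h
      refine ⟨?_, fun j => (h j).1⟩
      rintro ⟨i, j, hij⟩
      exact (h j).2.resolve_right fun h => hij.not_gt (h i)
  have h2 : I.EFX (allocOf I f) ↔ ∀ j, NoEnvy I (allocOf I f) j := by
    have hc : ∀ j, I.cost (allocOf I f j) (((allocOf I f).bundle (allocOf I f j)).erase j) =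
        costTo I (allocOf I f) m (allocOf I f j) (allocOf I f j) - I.d (allocOf I f j) j :=
      fun j => by
        rw [costTo_size, ChoreInstance.cost, ChoreInstance.cost,
          sum_erase_eq_sub (by simp [Allocation.bundle])]
    constructor
    · intro h j a
      rw [← hc, costTo_size]
      exact h _ a j (by simp [Allocation.bundle])
    · intro h i a j hj
      obtain rfl : allocOf I f j = i := by simpa [Allocation.bundle] using hj
      rw [hc, ← costTo_size]
      exact h j a
  rw [Good, ← and_assoc, h1, h2]

end Chores

namespace Chores

/-! ### The search for a solution -/


open RAM Finset

variable {N m : ℕ} {I : ChoreInstance 3 m}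

/-- Forget the allocation that has been examined before. -/
def reset : Program :=
  block [.natConst 6 1, .realAdd 10 1 1, .realAdd 11 1 1, .realAdd 12 1 1, .realAdd 13 1 1,
    .realAdd 14 1 1, .realAdd 15 1 1, .realAdd 16 1 1, .realAdd 17 1 1, .realAdd 18 1 1]

/-- Unless a solution has been found, examine the allocation described by the registers. -/
def examine : Program :=
  .ite (.natLE 2 5) .skip (.seq reset (.seq (forChores (classify addChore))
    (.seq (forChores (classify fun _ _ => checkChore)) (.op (.natAdd 5 6 3)))))

/-- The state during the search for a solution; if `p` holds, then it has been found. -/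
structure Search (I : ChoreInstance 3 m) (f : ℕ → ℕ) (p : Prop) (σ : State) : Prop where
  env : Env I f σ
  sound : 0 < σ.natReg 5 → ∃ x : Allocation 3 m, σ.Encodes x ∧ I.EFX x ∧ I.FPO x
  found : p → 0 < σ.natReg 5

theorem Tr.reset {f : ℕ → ℕ} :
    Tr N (fun σ => Env I f σ ∧ σ.natReg 5 = 0) reset (Work I f 0 True) := by
  refine .block ?_
  rintro σ ⟨he, h5⟩
  refine ⟨he.congr (fun r hr => ?_) (fun r hr => ?_) rfl, ?_, ?_, ?_, fun h i => ?_⟩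
  · simp only [List.foldl_cons, List.foldl_nil, Op.exec]
    rw [Function.update_of_ne (by omega)]
  · simp only [List.foldl_cons, List.foldl_nil, Op.exec]
    iterate 9 rw [Function.update_of_ne (by omega)]
  · simp [Op.exec, h5]
  · intro j hj; omega
  · simp [Op.exec]
  · rw [costTo_zero]
    fin_cases h <;> fin_cases i <;> simp [Op.exec, he.base.real_zero]

theorem Tr.examine (hI : I.Bivalued) (hN : m ≤ N) (f : ℕ → ℕ) (p : Prop) :
    Tr N (Search I f p) examine (Search I f (p ∨ Good I f)) := by
  by_cases hp : p
  -- After a success nothing is examined, so the allocation stored in memory is not overwritten.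
  · refine .ite (.skip fun σ h => ⟨h.1.env, h.1.sound, fun _ => h.1.found hp⟩) fun σ ⟨hs, hb⟩ => ?_
    rw [Test.Holds, hs.env.base.one] at hb
    exact absurd (hs.found hp) hb
  refine .ite (.skip ?_) (.seq (Tr.mono (Tr.reset (I := I) (f := f)) ?_ fun _ h => h) (.seq
    (B := Work I f m (∀ j : Fin m, (j : ℕ) < m → Conforms I f j)) ?_ (.seq
    (B := Work I f m ((∀ j : Fin m, (j : ℕ) < m → Conforms I f j) ∧
      ∀ j : Fin m, (j : ℕ) < m → NoEnvy I (allocOf I f) j)) ?_ (.op ?_))))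
  · rintro σ ⟨hs, hb⟩
    rw [Test.Holds, hs.env.base.one] at hb
    exact ⟨hs.env, hs.sound, fun _ => hb⟩
  · rintro σ ⟨hs, hb⟩
    rw [Test.Holds, hs.env.base.one] at hb
    exact ⟨hs.env, by omega⟩
  · refine Tr.mono (Tr.forChores
      (Q := fun k => Work I f k (∀ j : Fin m, (j : ℕ) < k → Conforms I f j)) hN
      (fun _ _ h => h.env.base) (fun _ _ _ h hs => h.sameOutside hs) fun j => ?_)
      (fun σ hσ => hσ.of_iff (by simp)) fun _ h => h
    refine Tr.classify (fun σ hσ => ⟨hσ.1, hσ.2.env⟩) (Tr.mono (.addChore j) (fun _ h => h)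
      fun σ hσ => ⟨hσ.1, hσ.2.of_iff ⟨fun h k hk => ?_, fun h =>
        ⟨fun k hk => h k (by omega), h j (Nat.lt_succ_self _)⟩⟩⟩)
    rcases (Nat.lt_succ_iff.1 hk).lt_or_eq with hk | hk
    · exact h.1 k hk
    · rw [Fin.ext hk]; exact h.2
  · refine Tr.mono (Tr.forChores
      (Q := fun k => Work I f m ((∀ j : Fin m, (j : ℕ) < m → Conforms I f j) ∧
        ∀ j : Fin m, (j : ℕ) < k → NoEnvy I (allocOf I f) j)) hN
      (fun _ _ h => h.env.base) (fun _ _ _ h hs => h.sameOutside hs) fun j => ?_)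
      (fun σ hσ => hσ.of_iff (by simp)) fun _ h => h
    refine Tr.classify (fun σ hσ => ⟨hσ.1, hσ.2.env⟩) (Tr.mono (.checkChore j) (fun _ h => h)
      fun σ hσ => ⟨hσ.1, hσ.2.of_iff ⟨fun h => ⟨h.1.1, fun k hk => ?_⟩, fun h =>
        ⟨⟨h.1, fun k hk => h.2 k (by omega)⟩, h.2 j (Nat.lt_succ_self _)⟩⟩⟩)
    rcases (Nat.lt_succ_iff.1 hk).lt_or_eq with hk | hk
    · exact h.1.2 k hk
    · rw [Fin.ext hk]; exact h.2
  · intro σ hw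
    have e : (Op.natAdd 5 6 3).exec σ =
        { σ with natReg := Function.update σ.natReg 5 (σ.natReg 6) } := by
      simp [Op.exec, hw.env.base.zero]
    have hg : 0 < σ.natReg 6 ↔ Good I f := by
      rw [hw.ok, good_iff]
      simp
    rw [e]
    refine ⟨hw.env.congr (fun r hr => ?_) (fun _ _ => rfl) rfl, fun h5 => ?_, ?_⟩
    · exact Function.update_of_ne (by omega) _ _
    · change 0 < Function.update σ.natReg 5 _ 5 at h5
      rw [Function.update_self] at h5
      have := hg.1 h5
      exact ⟨allocOf I f, fun j => hw.mem j j.2, this.2.2, this.2.1.fpo hI this.1⟩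
    · intro h
      change 0 < Function.update σ.natReg 5 _ 5
      rw [Function.update_self]
      exact hg.2 (h.resolve_left hp)

/-! ### The complete program -/

/-- The registers that are searched through. -/
def searchRegs : List ℕ := List.range' 20 19

/-- Find an allocation that is EFX and fPO for an instance with three agents. -/
def solver : Program :=
  .seq (block [.natConst 2 1, .natConst 3 0, .natAdd 4 1 2, .natConst 13 2, .realLoad 0 3])
    (.seq findMin (loops searchRegs examine))

theorem exists_good (hI : I.Bivalued) (f : ℕ → ℕ) : ∃ g, (∀ s, s ∉ searchRegs → g s = f s) ∧
    (∀ s ∈ searchRegs, g s ≤ m + 1) ∧ Good I g := by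
  obtain ⟨lam, u, v, ha, huv, hc, he⟩ := exists_solution hI
  -- The inverse of `typCode`, reading off three binary digits.
  let dec : ℕ → Typ := fun k => (decide (4 ≤ k), decide (2 ≤ k % 4), decide (k % 2 = 1))
  have hdec : ∀ L, dec (typCode L) = L ∧ typCode L < 8 := by decide
  let g : ℕ → ℕ := fun s =>
    if s < 20 then f s else if s < 28 then u (dec (s - 20)) else if s < 36 then v (dec (s - 28))
    else if s = 36 then (lam 0).toNat else if s = 37 then (lam 1).toNat
    else if s = 38 then (lam 2).toNat else f s
  have hu : uOf g = u := funext fun L => by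
    obtain ⟨h1, h2⟩ := hdec L
    simp only [uOf, g]
    rw [if_neg (by omega), if_pos (by omega), Nat.add_sub_cancel_left, h1]
  have hv : vOf g = v := funext fun L => by
    obtain ⟨h1, h2⟩ := hdec L
    simp only [vOf, g]
    rw [if_neg (by omega), if_neg (by omega), if_pos (by omega), Nat.add_sub_cancel_left, h1]
  have hlam : lamOf g = lam := funext fun i => by
    fin_cases i
    · cases h : lam 0 <;> simp [lamOf, g, h]
    · cases h : lam 1 <;> simp [lamOf, g, h]
    · cases h : lam 2 <;> simp [lamOf, g, h]
  refine ⟨g, fun s hs => ?_, fun s hs => ?_, ?_⟩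
  · simp only [searchRegs, List.mem_range'_1] at hs
    simp only [g]
    split_ifs <;> first | rfl | omega
  · simp only [searchRegs, List.mem_range'_1] at hs
    simp only [g]
    -- The search bound `m + 1` leaves room for the weight bit `1` even if `m = 0`.
    have hb : ∀ b : Bool, b.toNat ≤ m + 1 := fun b => b.toNat_le.trans (by omega)
    split_ifs
    · omega
    · exact (huv _).1.trans (by omega)
    · exact (huv _).2.trans (by omega)
    all_goals first | exact hb _ | omega
  · rw [Good, allocOf, hu, hv, hlam]
    exact ⟨ha, hc, he⟩

theorem Tr.solver (hI : I.Bivalued) (hN : m + 2 ≤ N) :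
    Tr N (fun σ => σ = initState I) solver
      (fun σ => ∃ x : Allocation 3 m, σ.Encodes x ∧ I.EFX x ∧ I.FPO x) := by
  refine .seq (B := MinOf I fun _ j => (j : ℕ) < 0) (.block ?_) (.seq (.findMin (by omega)) ?_)
  · rintro _ rfl
    have hmem : ∀ (i : Fin 3) (j : Fin m),
        (initState I).realMem (3 * (j : ℕ) + (i : ℕ)) = I.d i j := by
      intro i j
      have h1 : (3 * (j : ℕ) + i) % 3 = i := by omega
      have h2 : (3 * (j : ℕ) + i) / 3 = j := by omega
      have h3 : 0 < 3 ∧ (3 * (j : ℕ) + i) / 3 < m := ⟨by omega, by omega⟩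
      simp only [initState]
      rw [dif_pos h3]
      congr 1
      · exact Fin.ext h1
      · exact Fin.ext h2
    refine ⟨⟨?_, ?_, ?_, ?_, ?_, ?_, ?_, hmem⟩, ?_, fun hm => ⟨0, ⟨0, hm⟩, ?_⟩, fun i j hj => ?_⟩
    · simp [Op.exec, initState]
    · simp [Op.exec, initState]
    · simp [Op.exec, initState]
    · simp [Op.exec, initState]
    · simp [Op.exec, initState]
    · simp [Op.exec, initState]
    · simp [Op.exec, initState]
    · simp [Op.exec, initState]
    · rw [← hmem 0 ⟨0, hm⟩]
      simp [Op.exec]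
    · omega
  · intro σ hσ
    have hs : Search I σ.natReg False σ :=
      ⟨hσ.env, fun h => by rw [hσ.found] at h; omega, False.elim⟩
    have hu : ∀ (f : ℕ → ℕ) (p : Prop) (σ : State) (r c : ℕ), 20 ≤ r → Search I f p σ →
        Search I (Function.update f r c) p { σ with natReg := Function.update σ.natReg r c } := by
      intro f p σ r c hr h
      refine ⟨⟨h.env.base.congr (fun s hs => Function.update_of_ne (by omega) _ _) rfl rfl,
        h.env.low, fun s hs => ?_⟩, ?_, ?_⟩
      · rcases eq_or_ne s r with rfl | hsr
        · simp
        · simp [hsr, h.env.reg s hs]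
      · simpa [show 5 ≠ r by omega, State.Encodes] using h.sound
      · simpa [show 5 ≠ r by omega] using h.found
    obtain ⟨σ', t, ht, hr, f', -, h⟩ := Tr.loops (I := I) (S := Search I) (G := Good I) hN
      (fun _ _ _ h => h.env.base) (fun _ _ _ h => h.env.reg)
      (fun _ _ _ _ hpq h => ⟨h.env, h.sound, fun hq => h.found (hpq hq)⟩) hu
      (fun f p => Tr.examine hI (by omega) f p) searchRegs
      (fun r hr => (List.mem_range'_1.1 hr).1) List.nodup_range' σ.natReg False σ hs
    exact ⟨σ', t, ht, hr, h.sound (h.found (.inr (exists_good hI _)))⟩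

theorem tame_solver : Tame solver := by
  have hd : Tame discard := Nat.zero_le 3
  have hk : ∀ r, Tame (keepMin r) := fun _ => ⟨trivial, trivial⟩
  have he : ∀ i h, Tame (checkEnvy i h) := fun _ _ => ⟨trivial, hd⟩
  have h1 : ∀ L lam i, Tame (addChore L lam i) := fun L lam i => by
    refine ⟨?_, ?_, tame_block (by simp [TameOp])⟩
    · unfold checkPattern
      split_ifs
      exacts [trivial, hd]
    · unfold checkPositive
      split_ifs
      exacts [trivial, ⟨⟨hd, trivial⟩, ⟨hd, trivial⟩, hd, trivial⟩]
  have h2 : ∀ i, Tame (checkChore i) := fun i => ⟨trivial, he i 0, he i 1, he i 2⟩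
  have h3 : Tame examine := ⟨trivial, tame_block (by simp [TameOp]),
    tame_forChores (tame_classify h1), tame_forChores (tame_classify fun _ _ => h2), trivial⟩
  exact ⟨tame_block (by simp [TameOp]), tame_forChores ⟨hk 2, hk 3, hk 4⟩, tame_loops h3 _⟩

theorem solver_halts (hI : I.Bivalued) : ∃ t ≤ (time solver).eval (3 + m), ∃ x : Allocation 3 m,
    (runFor solver (initState I) t).1 = [] ∧ (runFor solver (initState I) t).2.Encodes x ∧
      I.EFX x ∧ I.FPO x := by
  -- Loops over chores take `m` rounds and search loops `m + 2`, so `3 + m` bounds them all.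
  obtain ⟨σ, t, ht, hr, x, hx⟩ := Tr.solver hI (show m + 2 ≤ 3 + m by omega) _ rfl
  have h : runFor solver (initState I) t = ([], σ) := hr []
  exact ⟨t, ht, x, by rw [h], by rw [h]; exact hx⟩

theorem eval_mono (p : Polynomial ℕ) {a b : ℕ} (h : a ≤ b) : p.eval a ≤ p.eval b := by
  simp only [Polynomial.eval_eq_sum, Polynomial.sum]
  exact Finset.sum_le_sum fun i _ => by gcongr

theorem solver_spec : ComputesInStronglyPolyTime solver (fun n _ I => n = 3 ∧ I.Bivalued)
    (fun _ _ I x => I.EFX x ∧ I.FPO x) := by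
  refine ⟨⟨time solver, ?_⟩, 2 * time solver + 4 * Polynomial.X + 10, ?_⟩
  · rintro n m I ⟨rfl, hI⟩
    exact solver_halts hI
  · rintro n m I ⟨rfl, hI⟩ D hD t
    obtain ⟨T, hT, -, hh, -⟩ := solver_halts hI
    refine (fitsIn_of_tame tame_solver I D hD hh t).mono ?_
    have := eval_mono (time solver) (show 3 + m ≤ inputSize D by unfold inputSize; omega)
    simp only [Polynomial.eval_add, Polynomial.eval_mul, Polynomial.eval_X, Polynomial.eval_ofNat]
    omega

end Chores

theorem theorem4 :
    (∀ (m : ℕ) (I : ChoreInstance 3 m), I.Bivalued →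
      ∃ x : Allocation 3 m, I.EFX x ∧ I.FPO x) ∧
    ∃ P : RAM.Program, RAM.ComputesInStronglyPolyTime P
      (fun n _ I => n = 3 ∧ I.Bivalued)
      (fun _ _ I x => I.EFX x ∧ I.FPO x) :=
  ⟨fun _ => Chores.exists_efx_fpo, _, Chores.solver_spec⟩
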